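/- Let $\mathfrak{T}$ be the topological $N=2$ superconformal algebra: the complex Lie superalgebra with even basis elements $\mathcal L_k,\mathcal H_k$ ($k\in\mathbb Z$) and $C$, odd basis elements $\mathcal G_k,\mathcal Q_k$ ($k\in\mathbb Z$), $C$ central, and $$[\mathcal L_k,\mathcal L_l]=(k-l)\mathcal L_{k+l},\quad [\mathcal H_k,\mathcal H_l]=\tfrac C3 k\,\delta_{k+l,0},\quad [\mathcal L_k,\mathcal G_l]=(k-l)\mathcal G_{k+l},\quad [\mathcal H_k,\mathcal G_l]=\mathcal G_{k+l},$$ $$[\mathcal L_k,\mathcal Q_l]=-l\,\mathcal Q_{k+l},\quad [\mathcal H_k,\mathcal Q_l]=-\mathcal Q_{k+l},\quad [\mathcal L_k,\mathcal H_l]=-l\,\mathcal H_{k+l}+\tfrac C6(k^2+k)\delta_{k+l,0},$$ $$\{\mathcal G_k,\mathcal Q_l\}=2\mathcal L_{k+l}-2l\,\mathcal H_{k+l}+\tfrac C3(k^2+k)\delta_{k+l,0},\quad \{\mathcal G_k,\mathcal G_l\}=\{\mathcal Q_k,\mathcal Q_l\}=0 .$$ For $\Delta,q,c\in\mathbb C$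 let $\mathcal V^G_{\Delta,q}$ (respectively $\mathcal V^Q_{\Delta,q}$) be the Verma module over $U(\mathfrak T)$ induced from a highest weight vector on which $\mathcal L_0,\mathcal H_0,C$ act by $\Delta,q,c$ and which is annihilated by all $\mathcal L_k,\mathcal H_k,\mathcal G_k,\mathcal Q_k$ with $k>0$ and by $\mathcal G_0$ (respectively by $\mathcal Q_0$), no condition being imposed on the other odd zero mode. A singular vector at level $m$ with charge $n$ is a vector $\Psi$, not proportional to the highest weight vector, with $\mathcal L_0\Psi=(\Delta+m)\Psi$ and $\mathcal H_0\Psi=(q+n)\Psi$, annihilated by all $\mathcal L_k,\mathcal H_k,\mathcal G_k,\mathcal Q_k$ with $k>0$. It is $\mathcal G_0$-closed if $\mathcal G_0\Psi=0$ and $\mathcal Q_0\Psi\ne0$, and $\mathcal Q_0$-closed if $\mathcal Q_0\Psi=0$ and $\mathcal G_0\Psi\neq0$. A $\mathcal G_0$-closed (respectively $\mathcal Q_0$-closed) singular vector space at level $m$ with charge $n$ is a linear subspace of the Verma module all of whose nonzero elements are $\mathcal G_0$-closed (respectively $\mathcal Q_0$-closed) singular vectors at level $m$ with charge $n$. **Theorem.**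 Let $c,q\in\mathbb C$ with $c\neq 3$, let $m\ge 1$ be an integer, let $\Delta=-m$, and let $n\in\mathbb Z$. The dimension of every closed singular vector space at level $m$ with charge $n$ is at most the entry of the following table. | module | type of singular vectors | $n=-2$ | $n=-1$ | $n=0$ | $n=1$ | $n=2$ | |---|---|---|---|---|---|---| | $\mathcal V^G_{-m,q}$ | $\mathcal G_0$-closed | 0 | 0 | 1 | 1 | 0 | | $\mathcal V^G_{-m,q}$ | $\mathcal Q_0$-closed | 1 | 1 | 0 | 0 | 0 | | $\mathcal V^Q_{-m,q}$ | $\mathcal Q_0$-closed | 0 | 1 | 1 | 0 | 0 | | $\mathcal V^Q_{-m,q}$ | $\mathcal G_0$-closed | 0 | 0 | 0 | 1 | 1 | For integers $n$ not in the table the dimension is $0$. Where the dimension is $0$ there are no closed singular vectors of the given type, level and charge. -/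

import Mathlib

/-! The topological `N = 2` superconformal algebra, its generic Verma modules and
spaces of singular vectors in them. -/

noncomputable section

namespace TopN2

/-- Labels of the basis of the topological `N = 2` superconformal algebra: the even generators
`L n`, `H n`, `C` and the odd generators `G n`, `Q n`. -/
inductive Gen : Type
  | L (n : ℤ)
  | H (n : ℤ)
  | G (n : ℤ)
  | Q (n : ℤ)
  | C

open Gen

/-- A basis element, inside the free associative algebra on the basis. -/
abbrev gen (x : Gen) : FreeAlgebra ℂ Gen := FreeAlgebra.ι ℂ x

/-- The commutator in an associative algebra. -/
def sComm {A : Type*} [Ring A] (a b : A) : A := a * b - b * a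

/-- The anticommutator in an associative algebra. -/
def aComm {A : Type*} [Ring A] (a b : A) : A := a * b + b * a

/-- The (anti-)commutation relations of the topological `N = 2` superconformal algebra, imposed
on the free associative algebra. The generator `C` is central. -/
inductive TopRel : FreeAlgebra ℂ Gen → FreeAlgebra ℂ Gen → Prop
  | LL (m n : ℤ) : TopRel (sComm (gen (L m)) (gen (L n))) (((m : ℂ) - n) • gen (L (m + n)))
  | HH (m n : ℤ) : TopRel (sComm (gen (H m)) (gen (H n)))
      ((if m + n = 0 then (m : ℂ) / 3 else 0) • gen C)
  | LG (m n : ℤ) : TopRel (sComm (gen (L m)) (gen (G n))) (((m : ℂ) - n) • gen (G (m + n)))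
  | HG (m n : ℤ) : TopRel (sComm (gen (H m)) (gen (G n))) (gen (G (m + n)))
  | LQ (m n : ℤ) : TopRel (sComm (gen (L m)) (gen (Q n))) ((-(n : ℂ)) • gen (Q (m + n)))
  | HQ (m n : ℤ) : TopRel (sComm (gen (H m)) (gen (Q n))) (-gen (Q (m + n)))
  | LH (m n : ℤ) : TopRel (sComm (gen (L m)) (gen (H n)))
      ((-(n : ℂ)) • gen (H (m + n)) +
        (if m + n = 0 then ((m : ℂ) ^ 2 + m) / 6 else 0) • gen C)
  | GQ (m n : ℤ) : TopRel (aComm (gen (G m)) (gen (Q n)))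
      ((2 : ℂ) • gen (L (m + n)) - (2 * (n : ℂ)) • gen (H (m + n)) +
        (if m + n = 0 then ((m : ℂ) ^ 2 + m) / 3 else 0) • gen C)
  | GG (m n : ℤ) : TopRel (aComm (gen (G m)) (gen (G n))) 0
  | QQ (m n : ℤ) : TopRel (aComm (gen (Q m)) (gen (Q n))) 0
  | central (x : Gen) : TopRel (sComm (gen C) (gen x)) 0

/-- The universal enveloping algebra of the topological `N = 2` superconformal algebra: the
associative unital algebra generated by a basis of the Lie superalgebra, subject to the
supercommutators of the basis elements. -/
def U : Type := RingQuot TopRel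

instance : Ring U := inferInstanceAs (Ring (RingQuot TopRel))

instance : Algebra ℂ U := inferInstanceAs (Algebra ℂ (RingQuot TopRel))

/-- The quotient map from the free associative algebra. -/
def toU : FreeAlgebra ℂ Gen →ₐ[ℂ] U := RingQuot.mkAlgHom ℂ TopRel

/-- The image of a basis element in the enveloping algebra. -/
def u (x : Gen) : U := toU (gen x)

/-- The two kinds of closedness: annihilated by `G 0` only, or by `Q 0` only. -/
inductive Label : Type
  | G
  | Q

/-- The zero mode by which a vector with the given label is annihilated. -/
def Label.zeroMode : Label → Gen
  | .G => Gen.G 0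
  | .Q => Gen.Q 0

/-- The other label, so that `N.other.zeroMode` is the zero mode which does not annihilate a
vector with label `N`. -/
def Label.other : Label → Label
  | .G => .Q
  | .Q => .G

/-- The left ideal of the enveloping algebra generated by `L 0 - Δ`, `H 0 - q`, `C - c`, all
generators of positive index, and the zero mode belonging to the label `N`. -/
def vermaIdeal (N : Label) (Δ q c : ℂ) : Submodule U U :=
  Submodule.span U
    ({u (L 0) - algebraMap ℂ U Δ, u (H 0) - algebraMap ℂ U q, u C - algebraMap ℂ U c,
        u N.zeroMode} ∪
      {x | ∃ k : ℤ, 0 < k ∧ (x = u (L k) ∨ x = u (H k) ∨ x = u (G k) ∨ x = u (Q k))})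

/-- The generic Verma module with label `N`: the module over the enveloping algebra induced from
the one-dimensional module spanned by the highest weight vector, with `L 0`, `H 0`, `C` acting on
that vector by `Δ`, `q`, `c`, and with the generators of positive index and the zero mode of the
label `N` acting on it by `0`. -/
abbrev Verma (N : Label) (Δ q c : ℂ) : Type := U ⧸ vermaIdeal N Δ q c

/-- The highest weight vector. -/
def hwv (N : Label) (Δ q c : ℂ) : Verma N Δ q c := (vermaIdeal N Δ q c).mkQ 1

/-- `x` is a singular vector of level `m` and charge `n`: it is an eigenvector of `L 0` and `H 0`
with eigenvalues `Δ + m` and `q + n` (`C` acts on the whole module as `c`), it is annihilated by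
all generators of positive index, and it is not proportional to the highest weight vector (so in
particular it is not zero). -/
structure IsSingular {N : Label} {Δ q c : ℂ} (m : ℕ) (n : ℤ) (x : Verma N Δ q c) : Prop where
  level : u (L 0) • x = (Δ + m) • x
  charge : u (H 0) • x = (q + n) • x
  annL : ∀ k : ℤ, 0 < k → u (L k) • x = 0
  annH : ∀ k : ℤ, 0 < k → u (H k) • x = 0
  annG : ∀ k : ℤ, 0 < k → u (G k) • x = 0
  annQ : ∀ k : ℤ, 0 < k → u (Q k) • x = 0
  not_hwv : x ∉ Submodule.span ℂ {hwv N Δ q c}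

/-- `x` is a `K`-closed singular vector of level `m` and charge `n`: a singular vector annihilated
by the zero mode of `K` and not annihilated by the other odd zero mode. -/
structure IsClosedSingular {N : Label} {Δ q c : ℂ} (K : Label) (m : ℕ) (n : ℤ)
    (x : Verma N Δ q c) : Prop extends IsSingular m n x where
  ann : u K.zeroMode • x = 0
  not_ann : u K.other.zeroMode • x ≠ 0

/-- `W` is a `K`-closed singular vector space of level `m` and charge `n`: a linear subspace, each
nonzero element of which is a `K`-closed singular vector of level `m` and charge `n`. -/
def IsClosedSingularSpace {N : Label} {Δ q c : ℂ} (K : Label) (m : ℕ) (n : ℤ)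
    (W : Submodule ℂ (Verma N Δ q c)) : Prop :=
  ∀ x ∈ W, x ≠ 0 → IsClosedSingular K m n x

/-- The table of maximal dimensions of `K`-closed singular vector spaces of charge `n`, at level
`m`, in the Verma module with label `N` and with `Δ = -m`; the arguments are `N`, `K`, `n`. -/
def maxDim : Label → Label → ℤ → ℕ
  | .G, .G, 0 => 1
  | .G, .G, 1 => 1
  | .G, .Q, -2 => 1
  | .G, .Q, -1 => 1
  | .Q, .Q, -1 => 1
  | .Q, .Q, 0 => 1
  | .Q, .G, 1 => 1
  | .Q, .G, 2 => 1
  | _, _, _ => 0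

end TopN2

end

noncomputable section

/-! ### Induced modules of Lie superalgebras in terms of ordered monomials -/

namespace SuperPBW

open Finsupp

/-! At level `m` with `Δ = -m` a singular vector Ψ has conformal weight zero. If G_0 Ψ = 0, then G_0
Q_0 Ψ = 2 L_0 Ψ - Q_0 G_0 Ψ = 0, so Q_0 Ψ is chiral: it is killed by all positive modes and by both
odd zero modes (`IsClosedSingular.chiral`; the other label is symmetric). On a closed singular
vector space this zero mode is injective. It therefore suffices that chiral vectors of fixed level
and charge form a space of dimension at most one, which is zero unless the charge is 0 or -1 in V^G,
and 0 or 1 in V^Q. Shifting these charges by one gives the table. The mirror automorphism exchanging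
G and Q reduces V^Q to V^G.

In V^G, order the Poincaré–Birkhoff–Witt monomials with L_{-1} leftmost and write a nonzero chiral
vector as L_{-1}^a p + L_{-1}^{a-1} r + ..., where p ≠ 0 and p, r contain no L_{-1}. Applying a
generator x raises the power of L_{-1} by at most one; `raise x` is the coefficient that does so.
The top coefficient of x Ψ = 0 reads raise x p = 0. Since L_{-1} arises from Q_j with G_{-j-1}, from
G_j with Q_{-j-1} and from L_j with L_{-j-1}, these equations remove from p all letters except H_n
and Q_0 (`wordsIn_isH`).

The letters H_n need the next coefficient, keep x p + a raise [x, L_{-1}] p + raise x r = 0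
(`cf_op_eq`). For x = Q_j it reads raise Q_j r = -Q_j p, which determines the part of r that matters
to H_k. Substituted into the equation for H_k, this leaves an operator on p that deletes H_{-k} with
factor k(c - 3)/3 (`wordsIn_lt_of_second_order`). Here c ≠ 3 enters. Hence p lies in the span of 1
and Q_0; level and charge single out one monomial, and a chiral vector with zero coefficient there
vanishes (`IsChiral.topWord_mem`).

The monomial coordinates come from an explicit action on ordered words (`Data.comm`), which is
compared with the quotient of the enveloping algebra in `coords_injective`. -/

theorem map_eq_sum {α N : Type*} [AddCommGroup N] [Module ℂ N] (f : (α →₀ ℂ) →ₗ[ℂ] N)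
    (x : α →₀ ℂ) : f x = ∑ w ∈ x.support, x w • f (single w 1) := by
  conv_lhs => rw [← Finsupp.sum_single x]
  simp [Finsupp.sum, ← map_smul]

/-- Two linear maps agree on a finitely supported function if they agree on the basis vectors
of its support. -/
theorem map_eq_of_support {α N : Type*} [AddCommGroup N] [Module ℂ N]
    (f g : (α →₀ ℂ) →ₗ[ℂ] N) (x : α →₀ ℂ)
    (h : ∀ w ∈ x.support, f (single w 1) = g (single w 1)) : f x = g x := by
  rw [map_eq_sum f, map_eq_sum g]
  exact Finset.sum_congr rfl fun w hw => by rw [h w hw]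

/-- The image of a finitely supported function lies in a submodule if the images of the basis
vectors of its support do. -/
theorem map_mem_of_support {α N : Type*} [AddCommGroup N] [Module ℂ N]
    (f : (α →₀ ℂ) →ₗ[ℂ] N) (S : Submodule ℂ N) (x : α →₀ ℂ)
    (h : ∀ w ∈ x.support, f (single w 1) ∈ S) : f x ∈ S := by
  rw [map_eq_sum f]
  exact Submodule.sum_mem _ fun w hw => S.smul_mem _ (h w hw)

/-- Structure constants of a Lie superalgebra with a totally ordered homogeneous basis in which
every basis element supercommutes with itself, together with an initial segment `neg` of the
basis whose complement spans a subalgebra with a character `χ`. -/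
structure Data (ι : Type*) [LinearOrder ι] where
  sgn : ι → ι → ℂ
  br : ι → ι → ι →₀ ℂ
  neg : ι → Prop
  χ : ι → ℂ
  sgn_symm : ∀ i j, sgn i j = sgn j i
  sgn_sq : ∀ i j, sgn i j * sgn i j = 1
  sgn_br : ∀ i j k l, k ∈ (br i j).support → sgn k l = sgn i l * sgn j l
  br_swap : ∀ i j, br j i = -(sgn i j • br i j)
  br_self : ∀ i, br i i = 0
  jacobi : ∀ i j k, linearCombination ℂ (br i) (br j k) =
    linearCombination ℂ (fun l => br l k) (br i j) +
      sgn i j • linearCombination ℂ (br j) (br i k)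
  neg_lower : ∀ i j, i ≤ j → neg j → neg i
  χ_comm : ∀ i j, ¬ neg i → ¬ neg j → χ i * χ j = sgn i j * (χ j * χ i)
  br_pos : ∀ i j, ¬ neg i → ¬ neg j → ∀ k ∈ (br i j).support, ¬ neg k
  χ_br : ∀ i j, ¬ neg i → ¬ neg j → linearCombination ℂ χ (br i j) = 0

variable {ι : Type*} [LinearOrder ι] (A : Data ι)

namespace Data

/-- The letter `i` may be put in front of the ordered word `w`. -/
def Ok (i : ι) (w : List ι) : Prop :=
  A.neg i ∧ ∀ j ∈ w.head?, i < j ∨ (i = j ∧ A.sgn i i = 1)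

/-- Ordered words. -/
def Std : List ι → Prop
  | [] => True
  | i :: w => A.Ok i w ∧ Std w

open Classical in
/-- The action of the letter `i` on the word `w`; the first argument bounds the depth of the
recursion and has to be at least the length of `w`. -/
def act : ℕ → ι → List ι → (List ι →₀ ℂ)
  -- The final 0, for a nonempty word at depth zero, is a junk value; it is not reached once the
  -- depth is at least the length of the word.
  | 0, i, w => if A.Ok i w then single (i :: w) 1 else if w = [] then single [] (A.χ i) else 0
  | n + 1, i, w => if A.Ok i w then single (i :: w) 1 else
      match w with
      | [] => single [] (A.χ i)
      -- On an ordered word, equality of letters is reached here only for an odd letter, whose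
      -- square vanishes because `br i i = 0`.
      | j :: w' => if i = j then 0 else
          A.sgn i j • linearCombination ℂ (act n j) (act n i w') +
            linearCombination ℂ (fun k => act n k w') (A.br i j)

theorem act_ok {n : ℕ} {i : ι} {w : List ι} (h : A.Ok i w) : A.act n i w = single (i :: w) 1 := by
  cases n <;> simp [act, h]

theorem act_nil {n : ℕ} {i : ι} (h : ¬ A.neg i) : A.act n i [] = single [] (A.χ i) := by
  have : ¬ A.Ok i [] := fun h' => h h'.1
  cases n <;> simp [act, this]

theorem act_eq {n : ℕ} {i : ι} {w : List ι} (h : ¬ A.Ok i (i :: w)) :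
    A.act (n + 1) i (i :: w) = 0 := by
  simp [act, h]

theorem act_cons {n : ℕ} {i j : ι} {w : List ι} (h : ¬ A.Ok i (j :: w)) (hij : i ≠ j) :
    A.act (n + 1) i (j :: w) = A.sgn i j • linearCombination ℂ (A.act n j) (A.act n i w) +
      linearCombination ℂ (fun k => A.act n k w) (A.br i j) := by
  simp [act, h, hij]

theorem ok_nil {i : ι} : A.Ok i [] ↔ A.neg i := by simp [Ok]

theorem ok_cons_of_lt {i j : ι} {w : List ι} (hj : A.neg j) (h : i < j) : A.Ok i (j :: w) :=
  ⟨A.neg_lower _ _ h.le hj, by simp [h]⟩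

/-- If `i` may not be put in front of an ordered nonempty word, it is the first letter or larger. -/
theorem lt_of_not_ok {i j : ι} {w : List ι} (hw : A.Std (j :: w)) (h : ¬ A.Ok i (j :: w))
    (hij : i ≠ j) : j < i := by
  rcases lt_trichotomy i j with h' | h' | h'
  · exact absurd (A.ok_cons_of_lt hw.1.1 h') h
  · exact absurd h' hij
  · exact h'

/-- If `j` may be put in front of `w` and `k` may be put in front of `j :: w`, where `k ≠ j`,
then also in front of any word with first letter `j`. -/
theorem ok_cons_congr {k j : ι} {w w' : List ι} (h : A.Ok k (j :: w)) : A.Ok k (j :: w') := by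
  refine ⟨h.1, ?_⟩
  simpa using h.2

/-- The shape of the words occurring in the action of a letter on an ordered word. -/
theorem act_support (n : ℕ) : ∀ (i : ι) (w : List ι), A.Std w → ∀ u ∈ (A.act n i w).support,
    A.Std u ∧ (u.length ≤ w.length ∨
      (u.length = w.length + 1 ∧ ∀ k, k < i → A.Ok k w → A.Ok k u)) := by
  have okc : ∀ (i : ι) (w : List ι), A.Std w → A.Ok i w → ∀ u ∈ (single (i :: w) (1:ℂ)).support,
    A.Std u ∧ (u.length ≤ w.length ∨
      (u.length = w.length + 1 ∧ ∀ k, k < i → A.Ok k w → A.Ok k u)) := by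
    intro i w hw hi u hu
    have : u = i :: w := by
      have := Finsupp.support_single_subset hu
      simpa using this
    subst this
    exact ⟨⟨hi, hw⟩, Or.inr ⟨rfl, fun k hk _ => A.ok_cons_of_lt hi.1 hk⟩⟩
  have nilc : ∀ (i : ι) (u : List ι), u ∈ (single [] (A.χ i)).support → A.Std u ∧
      (u.length ≤ ([] : List ι).length ∨
      (u.length = ([] : List ι).length + 1 ∧ ∀ k, k < i → A.Ok k [] → A.Ok k u)) := by
    intro i u hu
    have : u = [] := by
      have := Finsupp.support_single_subset hu
      simpa using this
    subst this
    exact ⟨trivial, Or.inl le_rfl⟩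
  induction n with
  | zero =>
    intro i w hw u hu
    by_cases hi : A.Ok i w
    · rw [A.act_ok hi] at hu
      exact okc i w hw hi u hu
    · by_cases h0 : w = []
      · subst h0
        simp only [act, hi, if_false, if_true] at hu
        exact nilc i u hu
      · simp [act, hi, h0] at hu
  | succ n ih =>
    intro i w hw u hu
    by_cases hi : A.Ok i w
    · rw [A.act_ok hi] at hu
      exact okc i w hw hi u hu
    · rcases w with _ | ⟨j, w⟩
      · simp only [act, hi, if_false] at hu
        exact nilc i u hu
      · by_cases hij : i = j
        · subst hij
          simp [A.act_eq hi] at hu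
        · have hji := A.lt_of_not_ok hw hi hij
          rw [A.act_cons hi hij] at hu
          rcases Finset.mem_union.1 (Finsupp.support_add hu) with hu | hu
          · have hu := Finsupp.support_smul hu
            rw [linearCombination_apply] at hu
            obtain ⟨v, hv, hu⟩ := Finset.mem_biUnion.1 (Finsupp.support_sum hu)
            have hu := Finsupp.support_smul hu
            obtain ⟨hvs, hvl⟩ := ih i w hw.2 v hv
            obtain ⟨hus, hul⟩ := ih j v hvs u hu
            refine ⟨hus, ?_⟩
            rcases hvl with hvl | ⟨hvl, hvo⟩
            · left
              simp only [List.length_cons]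
              rcases hul with h | h <;> omega
            -- The second alternative of the statement is made for this point: `j` still fits in
            -- front of the longer words `v`, so it is merely prefixed and the length grows by no
            -- more than one in total.
            · have hjv : A.Ok j v := hvo j hji hw.1
              rw [A.act_ok hjv] at hu
              have : u = j :: v := by
                have := Finsupp.support_single_subset hu
                simpa using this
              subst this
              refine Or.inr ⟨by simp [hvl], fun k _ hk => A.ok_cons_congr hk⟩
          · rw [linearCombination_apply] at hu
            obtain ⟨k, _, hu⟩ := Finset.mem_biUnion.1 (Finsupp.support_sum hu)
            have hu := Finsupp.support_smul hu
            obtain ⟨hus, hul⟩ := ih k w hw.2 u hu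
            refine ⟨hus, Or.inl ?_⟩
            simp only [List.length_cons]
            rcases hul with h | h <;> omega

/-- The bound on the depth is irrelevant, as long as it is large enough. -/
theorem act_stable (n : ℕ) : ∀ (i : ι) (w : List ι), A.Std w → w.length ≤ n →
    A.act (n + 1) i w = A.act n i w := by
  induction n with
  | zero =>
    intro i w hw hl
    have : w = [] := by simpa using hl
    subst this
    simp [act]
  | succ n ih =>
    intro i w hw hl
    by_cases hi : A.Ok i w
    · rw [A.act_ok hi, A.act_ok hi]
    · rcases w with _ | ⟨j, w⟩
      · simp [act, hi]
      · have hl : w.length ≤ n := by simpa using hl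
        by_cases hij : i = j
        · subst hij
          rw [A.act_eq hi, A.act_eq hi]
        · have hji := A.lt_of_not_ok hw hi hij
          rw [A.act_cons hi hij, A.act_cons hi hij, ih i w hw.2 hl]
          congr 2
          · refine map_eq_of_support _ _ _ fun v hv => ?_
            simp only [linearCombination_single, one_smul]
            obtain ⟨hvs, hvl⟩ := A.act_support n i w hw.2 v hv
            rcases hvl with hvl | ⟨_, hvo⟩
            · exact ih j v hvs (hvl.trans hl)
            · have hjv : A.Ok j v := hvo j hji hw.1
              rw [A.act_ok hjv, A.act_ok hjv]
          · congr 1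
            funext k
            exact ih k w hw.2 hl

theorem act_eq_of_le {n : ℕ} {i : ι} {w : List ι} (hw : A.Std w) (h : w.length ≤ n) :
    A.act n i w = A.act w.length i w := by
  induction n, h using Nat.le_induction with
  | base => rfl
  | succ n hn ih => rw [A.act_stable n i w hw hn, ih]

/-- The action of the letter `i`. -/
def ρ (i : ι) : (List ι →₀ ℂ) →ₗ[ℂ] (List ι →₀ ℂ) :=
  linearCombination ℂ fun w => A.act w.length i w

/-- The action of an element of the Lie superalgebra. -/
def ρL : (ι →₀ ℂ) →ₗ[ℂ] ((List ι →₀ ℂ) →ₗ[ℂ] (List ι →₀ ℂ)) := linearCombination ℂ A.ρ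

/-- The basis vector belonging to a word. -/
abbrev bas (w : List ι) : List ι →₀ ℂ := single w 1

theorem ρ_bas (i : ι) (w : List ι) : A.ρ i (bas w) = A.act w.length i w := by
  simp [ρ]

theorem ρL_single (i : ι) (a : ℂ) : A.ρL (single i a) = a • A.ρ i := by
  simp [ρL]

/-- The span of the ordered words. -/
def stdM : Submodule ℂ (List ι →₀ ℂ) := Finsupp.supported ℂ ℂ {w | A.Std w}

theorem bas_mem {w : List ι} (hw : A.Std w) : bas w ∈ A.stdM :=
  Finsupp.single_mem_supported ℂ _ hw

theorem ρ_mem (i : ι) {x : List ι →₀ ℂ} (hx : x ∈ A.stdM) : A.ρ i x ∈ A.stdM := by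
  refine map_mem_of_support _ _ _ fun w hw => ?_
  rw [show single w (1:ℂ) = bas w from rfl, ρ_bas]
  exact fun u hu => (A.act_support _ i w (hx hw) u hu).1

theorem ρ_ok {i : ι} {w : List ι} (h : A.Ok i w) : A.ρ i (bas w) = bas (i :: w) := by
  rw [ρ_bas, A.act_ok h]

theorem ρ_nil {i : ι} (h : ¬ A.neg i) : A.ρ i (bas []) = A.χ i • bas [] := by
  rw [ρ_bas, A.act_nil h]; simp

theorem ρ_self {i : ι} {w : List ι} (h : ¬ A.Ok i (i :: w)) : A.ρ i (bas (i :: w)) = 0 := by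
  rw [ρ_bas, List.length_cons, A.act_eq h]

/-- The recursion freed of its depth bound: a word produced by `i` from `w` is either short enough
for `act_eq_of_le`, or accepts `j` as a prefix, where the depth plays no role. -/
theorem ρ_cons {i j : ι} {w : List ι} (hw : A.Std (j :: w)) (h : ¬ A.Ok i (j :: w)) (hij : i ≠ j) :
    A.ρ i (bas (j :: w)) =
      A.sgn i j • A.ρ j (A.ρ i (bas w)) + A.ρL (A.br i j) (bas w) := by
  have hji := A.lt_of_not_ok hw h hij
  rw [ρ_bas, ρ_bas, List.length_cons, A.act_cons h hij]
  congr 1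
  · congr 1
    refine map_eq_of_support _ _ _ fun v hv => ?_
    rw [show single v (1:ℂ) = bas v from rfl, ρ_bas]
    simp only [linearCombination_single, one_smul]
    obtain ⟨hvs, hvl⟩ := A.act_support _ i w hw.2 v hv
    rcases hvl with hvl | ⟨_, hvo⟩
    · exact A.act_eq_of_le hvs hvl
    · have hjv : A.Ok j v := hvo j hji hw.1
      rw [A.act_ok hjv, A.act_ok hjv]
  · rw [ρL, linearCombination_apply, linearCombination_apply, Finsupp.sum, Finsupp.sum,
      LinearMap.sum_apply]
    refine Finset.sum_congr rfl fun k _ => ?_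
    rw [LinearMap.smul_apply, ρ_bas]

/-! ### The supercommutation relations for the action on ordered words. -/

/-- The supercommutator relation of two letters, on a vector. -/
def Comm (i j : ι) (x : List ι →₀ ℂ) : Prop :=
  A.ρ i (A.ρ j x) = A.sgn i j • A.ρ j (A.ρ i x) + A.ρL (A.br i j) x

theorem Comm.symm {i j : ι} {x : List ι →₀ ℂ} (h : A.Comm i j x) : A.Comm j i x := by
  unfold Comm at *
  have h1 := A.sgn_sq i j
  rw [h, A.br_swap i j, A.sgn_symm j i, map_neg, map_smul, LinearMap.neg_apply,
    LinearMap.smul_apply, smul_add, smul_smul, h1]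
  module

theorem comm_of_support {i j : ι} {x : List ι →₀ ℂ} (h : ∀ w ∈ x.support, A.Comm i j (bas w)) :
    A.Comm i j x := by
  have := map_eq_of_support (A.ρ i ∘ₗ A.ρ j) (A.sgn i j • (A.ρ j ∘ₗ A.ρ i) + A.ρL (A.br i j)) x
    (fun w hw => by simpa [Comm] using h w hw)
  simpa [Comm] using this

/-- Moving a bracket to the right of a letter. -/
theorem ρL_br_comm {i j k : ι} {x : List ι →₀ ℂ} (h : ∀ l, A.Comm l k x) :
    A.ρL (A.br i j) (A.ρ k x) = (A.sgn i k * A.sgn j k) • A.ρ k (A.ρL (A.br i j) x) +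
      A.ρL (linearCombination ℂ (fun l => A.br l k) (A.br i j)) x := by
  have := map_eq_of_support (LinearMap.applyₗ (A.ρ k x) ∘ₗ A.ρL)
    ((A.sgn i k * A.sgn j k) • (A.ρ k ∘ₗ LinearMap.applyₗ x ∘ₗ A.ρL) +
      LinearMap.applyₗ x ∘ₗ A.ρL ∘ₗ linearCombination ℂ (fun l => A.br l k)) (A.br i j)
    (fun l hl => by
      have h' := h l
      unfold Comm at h'
      simpa [ρL_single, A.sgn_br i j l k hl] using h')
  simpa using this

/-- Moving a letter to the right of a bracket. -/
theorem comm_ρL_br {i j k : ι} {x : List ι →₀ ℂ} (h : ∀ l, A.Comm k l x) :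
    A.ρ k (A.ρL (A.br i j) x) = (A.sgn i k * A.sgn j k) • A.ρL (A.br i j) (A.ρ k x) +
      A.ρL (linearCombination ℂ (A.br k) (A.br i j)) x := by
  have := map_eq_of_support (A.ρ k ∘ₗ LinearMap.applyₗ x ∘ₗ A.ρL)
    ((A.sgn i k * A.sgn j k) • (LinearMap.applyₗ (A.ρ k x) ∘ₗ A.ρL) +
      LinearMap.applyₗ x ∘ₗ A.ρL ∘ₗ linearCombination ℂ (A.br k)) (A.br i j)
    (fun l hl => by
      have h' := h l
      unfold Comm at h'
      simpa [ρL_single, ← A.sgn_br i j l k hl, A.sgn_symm l k] using h')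
  simpa using this

/-- In this position the relation is the defining recursion for `i` on the word `j :: w`. -/
theorem comm_of_ok {i j : ι} {w : List ι} (hw : A.Std w) (hj : A.Ok j w) (hji : j < i) :
    A.Comm i j (bas w) := by
  have h : ¬ A.Ok i (j :: w) := by
    rintro ⟨_, h⟩
    rcases h j (by simp) with h | h
    · exact absurd hji h.not_gt
    · exact hji.ne' h.1
  rw [Comm, A.ρ_ok hj, A.ρ_cons ⟨hj, hw⟩ h hji.ne']

theorem sgn_eq_neg_one {j : ι} (h : A.sgn j j ≠ 1) : A.sgn j j = -1 := by
  rcases mul_self_eq_one_iff.1 (A.sgn_sq j j) with h' | h'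
  · exact absurd h' h
  · exact h'

theorem ρ_sq_of_comm {j : ι} {x : List ι →₀ ℂ} (h : A.sgn j j ≠ 1) (hx : A.Comm j j x) :
    A.ρ j (A.ρ j x) = 0 := by
  rw [Comm, A.sgn_eq_neg_one h, A.br_self, map_zero, LinearMap.zero_apply, add_zero, neg_one_smul,
    eq_neg_iff_add_eq_zero, ← two_smul ℂ] at hx
  exact (smul_eq_zero.1 hx).resolve_left two_ne_zero

theorem ρ_sq_of_ok {j : ι} {w : List ι} (h : A.sgn j j ≠ 1) (hj : A.Ok j w) :
    A.ρ j (A.ρ j (bas w)) = 0 := by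
  have h' : ¬ A.Ok j (j :: w) := by
    rintro ⟨_, h'⟩
    rcases h' j (by simp) with h' | h'
    · exact lt_irrefl _ h'
    · exact h h'.2
  rw [A.ρ_ok hj, A.ρ_self h']

/-- For odd `j` the two terms on the right of the Jacobi identity for (i, j, j) coincide instead of
cancelling, while the left side vanishes since `br j j = 0`. -/
theorem double_br_self {i j : ι} (h : A.sgn j j ≠ 1) :
    linearCombination ℂ (fun l => A.br l j) (A.br i j) = 0 := by
  have h1 := A.jacobi i j j
  have h2 : linearCombination ℂ (A.br j) (A.br i j) =
      A.sgn i j • linearCombination ℂ (fun l => A.br l j) (A.br i j) := by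
    have := map_eq_of_support (linearCombination ℂ (A.br j))
      (A.sgn i j • linearCombination ℂ (fun l => A.br l j)) (A.br i j) (fun l hl => by
        have hs := A.sgn_br i j l j hl
        rw [A.sgn_eq_neg_one h] at hs
        simp [A.br_swap l j, hs])
    simpa using this
  rw [A.br_self, map_zero, h2, smul_smul, A.sgn_sq, one_smul, ← two_smul ℂ] at h1
  exact (smul_eq_zero.1 h1.symm).resolve_left two_ne_zero

/-- The supercommutator relations hold on the span of the ordered words. -/
theorem comm_bas (n : ℕ) : ∀ (w : List ι), A.Std w → w.length ≤ n → ∀ i j, A.Comm i j (bas w) := by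
  induction n with
  | zero =>
    intro w hw hl
    have hw0 : w = [] := by simpa using hl
    subst hw0
    have key : ∀ i j, j ≤ i → A.Comm i j (bas []) := by
      intro i j hji
      by_cases hj : A.Ok j []
      · rcases hji.lt_or_eq with hlt | rfl
        · exact A.comm_of_ok hw hj hlt
        · by_cases hs : A.sgn j j = 1
          · simp [Comm, hs, A.br_self]
          · simp [Comm, A.ρ_sq_of_ok hs hj, A.br_self]
      · have hj' : ¬ A.neg j := fun h => hj (A.ok_nil.2 h)
        have hi' : ¬ A.neg i := fun h => hj' (A.neg_lower _ _ hji h)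
        -- Both letters act on the empty word by `χ`, and so does every term of their bracket; `χ`
        -- vanishes on brackets.
        have hL : A.ρL (A.br i j) (bas []) = 0 := by
          have := map_eq_of_support (LinearMap.applyₗ (bas []) ∘ₗ A.ρL)
            ((LinearMap.toSpanSingleton ℂ _ (bas [])) ∘ₗ linearCombination ℂ A.χ) (A.br i j)
            (fun k hk => by
              simp [ρL_single, A.ρ_nil (A.br_pos i j hi' hj' k hk)])
          simpa [A.χ_br i j hi' hj'] using this
        rw [Comm, A.ρ_nil hj', map_smul, A.ρ_nil hi', map_smul, A.ρ_nil hj', hL, add_zero,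
          smul_smul, smul_smul, smul_smul, mul_comm, A.χ_comm i j hi' hj', mul_assoc,
          mul_comm (A.χ j)]
    intro i j
    rcases le_total j i with h | h
    · exact key i j h
    · exact (key j i h).symm
  | succ n ih =>
    intro w hw hl
    by_cases hl' : w.length ≤ n
    · exact ih w hw hl'
    have key : ∀ i j, j ≤ i → A.Comm i j (bas w) := by
      intro i j hji
      by_cases hj : A.Ok j w
      · rcases hji.lt_or_eq with hlt | rfl
        · exact A.comm_of_ok hw hj hlt
        · by_cases hs : A.sgn j j = 1
          · simp [Comm, hs, A.br_self]
          · simp [Comm, A.ρ_sq_of_ok hs hj, A.br_self]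
      rcases w with _ | ⟨k, w⟩
      · simp at hl'
      have hwn : w.length ≤ n := by simpa using hl
      have ihw := ih w hw.2 hwn
      have hkw : A.ρ k (bas w) = bas (k :: w) := A.ρ_ok hw.1
      -- a letter larger than `k` acting on `w` yields words which may be preceded by `k`
      have supp : ∀ l, k < l → ∀ v ∈ (A.ρ l (bas w)).support,
          A.Std v ∧ (v.length ≤ n ∨ A.Ok k v) := by
        intro l hl v hv
        rw [ρ_bas] at hv
        obtain ⟨h1, h2⟩ := A.act_support _ l w hw.2 v hv
        exact ⟨h1, h2.imp (fun h => h.trans hwn) fun h => h.2 k hl hw.1⟩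
      -- As `j` cannot precede `k :: w`, either `j = k` is odd or `k < j`. The first case rests on
      -- `ρ` of an odd letter squaring to zero, the second on moving both letters past `k`.
      rcases eq_or_ne j k with rfl | hjk
      · have hs : A.sgn j j ≠ 1 := fun h => hj ⟨hw.1.1, by simp [h]⟩
        have hjw : A.ρ j (bas (j :: w)) = 0 := A.ρ_self hj
        rcases hji.lt_or_eq with hlt | rfl
        · have hi : ¬ A.Ok i (j :: w) := by
            rintro ⟨_, h⟩
            rcases h j (by simp) with h | h
            · exact absurd hlt h.not_gt
            · exact hlt.ne' h.1
          have hsq : A.ρ j (A.ρ j (A.ρ i (bas w))) = 0 := by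
            have := map_eq_of_support (A.ρ j ∘ₗ A.ρ j) 0 (A.ρ i (bas w)) (fun v hv => by
              obtain ⟨h1, h2⟩ := supp i hlt v hv
              rcases h2 with h2 | h2
              · exact A.ρ_sq_of_comm hs (ih v h1 h2 j j)
              · exact A.ρ_sq_of_ok hs h2)
            simpa using this
          have hb := A.ρL_br_comm (i := i) (j := j) (k := j) (x := bas w) fun l => ihw l j
          rw [A.double_br_self hs, hkw, A.sgn_eq_neg_one hs, map_zero, LinearMap.zero_apply] at hb
          rw [Comm, hjw, map_zero, A.ρ_cons hw hi hlt.ne', map_add, map_smul, hsq, hb]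
          module
        · simp [Comm, hjw, A.br_self]
      · have hkj : k < j := A.lt_of_not_ok hw hj hjk
        have hki : k < i := hkj.trans_le hji
        have hi : ¬ A.Ok i (k :: w) := by
          rintro ⟨_, h⟩
          rcases h k (by simp) with h | h
          · exact absurd hki h.not_gt
          · exact hki.ne' h.1
        have lem : ∀ a b, k < a → k < b → A.Comm a k (A.ρ b (bas w)) := by
          intro a b ha hb
          refine A.comm_of_support fun v hv => ?_
          obtain ⟨h1, h2⟩ := supp b hb v hv
          rcases h2 with h2 | h2
          · exact ih v h1 h2 a k
          · exact A.comm_of_ok h1 h2 ha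
        have e1 := lem i j hki hkj
        have e2 := lem j i hkj hki
        have e3 := A.comm_ρL_br (i := j) (j := k) (k := i) (x := bas w) fun l => ihw i l
        have e4 := A.comm_ρL_br (i := i) (j := k) (k := j) (x := bas w) fun l => ihw j l
        have e5 := A.ρL_br_comm (i := i) (j := j) (k := k) (x := bas w) fun l => ihw l k
        have e6 := ihw i j
        -- After both letters have passed `k`, the remaining double-bracket terms are exactly those
        -- balanced by the Jacobi identity.
        have e7 := congrArg (fun y => A.ρL y (bas w)) (A.jacobi i j k)
        simp only [map_add, map_smul, LinearMap.add_apply, LinearMap.smul_apply] at e7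
        unfold Comm at e1 e2 e6 ⊢
        rw [A.ρ_cons hw hj hkj.ne', A.ρ_cons hw hi hki.ne', map_add, map_add, map_smul, map_smul,
          e1, e2, e3, e4, e6, ← hkw, e5, e7, A.sgn_symm j i, A.sgn_symm k i, A.sgn_symm k j]
        rw [map_add, map_smul]
        have s1 := A.sgn_sq i j
        match_scalars <;> first | ring1 | linear_combination -(A.sgn j k) * s1
    intro i j
    rcases le_total j i with h | h
    · exact key i j h
    · exact (key j i h).symm

theorem comm {x : List ι →₀ ℂ} (hx : x ∈ A.stdM) (i j : ι) : A.Comm i j x :=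
  A.comm_of_support fun w hw => A.comm_bas _ w (hx hw) le_rfl i j

end Data

end SuperPBW
end

noncomputable section

namespace TopN2

open Finsupp SuperPBW Gen

/-! ### The structure constants -/

/-- The position of a basis element in the total order: `L (-1)`, then the other `G`, `Q`, `L`,
`H` of negative index, then `Q 0`, then the basis elements acting on a highest weight vector by
scalars. -/
def key : Gen → ℕ ×ₗ ℕ
  | L n => toLex (if n = -1 then (0, 0) else if n < 0 then (3, n.natAbs) else (6, n.natAbs))
  | G n => toLex (if n < 0 then (1, n.natAbs) else (7, n.natAbs))
  | Q n => toLex (if n < 0 then (2, n.natAbs) else if n = 0 then (5, 0) else (8, n.natAbs))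
  | H n => toLex (if n < 0 then (4, n.natAbs) else (9, n.natAbs))
  | C => toLex (10, 0)

theorem key_injective : Function.Injective key := by
  intro x y h
  rcases x with m | m | m | m | _ <;> rcases y with n | n | n | n | _ <;>
    simp only [key, toLex_inj] at h <;> (try split_ifs at h) <;>
    (try simp only [Prod.mk.injEq] at h) <;> first | rfl | omega | (congr 1; omega)

instance : LinearOrder Gen := LinearOrder.lift' key key_injective

theorem lt_iff (x y : Gen) : x < y ↔ key x < key y := Iff.rfl

theorem le_iff (x y : Gen) : x ≤ y ↔ key x ≤ key y := Iff.rfl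

/-- The parity of a basis element. -/
def odd : Gen → Bool
  | G _ => true
  | Q _ => true
  | _ => false

/-- The sign in the supercommutator. -/
def sg (x y : Gen) : ℂ := if odd x && odd y then -1 else 1

/-- The supercommutators of the basis elements. -/
def bracket : Gen → Gen → Gen →₀ ℂ
  | L m, L n => single (L (m + n)) ((m : ℂ) - n)
  | L m, H n => single (H (m + n)) (-(n : ℂ)) +
      single C (if m + n = 0 then ((m : ℂ) ^ 2 + m) / 6 else 0)
  | L m, G n => single (G (m + n)) ((m : ℂ) - n)
  | L m, Q n => single (Q (m + n)) (-(n : ℂ))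
  | H m, L n => single (H (m + n)) (m : ℂ) -
      single C (if m + n = 0 then ((n : ℂ) ^ 2 + n) / 6 else 0)
  | H m, H n => single C (if m + n = 0 then (m : ℂ) / 3 else 0)
  | H m, G n => single (G (m + n)) 1
  | H m, Q n => single (Q (m + n)) (-1)
  | G m, L n => single (G (m + n)) ((m : ℂ) - n)
  | G m, H n => single (G (m + n)) (-1)
  | G m, Q n => single (L (m + n)) 2 + single (H (m + n)) (-(2 * (n : ℂ))) +
      single C (if m + n = 0 then ((m : ℂ) ^ 2 + m) / 3 else 0)
  | Q m, L n => single (Q (m + n)) (m : ℂ)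
  | Q m, H n => single (Q (m + n)) 1
  | Q m, G n => single (L (m + n)) 2 + single (H (m + n)) (-(2 * (m : ℂ))) +
      single C (if m + n = 0 then ((n : ℂ) ^ 2 + n) / 3 else 0)
  | _, _ => 0

/-- The basis elements which act freely on the highest weight vector. -/
def negative (x : Gen) : Prop := (ofLex (key x)).1 ≤ 5

/-- The action of the other basis elements on the highest weight vector. -/
def character (Δ q c : ℂ) : Gen → ℂ
  | L n => if n = 0 then Δ else 0
  | H n => if n = 0 then q else 0
  | C => c
  | _ => 0

theorem sg_bracket (i j k l : Gen) (h : k ∈ (bracket i j).support) :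
    sg k l = sg i l * sg j l := by
  have hs : odd k = xor (odd i) (odd j) := by
    by_contra hne
    apply Finsupp.mem_support_iff.1 h
    rcases i with m | m | m | m | _ <;> rcases j with n | n | n | n | _ <;>
      rcases k with p | p | p | p | _ <;> simp [odd] at hne <;> simp [bracket]
  unfold sg
  rw [hs]
  cases odd i <;> cases odd j <;> cases odd l <;> simp

theorem bracket_swap (i j : Gen) : bracket j i = -(sg i j • bracket i j) := by
  rcases i with m | m | m | m | _ <;> rcases j with n | n | n | n | _ <;>
    try (simp [bracket]; done)
  case H.H =>
    by_cases h : m + n = 0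
    · obtain rfl : n = -m := by omega
      ext g
      simp [bracket, sg, odd, neg_div]
    · simp [h, bracket, add_comm n m]
  all_goals
    simp only [bracket, sg, odd, Bool.and_self, Bool.and_false, Bool.false_and, if_true, if_false,
      neg_smul, one_smul, neg_neg, add_comm n m,
      Bool.false_eq_true, single_neg, single_sub]
    try abel

theorem bracket_self (i : Gen) : bracket i i = 0 := by
  rcases i with m | m | m | m | _ <;> simp [bracket]

set_option maxHeartbeats 4000000 in
theorem jacobi (i j k : Gen) : linearCombination ℂ (bracket i) (bracket j k) =
    linearCombination ℂ (fun l => bracket l k) (bracket i j) +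
      sg i j • linearCombination ℂ (bracket j) (bracket i k) := by
  have hC : bracket C = 0 := funext fun x => by cases x <;> rfl
  have hC' : (fun l => bracket l C) = 0 := funext fun x => by cases x <;> rfl
  rcases i with m | m | m | m | _ <;> rcases j with n | n | n | n | _ <;>
    rcases k with p | p | p | p | _ <;>
    try (simp [bracket, hC, -Finsupp.single_mul]; done)
  all_goals
    -- With the total index `r` as parameter, all three nested brackets carry the same index and
    -- every central term is governed by the condition `r = 0`.
    obtain ⟨r, rfl⟩ : ∃ r, p = r - m - n := ⟨m + n + p, by ring⟩
    have e1 : m + (n + (r - m - n)) = r := by ring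
    have e2 : m + n + (r - m - n) = r := by ring
    have e3 : n + (m + (r - m - n)) = r := by ring
    simp only [bracket, sg, odd, Bool.and_self, Bool.and_false, Bool.false_and, if_true, if_false,
      Bool.false_eq_true, map_add, map_sub, map_zero, linearCombination_single, smul_add,
      smul_sub, smul_zero, Finsupp.smul_single, smul_eq_mul, add_zero, zero_add, mul_one,
      one_smul, sub_zero, e1, e2, e3]
  all_goals
    try rfl
    ext g
    by_cases hr : r = 0
    · subst hr
      simp only [Finsupp.add_apply, Finsupp.sub_apply, Finsupp.single_apply, if_true,
        Finsupp.coe_zero, Pi.zero_apply]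
      split_ifs <;> push_cast <;> ring1
    · simp only [Finsupp.add_apply, Finsupp.sub_apply, Finsupp.single_apply, if_neg hr,
        Finsupp.coe_zero, Pi.zero_apply]
      split_ifs <;> push_cast <;> ring1

end TopN2
end

noncomputable section
namespace TopN2
open Finsupp SuperPBW Gen

theorem negative_lower (i j : Gen) (h : i ≤ j) (hj : negative j) : negative i := by
  have := (Prod.Lex.le_iff.1 ((le_iff i j).1 h))
  unfold negative at *
  rcases this with h | h
  · exact (h.trans_le hj).le
  · exact h.1.trans_le hj

theorem negative_L {n : ℤ} : negative (L n) ↔ n < 0 := by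
  simp only [negative, key]; split_ifs <;> simp <;> omega

theorem negative_H {n : ℤ} : negative (H n) ↔ n < 0 := by
  simp only [negative, key]; split_ifs <;> simp <;> omega

theorem negative_G {n : ℤ} : negative (G n) ↔ n < 0 := by
  simp only [negative, key]; split_ifs <;> simp <;> omega

theorem negative_Q {n : ℤ} : negative (Q n) ↔ n ≤ 0 := by
  simp only [negative, key]; split_ifs <;> simp <;> omega

theorem not_negative_C : ¬ negative C := by
  simp [negative, key]

/-- Indices add. The exceptional letter `Q 0` cannot appear, since a bracket producing some `Q`
needs a factor `Q n`, here with `n > 0`. -/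
theorem bracket_not_negative (i j : Gen) (hi : ¬ negative i) (hj : ¬ negative j) (k : Gen)
    (hk : k ∈ (bracket i j).support) : ¬ negative k := by
  revert hk
  contrapose!
  intro hk
  rw [Finsupp.notMem_support_iff]
  rcases i with m | m | m | m | _ <;> rcases j with n | n | n | n | _ <;>
    rcases k with p | p | p | p | _ <;>
    (try simp only [negative_L, negative_H, negative_G, negative_Q, not_negative_C] at hi hj hk) <;>
    (try simp [bracket, Finsupp.single_apply]) <;> (try have hne : m + n ≠ p := by omega) <;>
    (try simp [hne])

/-- For nonnegative indices a central term requires both indices to be 0, where its coefficient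
vanishes; the remaining terms in index 0 vanish likewise. -/
theorem character_bracket (Δ q c : ℂ) (i j : Gen) (hi : ¬ negative i) (hj : ¬ negative j) :
    linearCombination ℂ (character Δ q c) (bracket i j) = 0 := by
  rcases i with m | m | m | m | _ <;> rcases j with n | n | n | n | _ <;>
    (try simp only [negative_L, negative_H, negative_G, negative_Q] at hi hj) <;>
    (try simp [bracket, character, -Finsupp.single_mul]) 
  all_goals
    obtain ⟨rfl, rfl⟩ | h : (m = 0 ∧ n = 0) ∨ m + n ≠ 0 := by omega
    · first | (exfalso; omega) | simp
    · simp [h]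

/-- The data of the Verma module with label `G`. -/
def topData (Δ q c : ℂ) : Data Gen where
  sgn := sg
  br := bracket
  neg := negative
  χ := character Δ q c
  sgn_symm i j := by simp [sg, Bool.and_comm]
  sgn_sq i j := by unfold sg; split_ifs <;> norm_num
  sgn_br := sg_bracket
  br_swap := bracket_swap
  br_self := bracket_self
  jacobi := jacobi
  neg_lower := negative_lower
  χ_comm i j _ _ := by
    rcases i with m | m | m | m | _ <;> rcases j with n | n | n | n | _ <;>
      simp [character, sg, odd, mul_comm]
  br_pos := bracket_not_negative
  χ_br := character_bracket Δ q c

/-! ### The action on ordered words -/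

/-- A family of elements satisfying the supercommutation relations defines a homomorphism. -/
theorem lift_rel {B : Type*} [Ring B] [Algebra ℂ B] (f : Gen → B)
    (hf : ∀ i j, f i * f j = sg i j • (f j * f i) + linearCombination ℂ f (bracket i j))
    ⦃a b : FreeAlgebra ℂ Gen⦄ (h : TopRel a b) :
    FreeAlgebra.lift ℂ f a = FreeAlgebra.lift ℂ f b := by
  induction h with
  | LL m n => simp [-Finsupp.single_sub, sComm, hf (L m) (L n), sg, odd, bracket]
  | HH m n => by_cases h : m + n = 0 <;> simp [h, -Finsupp.single_mul, sComm, hf (H m) (H n), sg, odd, bracket]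
  | LG m n => simp [-Finsupp.single_sub, sComm, hf (L m) (G n), sg, odd, bracket]
  | HG m n => simp [sComm, hf (H m) (G n), sg, odd, bracket]
  | LQ m n => simp [sComm, hf (L m) (Q n), sg, odd, bracket]
  | HQ m n => simp [sComm, hf (H m) (Q n), sg, odd, bracket]
  | LH m n => by_cases h : m + n = 0 <;> simp [h, -Finsupp.single_mul, sComm, hf (L m) (H n), sg, odd, bracket]
  | GQ m n => by_cases h : m + n = 0 <;> simp [h, -Finsupp.single_mul, aComm, hf (G m) (Q n), sg, odd, bracket, sub_eq_add_neg]
  | GG m n => simp [aComm, hf (G m) (G n), sg, odd, bracket]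
  | QQ m n => simp [aComm, hf (Q m) (Q n), sg, odd, bracket]
  | central x => cases x <;> simp [sComm, hf C, sg, odd, bracket]

/-! ### Supercommutators in the enveloping algebra. -/

theorem toU_rel {a b : FreeAlgebra ℂ Gen} (h : TopRel a b) : toU a = toU b :=
  RingQuot.mkAlgHom_rel ℂ h

/-- The supercommutation relations in the enveloping algebra. -/
theorem u_mul_u (i j : Gen) :
    u i * u j = sg i j • (u j * u i) + linearCombination ℂ u (bracket i j) := by
  have key : ∀ i j, (sg i j = 1 → toU (sComm (gen i) (gen j)) = linearCombination ℂ u (bracket i j))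
      → (sg i j = -1 → toU (aComm (gen i) (gen j)) = linearCombination ℂ u (bracket i j)) →
      u i * u j = sg i j • (u j * u i) + linearCombination ℂ u (bracket i j) := by
    intro i j h1 h2
    have : sg i j = 1 ∨ sg i j = -1 := by unfold sg; split_ifs <;> simp
    rcases this with h | h
    · rw [← h1 h, h, sComm, map_sub, map_mul, map_mul]; simp [u]
    · rw [← h2 h, h, aComm, map_add, map_mul, map_mul]; simp [u]
  have swap : ∀ i j, u i * u j = sg i j • (u j * u i) + linearCombination ℂ u (bracket i j) →
      u j * u i = sg j i • (u i * u j) + linearCombination ℂ u (bracket j i) := by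
    intro i j h
    have hs : sg j i = sg i j := by simp [sg, Bool.and_comm]
    have hs2 : sg i j * sg i j = 1 := by unfold sg; split_ifs <;> norm_num
    rw [h, bracket_swap i j, hs, smul_add, smul_smul, hs2]
    simp
  have LL : ∀ m n : ℤ, u (L m) * u (L n) = sg (L m) (L n) • (u (L n) * u (L m)) +
      linearCombination ℂ u (bracket (L m) (L n)) := by
    intro m n
    refine key _ _ (fun _ => ?_) (fun h => absurd h (by norm_num [sg, odd]))
    rw [toU_rel (.LL m n)]
    simp [bracket, u, -Finsupp.single_sub]
  have LH : ∀ m n : ℤ, u (L m) * u (H n) = sg (L m) (H n) • (u (H n) * u (L m)) +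
      linearCombination ℂ u (bracket (L m) (H n)) := by
    intro m n
    refine key _ _ (fun _ => ?_) (fun h => absurd h (by norm_num [sg, odd]))
    rw [toU_rel (.LH m n)]
    by_cases h : m + n = 0 <;> simp [h, bracket, u]
  have LG : ∀ m n : ℤ, u (L m) * u (G n) = sg (L m) (G n) • (u (G n) * u (L m)) +
      linearCombination ℂ u (bracket (L m) (G n)) := by
    intro m n
    refine key _ _ (fun _ => ?_) (fun h => absurd h (by norm_num [sg, odd]))
    rw [toU_rel (.LG m n)]
    simp [bracket, u, -Finsupp.single_sub]
  have LQ : ∀ m n : ℤ, u (L m) * u (Q n) = sg (L m) (Q n) • (u (Q n) * u (L m)) +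
      linearCombination ℂ u (bracket (L m) (Q n)) := by
    intro m n
    refine key _ _ (fun _ => ?_) (fun h => absurd h (by norm_num [sg, odd]))
    rw [toU_rel (.LQ m n)]
    simp [bracket, u]
  have HH : ∀ m n : ℤ, u (H m) * u (H n) = sg (H m) (H n) • (u (H n) * u (H m)) +
      linearCombination ℂ u (bracket (H m) (H n)) := by
    intro m n
    refine key _ _ (fun _ => ?_) (fun h => absurd h (by norm_num [sg, odd]))
    rw [toU_rel (.HH m n)]
    by_cases h : m + n = 0 <;> simp [h, bracket, u]
  have HG : ∀ m n : ℤ, u (H m) * u (G n) = sg (H m) (G n) • (u (G n) * u (H m)) +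
      linearCombination ℂ u (bracket (H m) (G n)) := by
    intro m n
    refine key _ _ (fun _ => ?_) (fun h => absurd h (by norm_num [sg, odd]))
    rw [toU_rel (.HG m n)]
    simp [bracket, u]
  have HQ : ∀ m n : ℤ, u (H m) * u (Q n) = sg (H m) (Q n) • (u (Q n) * u (H m)) +
      linearCombination ℂ u (bracket (H m) (Q n)) := by
    intro m n
    refine key _ _ (fun _ => ?_) (fun h => absurd h (by norm_num [sg, odd]))
    rw [toU_rel (.HQ m n)]
    simp [bracket, u]
  have GG : ∀ m n : ℤ, u (G m) * u (G n) = sg (G m) (G n) • (u (G n) * u (G m)) +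
      linearCombination ℂ u (bracket (G m) (G n)) := by
    intro m n
    refine key _ _ (fun h => absurd h (by norm_num [sg, odd])) (fun _ => ?_)
    rw [toU_rel (.GG m n)]
    simp [bracket]
  have QQ : ∀ m n : ℤ, u (Q m) * u (Q n) = sg (Q m) (Q n) • (u (Q n) * u (Q m)) +
      linearCombination ℂ u (bracket (Q m) (Q n)) := by
    intro m n
    refine key _ _ (fun h => absurd h (by norm_num [sg, odd])) (fun _ => ?_)
    rw [toU_rel (.QQ m n)]
    simp [bracket]
  have GQ : ∀ m n : ℤ, u (G m) * u (Q n) = sg (G m) (Q n) • (u (Q n) * u (G m)) +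
      linearCombination ℂ u (bracket (G m) (Q n)) := by
    intro m n
    refine key _ _ (fun h => absurd h (by norm_num [sg, odd])) (fun _ => ?_)
    rw [toU_rel (.GQ m n)]
    by_cases h : m + n = 0 <;> simp [h, bracket, u, sub_eq_add_neg, -Finsupp.single_mul]
  have central : ∀ x, u C * u x = sg C x • (u x * u C) + linearCombination ℂ u (bracket C x) := by
    intro x
    refine key _ _ (fun _ => ?_) (fun h => absurd h (by norm_num [sg, odd]))
    rw [toU_rel (.central x)]
    simp [bracket]
  rcases i with m | m | m | m | _ <;> rcases j with n | n | n | n | _ <;>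
    first
    | exact central _
    | exact swap _ _ (central _)
    | exact LL _ _
    | exact LH _ _
    | exact LG _ _
    | exact LQ _ _
    | exact HH _ _
    | exact HG _ _
    | exact HQ _ _
    | exact GG _ _
    | exact GQ _ _
    | exact QQ _ _
    | exact swap _ _ (LH _ _)
    | exact swap _ _ (LG _ _)
    | exact swap _ _ (LQ _ _)
    | exact swap _ _ (HG _ _)
    | exact swap _ _ (HQ _ _)
    | exact swap _ _ (GQ _ _)

/-! ### The Verma module with label `G` inside the span of words. -/

variable (Δ q c : ℂ)

/-- The span of the ordered words, on which the enveloping algebra acts. -/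
def Fock : Type := (topData Δ q c).stdM

instance : AddCommGroup (Fock Δ q c) := inferInstanceAs (AddCommGroup (topData Δ q c).stdM)

instance : Module ℂ (Fock Δ q c) := inferInstanceAs (Module ℂ (topData Δ q c).stdM)

/-- The inclusion into the span of all words. -/
def Fock.val : Fock Δ q c →ₗ[ℂ] (List Gen →₀ ℂ) := (topData Δ q c).stdM.subtype

theorem Fock.val_injective : Function.Injective (Fock.val Δ q c) := Subtype.val_injective

theorem Fock.val_mem (x : Fock Δ q c) : Fock.val Δ q c x ∈ (topData Δ q c).stdM := Subtype.prop x

/-- The action of a basis element on the span of the ordered words. -/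
def fockOp (x : Gen) : Module.End ℂ (Fock Δ q c) :=
  ((topData Δ q c).ρ x).restrict fun _ hy => (topData Δ q c).ρ_mem x hy

theorem fockOp_val (x : Gen) (y : Fock Δ q c) :
    Fock.val Δ q c (fockOp Δ q c x y) = (topData Δ q c).ρ x (Fock.val Δ q c y) := rfl

theorem fockOp_rel (i j : Gen) : fockOp Δ q c i * fockOp Δ q c j =
    sg i j • (fockOp Δ q c j * fockOp Δ q c i) +
      linearCombination ℂ (fockOp Δ q c) (bracket i j) := by
  ext1 x
  apply Fock.val_injective
  have h := (topData Δ q c).comm (Fock.val_mem Δ q c x) i j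
  have e := map_eq_of_support
    (Fock.val Δ q c ∘ₗ LinearMap.applyₗ x ∘ₗ linearCombination ℂ (fockOp Δ q c))
    (LinearMap.applyₗ (Fock.val Δ q c x) ∘ₗ (topData Δ q c).ρL) (bracket i j)
    (fun k _ => by simp [Data.ρL_single, fockOp_val])
  simp only [LinearMap.comp_apply, LinearMap.applyₗ_apply_apply] at e
  rw [LinearMap.add_apply, map_add, e]
  exact h

/-- The representation of the enveloping algebra on the span of the ordered words. -/
def fockRep : U →ₐ[ℂ] Module.End ℂ (Fock Δ q c) :=
  RingQuot.liftAlgHom ℂ ⟨FreeAlgebra.lift ℂ (fockOp Δ q c),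
    lift_rel (B := Module.End ℂ (Fock Δ q c)) (fockOp Δ q c) (fockOp_rel Δ q c)⟩

theorem fockRep_u (x : Gen) : fockRep Δ q c (u x) = fockOp Δ q c x := by
  simp only [fockRep, u, toU]
  erw [RingQuot.liftAlgHom_mkAlgHom_apply]
  simp

/-- The empty word. -/
def fockVac : Fock Δ q c := ⟨Data.bas [], (topData Δ q c).bas_mem trivial⟩

theorem Fock.val_fockVac : Fock.val Δ q c (fockVac Δ q c) = Data.bas [] := rfl

/-- The empty word satisfies the highest weight conditions, which is what lets the orbit map descend
to the Verma module. -/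
theorem fockVac_ideal (x : U) (hx : x ∈ vermaIdeal .G Δ q c) :
    fockRep Δ q c x (fockVac Δ q c) = 0 := by
  induction hx using Submodule.span_induction with
  | zero => simp
  | add a b _ _ ha hb => simp [ha, hb]
  | smul a b _ hb => simp [hb]
  | mem x hx =>
    have act : ∀ y, ¬ negative y → fockRep Δ q c (u y) (fockVac Δ q c) =
        character Δ q c y • fockVac Δ q c := by
      intro y hy
      rw [fockRep_u]
      exact Fock.val_injective Δ q c ((topData Δ q c).ρ_nil hy)
    rcases hx with hx | ⟨k, hk, hx⟩
    · rcases hx with rfl | rfl | rfl | rfl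
      · simp [act _ (negative_L.not.2 (lt_irrefl 0)), character, Algebra.algebraMap_eq_smul_one]
      · simp [act _ (negative_H.not.2 (lt_irrefl 0)), character, Algebra.algebraMap_eq_smul_one]
      · simp [act _ not_negative_C, character, Algebra.algebraMap_eq_smul_one]
      · simp [act _ (negative_G.not.2 (lt_irrefl 0)), character, Label.zeroMode]
    · rcases hx with rfl | rfl | rfl | rfl
      · simp [act _ (negative_L.not.2 hk.not_gt), character, hk.ne']
      · simp [act _ (negative_H.not.2 hk.not_gt), character, hk.ne']
      · simp [act _ (negative_G.not.2 hk.not_gt), character]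
      · simp [act _ (negative_Q.not.2 hk.not_ge), character]

/-- The map from the Verma module to the span of the ordered words. -/
def toFock : Verma .G Δ q c →ₗ[ℂ] Fock Δ q c :=
  ((vermaIdeal .G Δ q c).restrictScalars ℂ).liftQ
    (LinearMap.applyₗ (fockVac Δ q c) ∘ₗ (fockRep Δ q c).toLinearMap)
    (fun x hx => LinearMap.mem_ker.2 (fockVac_ideal Δ q c x hx)) ∘ₗ
  (Submodule.Quotient.restrictScalarsEquiv ℂ (vermaIdeal .G Δ q c)).symm.toLinearMap

theorem toFock_mk (a : U) : toFock Δ q c (Submodule.Quotient.mk a) =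
    fockRep Δ q c a (fockVac Δ q c) := rfl

theorem toFock_smul (a : U) (x : Verma .G Δ q c) :
    toFock Δ q c (a • x) = fockRep Δ q c a (toFock Δ q c x) := by
  induction x using Submodule.Quotient.induction_on with
  | _ b =>
    rw [← Submodule.Quotient.mk_smul, toFock_mk, toFock_mk, smul_eq_mul, map_mul]
    rfl

/-- The product of the letters of a word, applied to the highest weight vector. -/
def ofWords : (List Gen →₀ ℂ) →ₗ[ℂ] Verma .G Δ q c :=
  linearCombination ℂ fun w => (w.map u).prod • hwv .G Δ q c

theorem ofWords_bas (w : List Gen) :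
    ofWords Δ q c (Data.bas w) = (w.map u).prod • hwv .G Δ q c := by
  simp [ofWords]

theorem u_smul_hwv (x : Gen) (hx : ¬ negative x) :
    u x • hwv .G Δ q c = character Δ q c x • hwv .G Δ q c := by
  have sub : ∀ (a : U) (z : ℂ), a - algebraMap ℂ U z ∈ vermaIdeal .G Δ q c →
      a • hwv .G Δ q c = z • hwv .G Δ q c := by
    intro a z h
    have h2 : (Submodule.Quotient.mk (a - algebraMap ℂ U z) : Verma .G Δ q c) = 0 :=
      (Submodule.Quotient.mk_eq_zero _).2 h
    rw [Submodule.Quotient.mk_sub, sub_eq_zero] at h2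
    have e1 : a • hwv .G Δ q c = Submodule.Quotient.mk a := by
      rw [hwv, Submodule.mkQ_apply, ← Submodule.Quotient.mk_smul, smul_eq_mul, mul_one]
    have e2 : z • hwv .G Δ q c = Submodule.Quotient.mk (algebraMap ℂ U z) := by
      rw [hwv, Submodule.mkQ_apply, ← Submodule.Quotient.mk_smul, Algebra.algebraMap_eq_smul_one]
    rw [e1, e2, h2]
  have pos : ∀ k : ℤ, 0 < k → ∀ y, (y = u (L k) ∨ y = u (H k) ∨ y = u (G k) ∨ y = u (Q k)) →
      y - algebraMap ℂ U 0 ∈ vermaIdeal .G Δ q c := fun k hk y hy => by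
    rw [map_zero, sub_zero]
    exact Submodule.subset_span (Or.inr ⟨k, hk, hy⟩)
  apply sub
  rcases x with n | n | n | n | _
  · rw [negative_L, not_lt] at hx
    rcases hx.eq_or_lt with rfl | h
    · exact Submodule.subset_span (by simp [character])
    · simpa [character, h.ne'] using pos n h _ (Or.inl rfl)
  · rw [negative_H, not_lt] at hx
    rcases hx.eq_or_lt with rfl | h
    · exact Submodule.subset_span (by simp [character])
    · simpa [character, h.ne'] using pos n h _ (Or.inr (Or.inl rfl))
  · rw [negative_G, not_lt] at hx
    rcases hx.eq_or_lt with rfl | h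
    · exact Submodule.subset_span (by simp [character, Label.zeroMode])
    · simpa [character] using pos n h _ (Or.inr (Or.inr (Or.inl rfl)))
  · rw [negative_Q, not_le] at hx
    simpa [character] using pos n hx _ (Or.inr (Or.inr (Or.inr rfl)))
  · exact Submodule.subset_span (by simp [character])

theorem ofWords_ρ_ok {i : Gen} {w : List Gen} (h : (topData Δ q c).Ok i w) :
    ofWords Δ q c ((topData Δ q c).ρ i (Data.bas w)) = u i • ofWords Δ q c (Data.bas w) := by
  rw [(topData Δ q c).ρ_ok h, ofWords_bas, ofWords_bas, List.map_cons, List.prod_cons, mul_smul]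

theorem u_sq (i : Gen) (h : sg i i ≠ 1) : u i * u i = 0 := by
  have h1 := u_mul_u i i
  have h2 : sg i i = -1 := (topData 0 0 0).sgn_eq_neg_one h
  rw [bracket_self, map_zero, add_zero, h2, neg_one_smul, eq_neg_iff_add_eq_zero, ← two_smul ℂ]
    at h1
  exact (smul_eq_zero.1 h1).resolve_left two_ne_zero

/-- The recursion defining the action uses only relations valid in the enveloping algebra, so
reading a word as a product intertwines the two actions. This makes `ofWords` usable as an inverse
of `toFock`. -/
theorem ofWords_ρ_bas (n : ℕ) : ∀ (i : Gen) (w : List Gen), (topData Δ q c).Std w → w.length ≤ n →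
    ofWords Δ q c ((topData Δ q c).ρ i (Data.bas w)) = u i • ofWords Δ q c (Data.bas w) := by
  have nil : ∀ i, ofWords Δ q c ((topData Δ q c).ρ i (Data.bas [])) =
      u i • ofWords Δ q c (Data.bas []) := by
    intro i
    by_cases hi : (topData Δ q c).Ok i []
    · exact ofWords_ρ_ok Δ q c hi
    · have hi' : ¬ negative i := fun h => hi ((topData Δ q c).ok_nil.2 h)
      rw [(topData Δ q c).ρ_nil hi', map_smul, ofWords_bas, List.map_nil, List.prod_nil, one_smul,
        u_smul_hwv Δ q c i hi']
      rfl
  induction n with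
  | zero =>
    intro i w _ hl
    rw [show w = [] by simpa using hl]
    exact nil i
  | succ n ih =>
    intro i w hw hl
    by_cases hi : (topData Δ q c).Ok i w
    · exact ofWords_ρ_ok Δ q c hi
    rcases w with _ | ⟨j, w⟩
    · exact nil i
    have hwn : w.length ≤ n := by simpa using hl
    have hjw : ofWords Δ q c (Data.bas (j :: w)) = u j • ofWords Δ q c (Data.bas w) := by
      rw [ofWords_bas, ofWords_bas, List.map_cons, List.prod_cons, mul_smul]
    rcases eq_or_ne i j with rfl | hij
    · have hs : sg i i ≠ 1 := fun h => hi ⟨hw.1.1, by simpa [topData] using h⟩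
      rw [(topData Δ q c).ρ_self hi, map_zero, hjw, ← mul_smul, u_sq i hs, zero_smul]
    · have hji := (topData Δ q c).lt_of_not_ok hw hi hij
      have e1 : ofWords Δ q c ((topData Δ q c).ρ j ((topData Δ q c).ρ i (Data.bas w))) =
          u j • ofWords Δ q c ((topData Δ q c).ρ i (Data.bas w)) := by
        refine map_eq_of_support (ofWords Δ q c ∘ₗ (topData Δ q c).ρ j)
          ((Algebra.lsmul ℂ ℂ (Verma .G Δ q c) (u j)) ∘ₗ ofWords Δ q c) _ fun v hv => ?_
        rw [Data.ρ_bas] at hv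
        obtain ⟨h1, h2⟩ := (topData Δ q c).act_support _ i w hw.2 v hv
        rcases h2 with h2 | ⟨_, h2⟩
        · exact ih j v h1 (h2.trans hwn)
        · exact ofWords_ρ_ok Δ q c (h2 j hji hw.1)
      have e2 : ofWords Δ q c ((topData Δ q c).ρL (bracket i j) (Data.bas w)) =
          linearCombination ℂ u (bracket i j) • ofWords Δ q c (Data.bas w) := by
        refine map_eq_of_support
          (ofWords Δ q c ∘ₗ LinearMap.applyₗ (Data.bas w) ∘ₗ (topData Δ q c).ρL)
          ((LinearMap.toSpanSingleton U _ (ofWords Δ q c (Data.bas w))).restrictScalars ℂ ∘ₗ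
            linearCombination ℂ u) _ fun k _ => ?_
        simpa [Data.ρL_single] using ih k w hw.2 hwn
      rw [(topData Δ q c).ρ_cons hw hi hij, map_add, map_smul, e1, ih i w hw.2 hwn, hjw,
        ← mul_smul, ← mul_smul, u_mul_u i j, add_smul, smul_assoc]
      exact congrArg _ e2

theorem ofWords_ρ (i : Gen) {x : List Gen →₀ ℂ} (hx : x ∈ (topData Δ q c).stdM) :
    ofWords Δ q c ((topData Δ q c).ρ i x) = u i • ofWords Δ q c x :=
  map_eq_of_support (ofWords Δ q c ∘ₗ (topData Δ q c).ρ i)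
    ((Algebra.lsmul ℂ ℂ (Verma .G Δ q c) (u i)) ∘ₗ ofWords Δ q c) _ fun w hw =>
      ofWords_ρ_bas Δ q c _ i w (hx hw) le_rfl

theorem toU_surjective : Function.Surjective toU := RingQuot.mkAlgHom_surjective ℂ TopRel

theorem ofWords_fockRep (a : U) (x : Fock Δ q c) :
    ofWords Δ q c (Fock.val Δ q c (fockRep Δ q c a x)) = a • ofWords Δ q c (Fock.val Δ q c x) := by
  obtain ⟨a, rfl⟩ := toU_surjective a
  induction a using FreeAlgebra.induction generalizing x with
  | grade0 z => simp
  | grade1 i =>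
    rw [show toU (FreeAlgebra.ι ℂ i) = u i from rfl, fockRep_u]
    exact ofWords_ρ Δ q c i (Fock.val_mem Δ q c x)
  | mul a b ha hb =>
    rw [map_mul, map_mul, Module.End.mul_apply, ha, hb, mul_smul]
  | add a b ha hb =>
    rw [map_add, map_add, LinearMap.add_apply, map_add, map_add, ha, hb, add_smul]

/-- Passing to words and multiplying out again is equivariant and fixes the highest weight vector,
which generates the module. -/
theorem toFock_injective : Function.Injective (toFock Δ q c) := by
  refine Function.LeftInverse.injective (g := fun x => ofWords Δ q c (Fock.val Δ q c x)) fun x => ?_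
  induction x using Submodule.Quotient.induction_on with
  | _ b =>
    beta_reduce
    rw [toFock_mk, ofWords_fockRep, Fock.val_fockVac, ofWords_bas, List.map_nil, List.prod_nil, one_smul,
      hwv, Submodule.mkQ_apply, ← Submodule.Quotient.mk_smul, smul_eq_mul, mul_one]

/-- The coordinates of a vector of the Verma module with respect to the ordered words. -/
def coords : Verma .G Δ q c →ₗ[ℂ] (List Gen →₀ ℂ) := Fock.val Δ q c ∘ₗ toFock Δ q c

theorem coords_injective : Function.Injective (coords Δ q c) :=
  (Fock.val_injective Δ q c).comp (toFock_injective Δ q c)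

theorem coords_mem (x : Verma .G Δ q c) : coords Δ q c x ∈ (topData Δ q c).stdM :=
  Fock.val_mem Δ q c _

theorem coords_smul (i : Gen) (x : Verma .G Δ q c) :
    coords Δ q c (u i • x) = (topData Δ q c).ρ i (coords Δ q c x) := by
  rw [coords, LinearMap.comp_apply, toFock_smul, fockRep_u, fockOp_val]
  rfl

end TopN2
end

noncomputable section
namespace TopN2
open Finsupp SuperPBW Gen

/-! ### Ordered words -/

/-- The basis element `L (-1)`, the smallest in the order. -/
abbrev e : Gen := L (-1)

theorem e_le (x : Gen) : e ≤ x := by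
  rw [le_iff]
  have : key e = toLex (0, 0) := by simp [key]
  rw [this, Prod.Lex.le_iff]
  simp only [ofLex_toLex]
  rcases Nat.eq_zero_or_pos (ofLex (key x)).1 with h | h
  · exact Or.inr ⟨h.symm, Nat.zero_le _⟩
  · exact Or.inl h

/-- The negative basis elements other than `L (-1)` and `Q 0`; they span a subalgebra. -/
def Low (x : Gen) : Prop := negative x ∧ x ≠ e ∧ x ≠ Q 0

theorem le_Q_zero {x : Gen} (h : negative x) : x ≤ Q 0 := by
  rw [le_iff, Prod.Lex.le_iff]
  unfold negative at h
  have hk : key (Q 0) = toLex (5, 0) := by simp [key]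
  rcases h.lt_or_eq with h' | h'
  · left; simpa [hk] using h'
  · right
    rcases x with n | n | n | n | _ <;> simp [key] at h' ⊢ <;> split_ifs at h' ⊢ <;> simp_all

theorem Low.lt_Q_zero {x : Gen} (h : Low x) : x < Q 0 := lt_of_le_of_ne (le_Q_zero h.1) h.2.2

theorem low_L {n : ℤ} : Low (L n) ↔ n ≤ -2 := by
  simp [Low, negative_L]; omega

theorem low_H {n : ℤ} : Low (H n) ↔ n < 0 := by
  simp [Low, negative_H]

theorem low_G {n : ℤ} : Low (G n) ↔ n < 0 := by
  simp [Low, negative_G]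

theorem low_Q {n : ℤ} : Low (Q n) ↔ n < 0 := by
  simp [Low, negative_Q]; omega

theorem not_low_C : ¬ Low C := fun h => not_negative_C h.1

/-- Two negative indices sum to at most -2, so neither `L (-1)`, nor `Q 0`, nor a central term can
arise. -/
theorem bracket_low {i j k : Gen} (hi : Low i) (hj : Low j) (hk : k ∈ (bracket i j).support) :
    Low k := by
  revert hk
  contrapose!
  intro hk
  rw [Finsupp.notMem_support_iff]
  rcases i with m | m | m | m | _ <;> rcases j with n | n | n | n | _ <;>
    rcases k with p | p | p | p | _ <;>
    (try simp only [low_L, low_H, low_G, low_Q, not_low_C] at hi hj hk) <;>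
    (try simp [bracket, Finsupp.single_apply]) <;> (try have hne : m + n ≠ p := by omega) <;>
    (try simp [hne]) <;> omega

/-- The bracket of a low element with `L (-1)` is low. -/
theorem bracket_low_e {i k : Gen} (hi : Low i) (hk : k ∈ (bracket i e).support) : Low k := by
  revert hk
  contrapose!
  intro hk
  rw [Finsupp.notMem_support_iff]
  rcases i with m | m | m | m | _ <;> rcases k with p | p | p | p | _ <;>
    (try simp only [low_L, low_H, low_G, low_Q, not_low_C] at hi hk) <;>
    (try simp [bracket, Finsupp.single_apply]) <;> (try have hne : m + -1 ≠ p := by omega) <;>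
    (try simp [hne])

variable (Δ q c : ℂ)

/-- The action of a basis element on words. -/
abbrev op (x : Gen) : (List Gen →₀ ℂ) →ₗ[ℂ] (List Gen →₀ ℂ) := (topData Δ q c).ρ x

/-- The action of an element of the Lie superalgebra on words. -/
abbrev opL (x : Gen →₀ ℂ) : (List Gen →₀ ℂ) →ₗ[ℂ] (List Gen →₀ ℂ) := (topData Δ q c).ρL x

/-- Ordered words of negative basis elements. -/
abbrev Std (w : List Gen) : Prop := (topData 0 0 0).Std w

theorem std_iff (w : List Gen) : (topData Δ q c).Std w ↔ Std w := by
  induction w with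
  | nil => exact Iff.rfl
  | cons x w ih => exact and_congr Iff.rfl ih

theorem Std.negative {w : List Gen} (hw : Std w) {x : Gen} (hx : x ∈ w) : negative x := by
  induction w with
  | nil => simp at hx
  | cons y w ih =>
    rcases List.mem_cons.1 hx with rfl | hx
    · exact hw.1.1
    · exact ih hw.2 hx

theorem Std.le {x y : Gen} {w : List Gen} (hw : Std (x :: w)) (hy : y ∈ w) :
    x < y ∨ (x = y ∧ sg x x = 1) := by
  induction w generalizing x with
  | nil => simp at hy
  | cons z w ih =>
    have hxz : x < z ∨ (x = z ∧ sg x x = 1) := hw.1.2 z (by simp)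
    rcases List.mem_cons.1 hy with rfl | hy
    · exact hxz
    · rcases ih hw.2 hy with h | ⟨rfl, h⟩
      · left
        rcases hxz with h' | ⟨rfl, _⟩
        · exact h'.trans h
        · exact h
      · exact hxz

/-- `L (-1)` is even and smallest, so it may be repeated and put in front of anything: its action is
plain prefixing. -/
theorem ok_e {w : List Gen} : (topData Δ q c).Ok e w := by
  refine ⟨negative_L.2 (by norm_num), fun y _ => ?_⟩
  rcases (e_le y).lt_or_eq with h | h
  · exact Or.inl h
  · exact Or.inr ⟨h, rfl⟩

theorem op_e_bas (w : List Gen) : op Δ q c e (Data.bas w) = Data.bas (e :: w) :=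
  (topData Δ q c).ρ_ok (ok_e Δ q c)

theorem op_head {x : Gen} {w : List Gen} (hw : Std (x :: w)) :
    op Δ q c x (Data.bas w) = Data.bas (x :: w) := (topData Δ q c).ρ_ok hw.1

/-- The ordered words without `L (-1)`. -/
def Red (w : List Gen) : Prop := Std w ∧ e ∉ w

theorem Red.tail {x : Gen} {w : List Gen} (h : Red (x :: w)) : Red w :=
  ⟨h.1.2, fun h' => h.2 (List.mem_cons_of_mem _ h')⟩

theorem red_nil : Red [] := ⟨trivial, by simp⟩

theorem red_Q_zero : Red [Q 0] := ⟨⟨(topData 0 0 0).ok_nil.2 (negative_Q.2 le_rfl), trivial⟩, by simp⟩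

theorem sg_Q (m n : ℤ) : sg (Q m) (Q n) = -1 := rfl

/-- An ordered word without `L (-1)` is empty, or `Q 0`, or has a low first letter. -/
theorem Red.cases {w : List Gen} (hw : Red w) :
    w = [] ∨ w = [Q 0] ∨ ∃ y w', w = y :: w' ∧ Low y ∧ Red w' := by
  rcases w with _ | ⟨y, w⟩
  · exact Or.inl rfl
  · right
    by_cases hy : y = Q 0
    · left
      subst hy
      rcases w with _ | ⟨z, w⟩
      · rfl
      · exfalso
        rcases hw.1.le (y := z) (by simp) with h | ⟨_, h⟩
        · exact absurd h (le_Q_zero (hw.1.negative (by simp))).not_gt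
        · rw [sg_Q] at h; norm_num at h
    · exact Or.inr ⟨y, w, rfl, ⟨hw.1.negative (by simp), fun h => hw.2 (by simp [h]), hy⟩, hw.tail⟩

/-- The span of the ordered words without `L (-1)`. -/
def redM : Submodule ℂ (List Gen →₀ ℂ) := Finsupp.supported ℂ ℂ {w | Red w}

theorem bas_mem_redM {w : List Gen} (hw : Red w) : Data.bas w ∈ redM :=
  Finsupp.single_mem_supported ℂ _ hw

theorem redM_le : redM ≤ (topData Δ q c).stdM := fun _ hx _ hw => (std_iff Δ q c _).2 (hx hw).1

theorem op_comm {x : List Gen →₀ ℂ} (hx : x ∈ (topData Δ q c).stdM) (i j : Gen) :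
    op Δ q c i (op Δ q c j x) = sg i j • op Δ q c j (op Δ q c i x) + opL Δ q c (bracket i j) x :=
  (topData Δ q c).comm hx i j

/-- The span of the ordered words without `L (-1)` with all low letters in `J`. -/
def wordsIn (J : Gen → Prop) : Submodule ℂ (List Gen →₀ ℂ) :=
  Finsupp.supported ℂ ℂ {w | Red w ∧ ∀ y ∈ w, Low y → J y}

theorem bas_mem_wordsIn {J : Gen → Prop} {w : List Gen} (hw : Red w) (h : ∀ y ∈ w, Low y → J y) :
    Data.bas w ∈ wordsIn J := Finsupp.single_mem_supported ℂ _ ⟨hw, h⟩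

theorem wordsIn_le_redM (J : Gen → Prop) : wordsIn J ≤ redM := fun _ hx _ hw => (hx hw).1

/-- Inserting a low letter into a word moves it only past smaller low letters; all corrections are
brackets of low letters, which are low and remain in `J`. -/
theorem act_low (J : Gen → Prop)
    (hJ : ∀ i j, J i → J j → Low i → Low j → ∀ k ∈ (bracket i j).support, J k)
    (n : ℕ) : ∀ (i : Gen) (w : List Gen), Low i → J i → Red w → (∀ y ∈ w, Low y → J y) →
    ∀ v ∈ ((topData Δ q c).act n i w).support, Red v ∧ ∀ y ∈ v, Low y → J y := by
  suffices ∀ (i : Gen) (w : List Gen), Low i → J i → Red w → (∀ y ∈ w, Low y → J y) →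
      ∀ v ∈ ((topData Δ q c).act n i w).support, e ∉ v ∧ ∀ y ∈ v, Low y → J y from
    fun i w hi hJi hw hJw v hv => ⟨⟨(std_iff Δ q c _).1
      ((topData Δ q c).act_support n i w ((std_iff Δ q c _).2 hw.1) v hv).1,
      (this i w hi hJi hw hJw v hv).1⟩, (this i w hi hJi hw hJw v hv).2⟩
  have okc : ∀ (i : Gen) (w : List Gen), Low i → J i → Red w → (∀ y ∈ w, Low y → J y) →
      ∀ v ∈ (single (i :: w) (1 : ℂ)).support, e ∉ v ∧ ∀ y ∈ v, Low y → J y := by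
    intro i w hi hJi hw hJw v hv
    obtain rfl : v = i :: w := by simpa using Finsupp.support_single_subset hv
    refine ⟨by simp [hw.2, hi.2.1.symm], fun y hy hl => ?_⟩
    rcases List.mem_cons.1 hy with rfl | hy
    · exact hJi
    · exact hJw y hy hl
  induction n with
  | zero =>
    intro i w hi hJi hw hJw v hv
    by_cases hok : (topData Δ q c).Ok i w
    · rw [(topData Δ q c).act_ok hok] at hv
      exact okc i w hi hJi hw hJw v hv
    · rcases w with _ | ⟨j, w⟩
      · exact absurd ((topData Δ q c).ok_nil.2 hi.1) hok
      · simp [Data.act, hok] at hv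
  | succ n ih =>
    intro i w hi hJi hw hJw v hv
    by_cases hok : (topData Δ q c).Ok i w
    · rw [(topData Δ q c).act_ok hok] at hv
      exact okc i w hi hJi hw hJw v hv
    · rcases w with _ | ⟨j, w⟩
      · exact absurd ((topData Δ q c).ok_nil.2 hi.1) hok
      · by_cases hij : i = j
        · subst hij
          simp [(topData Δ q c).act_eq hok] at hv
        · have hji := (topData Δ q c).lt_of_not_ok ((std_iff Δ q c _).2 hw.1) hok hij
          have hj : Low j := ⟨hw.1.negative (by simp), fun h => hw.2 (by simp [h]),
            fun h => absurd hi.lt_Q_zero (h ▸ hji).not_gt⟩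
          have hJj : J j := hJw j (by simp) hj
          have hJw' : ∀ y ∈ w, Low y → J y := fun y hy => hJw y (List.mem_cons_of_mem _ hy)
          rw [(topData Δ q c).act_cons hok hij] at hv
          rcases Finset.mem_union.1 (Finsupp.support_add hv) with hv | hv
          · have hv := Finsupp.support_smul hv
            rw [linearCombination_apply] at hv
            obtain ⟨v', hv', hv⟩ := Finset.mem_biUnion.1 (Finsupp.support_sum hv)
            have hstd := ((topData Δ q c).act_support n i w
              ((std_iff Δ q c _).2 hw.tail.1) v' hv').1
            have h := ih i w hi hJi hw.tail hJw' v' hv'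
            exact ih j v' hj hJj ⟨(std_iff Δ q c _).1 hstd, h.1⟩ h.2 v (Finsupp.support_smul hv)
          · rw [linearCombination_apply] at hv
            obtain ⟨k, hk, hv⟩ := Finset.mem_biUnion.1 (Finsupp.support_sum hv)
            exact ih k w (bracket_low hi hj hk) (hJ i j hJi hJj hi hj k hk) hw.tail hJw' v
              (Finsupp.support_smul hv)

/-- Low elements in a subalgebra preserve the span of the words with letters in that subalgebra. -/
theorem op_mem_wordsIn (J : Gen → Prop)
    (hJ : ∀ i j, J i → J j → Low i → Low j → ∀ k ∈ (bracket i j).support, J k)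
    {i : Gen} (hi : Low i) (hJi : J i) {x : List Gen →₀ ℂ} (hx : x ∈ wordsIn J) :
    op Δ q c i x ∈ wordsIn J := by
  refine map_mem_of_support _ _ _ fun w hw => ?_
  rw [show single w (1 : ℂ) = Data.bas w from rfl, op, Data.ρ_bas]
  exact fun v hv => act_low Δ q c J hJ _ i w hi hJi (hx hw).1 (hx hw).2 v hv

/-- The low elements preserve the span of the ordered words without `L (-1)`. -/
theorem op_low_mem {i : Gen} (hi : Low i) {x : List Gen →₀ ℂ} (hx : x ∈ redM) :
    op Δ q c i x ∈ redM :=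
  wordsIn_le_redM _ (op_mem_wordsIn Δ q c (fun _ => True) (fun _ _ _ _ _ _ _ _ => trivial) hi trivial
    fun _ hw => ⟨hx hw, fun _ _ _ => trivial⟩)

theorem opL_mem_of_support {y : Gen →₀ ℂ} {x : List Gen →₀ ℂ} (S : Submodule ℂ (List Gen →₀ ℂ))
    (h : ∀ k ∈ y.support, op Δ q c k x ∈ S) : opL Δ q c y x ∈ S :=
  map_mem_of_support (LinearMap.applyₗ x ∘ₗ (topData Δ q c).ρL) S y fun k hk => by
    simpa [Data.ρL_single] using h k hk

/-- Every basis element maps the words without `L (-1)` to words with at most one `L (-1)`. -/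
theorem op_mem_sup (w : List Gen) (hw : Red w) : ∀ i : Gen,
    op Δ q c i (Data.bas w) ∈ redM ⊔ redM.map (op Δ q c e) := by
  have std {x} (hx : x ∈ redM) := redM_le Δ q c hx
  have nil : ∀ i, op Δ q c i (Data.bas []) ∈ redM ⊔ redM.map (op Δ q c e) := by
    intro i
    by_cases hi : negative i
    · by_cases hie : i = e
      · subst hie
        exact Submodule.mem_sup_right ⟨_, bas_mem_redM red_nil, rfl⟩
      · rw [op, (topData Δ q c).ρ_ok ((topData Δ q c).ok_nil.2 hi)]
        refine Submodule.mem_sup_left (bas_mem_redM ⟨⟨(topData 0 0 0).ok_nil.2 hi, trivial⟩, ?_⟩)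
        simp [Ne.symm hie]
    · rw [op, (topData Δ q c).ρ_nil hi]
      exact Submodule.smul_mem _ _ (Submodule.mem_sup_left (bas_mem_redM red_nil))
  induction w with
  | nil => exact nil
  | cons y w ih =>
    intro i
    rcases hw.cases with h | h | ⟨y', w', h, hy, hw'⟩
    · simp at h
    · obtain ⟨rfl, rfl⟩ : y = Q 0 ∧ w = [] := by simpa using h
      by_cases hi : negative i
      · by_cases hie : i = e
        · subst hie
          exact Submodule.mem_sup_right ⟨_, bas_mem_redM red_Q_zero, rfl⟩
        · by_cases hiQ : i = Q 0
          · subst hiQ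
            have : ¬ (topData Δ q c).Ok (Q 0) [Q 0] := by
              rintro ⟨_, h⟩
              rcases h (Q 0) (by simp) with h | ⟨_, h⟩
              · exact lt_irrefl _ h
              · exact absurd h (by simp [topData, sg_Q]; norm_num)
            rw [op, (topData Δ q c).ρ_self this]
            exact Submodule.zero_mem _
          · exact Submodule.mem_sup_left (op_low_mem Δ q c ⟨hi, hie, hiQ⟩ (bas_mem_redM red_Q_zero))
      · rw [← op_head Δ q c hw.1, op_comm Δ q c (std (bas_mem_redM red_nil)), op, op,
          (topData Δ q c).ρ_nil hi, map_smul]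
        exact Submodule.add_mem _ (Submodule.smul_mem _ _ (Submodule.smul_mem _ _ (nil _)))
          (opL_mem_of_support Δ q c _ fun k _ => nil k)
    · obtain ⟨rfl, rfl⟩ : y = y' ∧ w = w' := by simpa using h
      rw [← op_head Δ q c hw.1, op_comm Δ q c (std (bas_mem_redM hw'))]
      refine Submodule.add_mem _ (Submodule.smul_mem _ _ ?_)
        (opL_mem_of_support Δ q c _ fun k _ => ih hw' k)
      -- Applying the low letter `y` to p + L_{-1} r keeps this shape, because the bracket of `y`
      -- with L_{-1} is again low.
      obtain ⟨p, hp, _, ⟨r, hr, rfl⟩, h⟩ := Submodule.mem_sup.1 (ih hw' i)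
      rw [← h, map_add, op_comm Δ q c (std hr)]
      refine Submodule.add_mem _ (Submodule.mem_sup_left (op_low_mem Δ q c hy hp))
        (Submodule.add_mem _ (Submodule.smul_mem _ _ (Submodule.mem_sup_right
          ⟨_, op_low_mem Δ q c hy hr, rfl⟩)) (Submodule.mem_sup_left ?_))
      exact opL_mem_of_support Δ q c _ fun k hk => op_low_mem Δ q c (bracket_low_e hy hk) hr

/-- Every basis element maps the words without `L (-1)` to words with at most one `L (-1)`. -/
theorem exists_op_eq (i : Gen) {x : List Gen →₀ ℂ} (hx : x ∈ redM) :
    ∃ p ∈ redM, ∃ r ∈ redM, op Δ q c i x = p + op Δ q c e r := by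
  have : op Δ q c i x ∈ redM ⊔ redM.map (op Δ q c e) :=
    map_mem_of_support _ _ _ fun w hw => op_mem_sup Δ q c w (hx hw) i
  obtain ⟨p, hp, _, ⟨r, hr, rfl⟩, h⟩ := Submodule.mem_sup.1 this
  exact ⟨p, hp, r, hr, h.symm⟩

end TopN2
end

noncomputable section
namespace TopN2
open Finsupp SuperPBW Gen

/-! ### Leading coefficients with respect to powers of `L (-1)` -/

/-- The coefficient of the `a`-th power of `L (-1)`. -/
def cf (a : ℕ) : (List Gen →₀ ℂ) →ₗ[ℂ] (List Gen →₀ ℂ) :=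
  linearCombination ℂ fun w => if w.count e = a then Data.bas (w.filter (· ≠ e)) else 0

/-- The coefficient of the power of `L (-1)` preceding the `a`-th. -/
def cfPred (a : ℕ) : (List Gen →₀ ℂ) →ₗ[ℂ] (List Gen →₀ ℂ) :=
  linearCombination ℂ fun w => if w.count e + 1 = a then Data.bas (w.filter (· ≠ e)) else 0

theorem cf_bas (a : ℕ) (w : List Gen) : cf a (Data.bas w) =
    if w.count e = a then Data.bas (w.filter (· ≠ e)) else 0 := by
  simp [cf]

theorem cfPred_bas (a : ℕ) (w : List Gen) : cfPred a (Data.bas w) =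
    if w.count e + 1 = a then Data.bas (w.filter (· ≠ e)) else 0 := by
  simp [cfPred]

theorem Red.count {w : List Gen} (hw : Red w) : w.count e = 0 := List.count_eq_zero.2 hw.2

theorem Red.filter {w : List Gen} (hw : Red w) : w.filter (· ≠ e) = w :=
  List.filter_eq_self.2 fun x hx => by
    simpa using fun h : x = e => hw.2 (h ▸ hx)

theorem cf_zero_red {x : List Gen →₀ ℂ} (hx : x ∈ redM) : cf 0 x = x :=
  map_eq_of_support (cf 0) LinearMap.id x fun w hw => by
    have := hx hw
    simp only [cf, linearCombination_single, this.count, this.filter]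
    simp

theorem cf_succ_red (a : ℕ) {x : List Gen →₀ ℂ} (hx : x ∈ redM) : cf (a + 1) x = 0 :=
  map_eq_of_support (cf (a + 1)) 0 x fun w hw => by
    have := hx hw
    simp [cf, this.count]

/-- An ordered word is a power of `L (-1)` followed by a word without `L (-1)`. -/
theorem Std.eq_append {w : List Gen} (hw : Std w) :
    w = List.replicate (w.count e) e ++ w.filter (· ≠ e) ∧ Red (w.filter (· ≠ e)) := by
  induction w with
  | nil => exact ⟨rfl, red_nil⟩
  | cons x w ih =>
    by_cases hx : x = e
    · subst hx
      obtain ⟨h1, h2⟩ := ih hw.2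
      refine ⟨?_, by simpa using h2⟩
      conv_lhs => rw [h1]
      simp [List.replicate_succ]
    · have hr : Red (x :: w) := by
        refine ⟨hw, fun h => ?_⟩
        rcases List.mem_cons.1 h with h | h
        · exact hx h.symm
        · rcases hw.le h with h | h
          · exact absurd h (e_le x).not_gt
          · exact hx h.1
      rw [hr.count, hr.filter]
      exact ⟨rfl, hr⟩

variable (Δ q c : ℂ)

theorem cf_succ_e (a : ℕ) (x : List Gen →₀ ℂ) : cf (a + 1) (op Δ q c e x) = cf a x :=
  map_eq_of_support (cf (a + 1) ∘ₗ op Δ q c e) (cf a) x fun w _ => by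
    rw [LinearMap.comp_apply, show single w (1 : ℂ) = Data.bas w from rfl, op_e_bas, cf_bas, cf_bas]
    simp

theorem cf_zero_e (x : List Gen →₀ ℂ) : cf 0 (op Δ q c e x) = 0 :=
  map_eq_of_support (cf 0 ∘ₗ op Δ q c e) 0 x fun w _ => by
    rw [LinearMap.comp_apply, show single w (1 : ℂ) = Data.bas w from rfl, op_e_bas, cf_bas]
    simp

/-- The part of a basis element which raises the power of `L (-1)`. -/
def raise (i : Gen) : (List Gen →₀ ℂ) →ₗ[ℂ] (List Gen →₀ ℂ) := cf 1 ∘ₗ op Δ q c i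

/-- The part of a basis element which preserves the power of `L (-1)`. -/
def keep (i : Gen) : (List Gen →₀ ℂ) →ₗ[ℂ] (List Gen →₀ ℂ) := cf 0 ∘ₗ op Δ q c i

/-- The linear extension of `raise` to the Lie superalgebra. -/
def raiseL (y : Gen →₀ ℂ) : (List Gen →₀ ℂ) →ₗ[ℂ] (List Gen →₀ ℂ) :=
  linearCombination ℂ (raise Δ q c) y

theorem raiseL_eq (y : Gen →₀ ℂ) (x : List Gen →₀ ℂ) :
    raiseL Δ q c y x = cf 1 (opL Δ q c y x) :=
  map_eq_of_support (LinearMap.applyₗ x ∘ₗ linearCombination ℂ (raise Δ q c))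
    (cf 1 ∘ₗ LinearMap.applyₗ x ∘ₗ (topData Δ q c).ρL) y fun k _ => by
      simp [raise, Data.ρL_single]

theorem raiseL_eq_zero {y : Gen →₀ ℂ} {x : List Gen →₀ ℂ}
    (h : ∀ k ∈ y.support, raise Δ q c k x = 0) : raiseL Δ q c y x = 0 :=
  map_eq_of_support (LinearMap.applyₗ x ∘ₗ linearCombination ℂ (raise Δ q c)) 0 y fun k hk => by
    simpa using h k hk

theorem raiseL_single (i : Gen) (a : ℂ) : raiseL Δ q c (single i a) = a • raise Δ q c i := by
  simp [raiseL]

theorem raiseL_add (y z : Gen →₀ ℂ) : raiseL Δ q c (y + z) = raiseL Δ q c y + raiseL Δ q c z := by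
  simp [raiseL]

variable {Δ q c}

theorem raise_mem (i : Gen) {x : List Gen →₀ ℂ} (hx : x ∈ redM) : raise Δ q c i x ∈ redM := by
  obtain ⟨p, hp, r, hr, h⟩ := exists_op_eq Δ q c i hx
  rw [raise, LinearMap.comp_apply, h, map_add, cf_succ_red _ hp, cf_succ_e, cf_zero_red hr, zero_add]
  exact hr

theorem keep_mem (i : Gen) {x : List Gen →₀ ℂ} (hx : x ∈ redM) : keep Δ q c i x ∈ redM := by
  obtain ⟨p, hp, r, hr, h⟩ := exists_op_eq Δ q c i hx
  rw [keep, LinearMap.comp_apply, h, map_add, cf_zero_red hp, cf_zero_e, add_zero]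
  exact hp

/-- By `exists_op_eq` no power of L_{-1} beyond the first occurs, so these two coefficients recover
the whole action. -/
theorem op_eq (i : Gen) {x : List Gen →₀ ℂ} (hx : x ∈ redM) :
    op Δ q c i x = keep Δ q c i x + op Δ q c e (raise Δ q c i x) := by
  obtain ⟨p, hp, r, hr, h⟩ := exists_op_eq Δ q c i hx
  have h1 : keep Δ q c i x = p := by
    rw [keep, LinearMap.comp_apply, h, map_add, cf_zero_red hp, cf_zero_e, add_zero]
  have h2 : raise Δ q c i x = r := by
    rw [raise, LinearMap.comp_apply, h, map_add, cf_succ_red _ hp, cf_succ_e, cf_zero_red hr,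
      zero_add]
  rw [h1, h2, h]

theorem cf_op (a : ℕ) (i : Gen) {x : List Gen →₀ ℂ} (hx : x ∈ redM) :
    cf (a + 2) (op Δ q c i x) = 0 := by
  rw [op_eq i hx, map_add, cf_succ_red _ (keep_mem i hx), cf_succ_e, cf_succ_red _ (raise_mem i hx),
    add_zero]

theorem raise_low {i : Gen} (hi : Low i) {x : List Gen →₀ ℂ} (hx : x ∈ redM) :
    raise Δ q c i x = 0 := cf_succ_red _ (op_low_mem Δ q c hi hx)

theorem keep_eq {i : Gen} {x : List Gen →₀ ℂ} (h : op Δ q c i x ∈ redM) :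
    keep Δ q c i x = op Δ q c i x := cf_zero_red h

theorem raise_e {x : List Gen →₀ ℂ} (hx : x ∈ redM) : raise Δ q c e x = x := by
  rw [raise, LinearMap.comp_apply, cf_succ_e, cf_zero_red hx]

theorem pow_mem (a : ℕ) {x : List Gen →₀ ℂ} (hx : x ∈ (topData Δ q c).stdM) :
    (op Δ q c e ^ a) x ∈ (topData Δ q c).stdM := by
  induction a with
  | zero => simpa using hx
  | succ a ih =>
    rw [pow_succ', Module.End.mul_apply]
    exact (topData Δ q c).ρ_mem _ ih

theorem sg_e (i : Gen) : sg i e = 1 := by simp [sg, odd]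

/-- The two leading coefficients of the action of a basis element on a power of `L (-1)`. -/
theorem cf_op_pow {x : List Gen →₀ ℂ} (hx : x ∈ redM) (a : ℕ) : ∀ i : Gen,
    (∀ b, a + 1 < b → cf b (op Δ q c i ((op Δ q c e ^ a) x)) = 0) ∧
    cf (a + 1) (op Δ q c i ((op Δ q c e ^ a) x)) = raise Δ q c i x ∧
    cf a (op Δ q c i ((op Δ q c e ^ a) x)) =
      keep Δ q c i x + (a : ℂ) • raiseL Δ q c (bracket i e) x := by
  induction a with
  | zero =>
    intro i
    refine ⟨fun b hb => ?_, by simp [raise], by simp [keep]⟩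
    obtain ⟨b, rfl⟩ := Nat.exists_eq_add_of_lt hb
    rw [show 0 + 1 + b + 1 = b + 2 by ring]
    exact cf_op b i hx
  | succ a ih =>
    intro i
    have hy := pow_mem (Δ := Δ) (q := q) (c := c) a (redM_le Δ q c hx)
    set y := (op Δ q c e ^ a) x with hyd
    -- Each L_{-1} that `i` crosses leaves a bracket with L_{-1}, whose raising part enters at the
    -- lower of the two powers; crossing `a` factors produces the coefficient `a`.
    have hcomm := op_comm Δ q c hy i e
    rw [sg_e, one_smul] at hcomm
    rw [pow_succ', Module.End.mul_apply, ← hyd, hcomm]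
    have hb1 : ∀ b, a + 1 < b → cf b (opL Δ q c (bracket i e) y) = 0 := fun b hb =>
      map_eq_of_support (cf b ∘ₗ LinearMap.applyₗ y ∘ₗ (topData Δ q c).ρL) 0 _ fun k _ => by
        simpa [Data.ρL_single] using (ih k).1 b hb
    have hb2 : cf (a + 1) (opL Δ q c (bracket i e) y) = raiseL Δ q c (bracket i e) x :=
      map_eq_of_support (cf (a + 1) ∘ₗ LinearMap.applyₗ y ∘ₗ (topData Δ q c).ρL)
        (LinearMap.applyₗ x ∘ₗ linearCombination ℂ (raise Δ q c)) _ fun k _ => by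
        simpa [Data.ρL_single] using (ih k).2.1
    refine ⟨fun b hb => ?_, ?_, ?_⟩
    · obtain ⟨b, rfl⟩ : ∃ b', b = b' + 1 := ⟨b - 1, by omega⟩
      rw [map_add, cf_succ_e, (ih i).1 b (by omega), hb1 _ (by omega), add_zero]
    · rw [map_add, cf_succ_e, (ih i).2.1, hb1 _ (by omega), add_zero]
    · rw [map_add, cf_succ_e, (ih i).2.2, hb2]
      push_cast
      module

theorem pow_bas (a : ℕ) (w : List Gen) :
    (op Δ q c e ^ a) (Data.bas w) = Data.bas (List.replicate a e ++ w) := by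
  induction a with
  | zero => simp
  | succ a ih => rw [pow_succ', Module.End.mul_apply, ih, op_e_bas]; rfl

theorem Std.bas_eq {w : List Gen} (hw : Std w) :
    Data.bas w = (op Δ q c e ^ w.count e) (Data.bas (w.filter (· ≠ e))) := by
  rw [pow_bas, ← hw.eq_append.1]

theorem cf_mem (a : ℕ) {x : List Gen →₀ ℂ} (hx : x ∈ (topData Δ q c).stdM) : cf a x ∈ redM :=
  map_mem_of_support _ _ _ fun w hw => by
    rw [show single w (1 : ℂ) = Data.bas w from rfl, cf_bas]
    split_ifs
    · exact bas_mem_redM ((std_iff Δ q c w).1 (hx hw)).eq_append.2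
    · exact Submodule.zero_mem _

theorem cfPred_mem (a : ℕ) {x : List Gen →₀ ℂ} (hx : x ∈ (topData Δ q c).stdM) :
    cfPred a x ∈ redM :=
  map_mem_of_support _ _ _ fun w hw => by
    rw [show single w (1 : ℂ) = Data.bas w from rfl, cfPred_bas]
    split_ifs
    · exact bas_mem_redM ((std_iff Δ q c w).1 (hx hw)).eq_append.2
    · exact Submodule.zero_mem _

/-- The leading coefficient of the action of a basis element. -/
theorem cf_succ_op {x : List Gen →₀ ℂ} (hx : x ∈ (topData Δ q c).stdM) {a : ℕ}
    (ha : ∀ w ∈ x.support, w.count e ≤ a) (i : Gen) :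
    cf (a + 1) (op Δ q c i x) = raise Δ q c i (cf a x) :=
  map_eq_of_support (cf (a + 1) ∘ₗ op Δ q c i) (raise Δ q c i ∘ₗ cf a) x fun w hw => by
    have hs := (std_iff Δ q c w).1 (hx hw)
    have hf := cf_op_pow (Δ := Δ) (q := q) (c := c) (bas_mem_redM hs.eq_append.2) (w.count e) i
    rw [← hs.bas_eq] at hf
    rw [LinearMap.comp_apply, LinearMap.comp_apply, show single w (1 : ℂ) = Data.bas w from rfl,
      cf_bas]
    rcases (ha w hw).eq_or_lt with h | h
    · rw [if_pos h, ← hf.2.1, h]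
    · rw [if_neg h.ne, map_zero, hf.1 _ (by omega)]

/-- The second coefficient of the action of a basis element. -/
theorem cf_op_eq {x : List Gen →₀ ℂ} (hx : x ∈ (topData Δ q c).stdM) {a : ℕ}
    (ha : ∀ w ∈ x.support, w.count e ≤ a) (i : Gen) :
    cf a (op Δ q c i x) = keep Δ q c i (cf a x) + (a : ℂ) • raiseL Δ q c (bracket i e) (cf a x) +
      raise Δ q c i (cfPred a x) :=
  map_eq_of_support (cf a ∘ₗ op Δ q c i) (keep Δ q c i ∘ₗ cf a +
    (a : ℂ) • (raiseL Δ q c (bracket i e) ∘ₗ cf a) + raise Δ q c i ∘ₗ cfPred a) x fun w hw => by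
    have hs := (std_iff Δ q c w).1 (hx hw)
    have hf := cf_op_pow (Δ := Δ) (q := q) (c := c) (bas_mem_redM hs.eq_append.2) (w.count e) i
    rw [← hs.bas_eq] at hf
    simp only [LinearMap.add_apply, LinearMap.smul_apply, LinearMap.comp_apply]
    rw [show single w (1 : ℂ) = Data.bas w from rfl, cf_bas, cfPred_bas]
    rcases (ha w hw).eq_or_lt with h | h
    · rw [if_pos h, if_neg (by omega), map_zero, add_zero, ← h, hf.2.2]
    · rw [if_neg h.ne, map_zero, map_zero, smul_zero, add_zero, zero_add]
      by_cases h' : w.count e + 1 = a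
      · rw [if_pos h', ← h', hf.2.1]
      · rw [if_neg h', map_zero, hf.1 _ (by omega)]

/-- The raising part supercommutes with low elements up to the bracket. -/
theorem raise_op_low (i : Gen) {y : Gen} (hy : Low y) {x : List Gen →₀ ℂ} (hx : x ∈ redM) :
    raise Δ q c i (op Δ q c y x) =
      sg i y • op Δ q c y (raise Δ q c i x) + raiseL Δ q c (bracket i y) x := by
  -- The only obstruction to moving `y` past the newly created L_{-1} is their bracket, which is low
  -- and creates no further L_{-1}.
  have h1 : cf 1 (opL Δ q c (bracket y e) (raise Δ q c i x)) = 0 := by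
    rw [← raiseL_eq]
    exact raiseL_eq_zero Δ q c fun k hk => raise_low (bracket_low_e hy hk) (raise_mem i hx)
  rw [raise, LinearMap.comp_apply, op_comm Δ q c (redM_le Δ q c hx), map_add, map_smul, raiseL_eq,
    op_eq i hx, map_add, map_add, op_comm Δ q c (redM_le Δ q c (raise_mem i hx)), map_add, h1,
    sg_e, one_smul, cf_succ_e, cf_succ_red _ (op_low_mem Δ q c hy (keep_mem i hx)),
    cf_zero_red (op_low_mem Δ q c hy (raise_mem i hx)), zero_add, add_zero]
  rfl

theorem raise_nil {i : Gen} (hi : i ≠ e) : raise Δ q c i (Data.bas []) = 0 := by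
  by_cases hn : negative i
  · rw [raise, LinearMap.comp_apply, op, (topData Δ q c).ρ_ok ((topData Δ q c).ok_nil.2 hn), cf_bas]
    simp [hi]
  · rw [raise, LinearMap.comp_apply, op, (topData Δ q c).ρ_nil hn, map_smul,
      cf_succ_red _ (bas_mem_redM red_nil), smul_zero]

theorem bracket_Q_zero {i k : Gen} (hi : ¬ negative i) (hk : k ∈ (bracket i (Q 0)).support) :
    k ≠ e := by
  rintro rfl
  apply Finsupp.mem_support_iff.1 hk
  rcases i with m | m | m | m | _ <;>
    (try simp only [negative_L, negative_H, negative_G, negative_Q] at hi) <;>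
    simp [bracket, Finsupp.single_apply] <;> omega

theorem op_Q_zero_Q_zero : op Δ q c (Q 0) (Data.bas [Q 0]) = 0 := by
  have : ¬ (topData Δ q c).Ok (Q 0) [Q 0] := by
    rintro ⟨_, h⟩
    rcases h (Q 0) (by simp) with h | ⟨_, h⟩
    · exact lt_irrefl _ h
    · exact absurd h (by simp [topData, sg_Q]; norm_num)
  rw [op, (topData Δ q c).ρ_self this]

/-- Among brackets with `Q 0`, only that of `G (-1)` contains L_{-1}; but `G (-1)` is low and hence
already in normal position. -/
theorem raise_Q_zero {i : Gen} (hi : i ≠ e) : raise Δ q c i (Data.bas [Q 0]) = 0 := by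
  by_cases hn : negative i
  · by_cases hQ : i = Q 0
    · rw [hQ, raise, LinearMap.comp_apply, op_Q_zero_Q_zero, map_zero]
    · exact raise_low ⟨hn, hi, hQ⟩ (bas_mem_redM red_Q_zero)
  · have h := raiseL_eq_zero Δ q c (x := Data.bas []) (y := bracket i (Q 0)) fun k hk =>
      raise_nil (bracket_Q_zero hn hk)
    have h0 := raise_nil (Δ := Δ) (q := q) (c := c) (i := Q 0) (by simp)
    rw [raise, LinearMap.comp_apply] at h0
    rw [raiseL_eq] at h
    rw [raise, LinearMap.comp_apply, ← op_head Δ q c red_Q_zero.1,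
      op_comm Δ q c (redM_le Δ q c (bas_mem_redM red_nil)), map_add, h, op, op,
      (topData Δ q c).ρ_nil hn, map_smul, map_smul, map_smul]
    rw [h0]
    simp

/-- If a set `X` of basis elements not containing `L (-1)` is stable under brackets with the low
letters of a word, then the elements of `X` do not raise the power of `L (-1)` on that word. -/
theorem raise_eq_zero (X : Gen → Prop) (B : Gen → Prop) (hX : ∀ i, X i → i ≠ e)
    (hXB : ∀ i y, X i → B y → Low y → ∀ k ∈ (bracket i y).support, X k)
    {w : List Gen} (hw : Red w) (hB : ∀ y ∈ w, Low y → B y) :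
    ∀ i, X i → raise Δ q c i (Data.bas w) = 0 := by
  induction w with
  | nil => exact fun i hi => raise_nil (hX i hi)
  | cons y w ih =>
    intro i hi
    rcases hw.cases with h | h | ⟨y', w', h, hy, hw'⟩
    · simp at h
    · rw [h]; exact raise_Q_zero (hX i hi)
    · obtain ⟨rfl, rfl⟩ : y = y' ∧ w = w' := by simpa using h
      have ih' := ih hw' fun z hz => hB z (List.mem_cons_of_mem _ hz)
      rw [← op_head Δ q c hw.1, raise_op_low i hy (bas_mem_redM hw'), ih' i hi, map_zero, smul_zero,
        zero_add]
      exact raiseL_eq_zero Δ q c fun k hk => ih' k (hXB i y hi (hB y (by simp) hy) hy k hk)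

theorem raise_eq_zero_of_mem (X : Gen → Prop) (B : Gen → Prop) (hX : ∀ i, X i → i ≠ e)
    (hXB : ∀ i y, X i → B y → Low y → ∀ k ∈ (bracket i y).support, X k)
    {x : List Gen →₀ ℂ} (hx : x ∈ wordsIn B) {i : Gen} (hi : X i) : raise Δ q c i x = 0 :=
  map_eq_of_support (raise Δ q c i) 0 x fun w hw =>
    raise_eq_zero X B hX hXB (hx hw).1 (hx hw).2 i hi

/-! ### Removing the smallest letter. -/

theorem Red.le_of_mem {y z : Gen} {w : List Gen} (hw : Red (z :: w)) (hy : y ∈ z :: w) : z ≤ y := by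
  rcases List.mem_cons.1 hy with rfl | hy
  · exact le_rfl
  · rcases hw.1.le hy with h | h
    · exact h.le
    · exact h.1.le

/-- A linear map removing the smallest letter `y` from the words, with nonzero multiplicity,
detects the words with that letter. -/
theorem mem_wordsIn_lt {f : (List Gen →₀ ℂ) →ₗ[ℂ] (List Gen →₀ ℂ)} {y : Gen} (hy : Low y) {κ : ℂ}
    (hκ : κ ≠ 0)
    (hf : ∀ w, Red w → (∀ z ∈ w, Low z → y ≤ z) →
      f (Data.bas w) = (κ * w.count y) • Data.bas w.tail)
    {x : List Gen →₀ ℂ} (hx : x ∈ wordsIn (y ≤ ·)) (h : f x = 0) : x ∈ wordsIn (y < ·) := by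
  have head : ∀ w ∈ x.support, y ∈ w → w = y :: w.tail := by
    intro w hw hyw
    obtain ⟨hr, hl⟩ := hx hw
    rcases hr.cases with rfl | rfl | ⟨z, w', rfl, hz, hw'⟩
    · simp at hyw
    · exact absurd (List.mem_singleton.1 hyw) hy.2.2
    · have h1 := hr.le_of_mem hyw
      have h2 := hl z (by simp) hz
      rw [le_antisymm h1 h2]
      rfl
  intro w hw
  obtain ⟨hr, hl⟩ := hx hw
  refine ⟨hr, fun z hz hzl => lt_of_le_of_ne (hl z hz hzl) ?_⟩
  rintro rfl
  have hcount : (w.count y : ℂ) ≠ 0 := by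
    exact_mod_cast (List.count_pos_iff.2 hz).ne'
  have hsum : f x = ∑ v ∈ x.support, x v • ((κ * v.count y) • Data.bas v.tail) := by
    rw [map_eq_sum f]
    exact Finset.sum_congr rfl fun v hv => by
      rw [show single v (1 : ℂ) = Data.bas v from rfl, hf v (hx hv).1 (hx hv).2]
  -- Words containing `y` begin with it, so they are determined by their tails; words without `y`
  -- have multiplicity zero. Only `w` contributes to this coefficient.
  have hval : f x w.tail = x w * (κ * w.count y) := by
    rw [hsum, Finsupp.finsetSum_apply, Finset.sum_eq_single w]
    · simp
    · intro v hv hvw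
      by_cases hyv : y ∈ v
      · have : v.tail ≠ w.tail := fun h' => hvw (by rw [head v hv hyv, head w hw hz, h'])
        simp [this]
      · simp [List.count_eq_zero.2 hyv]
    · exact fun h' => absurd hw h'
  rw [h, Finsupp.coe_zero, Pi.zero_apply] at hval
  exact mul_ne_zero (Finsupp.mem_support_iff.1 hw) (mul_ne_zero hκ hcount) hval.symm

/-- The action of the raising part of a basis element which removes the smallest letter. -/
theorem raise_bas {i y : Gen} (hy : Low y) {κ : ℂ} (hs : sg i y = 1 ∨ sg y y ≠ 1)
    (h0 : ∀ x ∈ wordsIn (y < ·), raise Δ q c i x = 0)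
    (h1 : ∀ x ∈ wordsIn (y ≤ ·), raiseL Δ q c (bracket i y) x = κ • x)
    (w : List Gen) (hw : Red w) (hl : ∀ z ∈ w, Low z → y ≤ z) :
    raise Δ q c i (Data.bas w) = (κ * w.count y) • Data.bas w.tail := by
  have hgt : ∀ w, Red w → (∀ z ∈ w, y < z) →
      raise Δ q c i (Data.bas w) = (κ * w.count y) • Data.bas w.tail := by
    intro w hw hl
    rw [h0 _ (bas_mem_wordsIn hw fun z hz _ => hl z hz),
      List.count_eq_zero.2 fun hz => lt_irrefl _ (hl y hz)]
    simp
  induction w with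
  | nil => exact hgt _ hw (by simp)
  | cons z w ih =>
    rcases hw.cases with h | h | ⟨z', w', h, hz, hw'⟩
    · simp at h
    · rw [h]
      exact hgt _ red_Q_zero (by simpa using hy.lt_Q_zero)
    · obtain ⟨rfl, rfl⟩ : z = z' ∧ w = w' := by simpa using h
      rcases (hl z (by simp) hz).lt_or_eq with hlt | rfl
      · exact hgt _ hw fun v hv => hlt.trans_le (hw.le_of_mem hv)
      · have hlw : ∀ z ∈ w, Low z → y ≤ z := fun v hv => hl v (List.mem_cons_of_mem _ hv)
        rw [← op_head Δ q c hw.1, raise_op_low i hy (bas_mem_redM hw'),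
          h1 _ (bas_mem_wordsIn hw' hlw), ih hw' hlw]
        by_cases hyw : y ∈ w
        -- A repeated `y` must be even. The hypothesis then gives the sign +1, so the contributions
        -- of the copies add up to the multiplicity.
        · rcases hs with hs | hs
          · have : w = y :: w.tail := by
              rcases w with _ | ⟨v, w⟩
              · simp at hyw
              · have e1 := hw'.le_of_mem hyw
                have e2 := hw.le_of_mem (y := v) (by simp)
                rw [le_antisymm e1 e2]
                rfl
            rw [hs, one_smul, map_smul, op_head Δ q c (w := w.tail) (by rw [← this]; exact hw'.1),
              ← this, List.count_cons_self, List.tail_cons]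
            push_cast
            module
          · rcases hw.1.le hyw with h | h
            · exact absurd h (lt_irrefl _)
            · exact absurd h.2 hs
        · simp [List.count_eq_zero.2 hyw]

/-- Words annihilated by the raising part of `i` do not contain the letter `y`. -/
theorem mem_wordsIn_lt_of_raise {i y : Gen} (hy : Low y) {κ : ℂ} (hκ : κ ≠ 0)
    (hs : sg i y = 1 ∨ sg y y ≠ 1) (h0 : ∀ x ∈ wordsIn (y < ·), raise Δ q c i x = 0)
    (h1 : ∀ x ∈ wordsIn (y ≤ ·), raiseL Δ q c (bracket i y) x = κ • x)
    {x : List Gen →₀ ℂ} (hx : x ∈ wordsIn (y ≤ ·)) (h : raise Δ q c i x = 0) :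
    x ∈ wordsIn (y < ·) :=
  mem_wordsIn_lt hy hκ (raise_bas hy hs h0 h1) hx h

end TopN2
end

noncomputable section
namespace TopN2
open Finsupp SuperPBW Gen

/-! ### Elimination of letters -/

/-- The low elements behind `G m`. -/
def afterG (m : ℤ) : Gen → Prop
  | G n => n < m
  | _ => True

/-- The low elements behind `Q m`. -/
def afterQ (m : ℤ) : Gen → Prop
  | G _ => False
  | Q n => n < m
  | _ => True

/-- The low elements behind `L m`. -/
def afterL (m : ℤ) : Gen → Prop
  | L n => n < m
  | H _ => True
  | _ => False

/-- The low elements behind `H m`. -/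
def afterH (m : ℤ) : Gen → Prop
  | H n => n < m
  | _ => False

theorem G_lt_iff {m : ℤ} (hm : m < 0) {z : Gen} (hz : Low z) : G m < z ↔ afterG m z := by
  rcases z with n | n | n | n | _ <;>
    simp only [low_L, low_H, low_G, low_Q, not_low_C] at hz <;>
    simp only [lt_iff, key, afterG, Prod.Lex.toLex_lt_toLex] <;> split_ifs <;> simp <;> omega

theorem Q_lt_iff {m : ℤ} (hm : m < 0) {z : Gen} (hz : Low z) : Q m < z ↔ afterQ m z := by
  rcases z with n | n | n | n | _ <;>
    simp only [low_L, low_H, low_G, low_Q, not_low_C] at hz <;>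
    simp only [lt_iff, key, afterQ, Prod.Lex.toLex_lt_toLex] <;> split_ifs <;> simp <;> omega

theorem L_lt_iff {m : ℤ} (hm : m ≤ -2) {z : Gen} (hz : Low z) : L m < z ↔ afterL m z := by
  rcases z with n | n | n | n | _ <;>
    simp only [low_L, low_H, low_G, low_Q, not_low_C] at hz <;>
    simp only [lt_iff, key, afterL, Prod.Lex.toLex_lt_toLex] <;> split_ifs <;> simp <;> omega

theorem H_lt_iff {m : ℤ} (hm : m < 0) {z : Gen} (hz : Low z) : H m < z ↔ afterH m z := by
  rcases z with n | n | n | n | _ <;>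
    simp only [low_L, low_H, low_G, low_Q, not_low_C] at hz <;>
    simp only [lt_iff, key, afterH, Prod.Lex.toLex_lt_toLex] <;> split_ifs <;> simp <;> omega

theorem wordsIn_mono {J K : Gen → Prop} (h : ∀ y, Low y → J y → K y) : wordsIn J ≤ wordsIn K :=
  fun _ hx _ hw => ⟨(hx hw).1, fun y hy hl => h y hl ((hx hw).2 y hy hl)⟩

variable {Δ q c : ℂ}

/-! ### Basis elements that cannot create L_{-1} from given letters. -/

/-- The set `X` does not contain `L (-1)` and is stable under brackets with the low elements
of `B`. -/
def Stable (X B : Gen → Prop) : Prop :=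
  (∀ i, X i → i ≠ e) ∧ ∀ i y, X i → B y → Low y → ∀ k ∈ (bracket i y).support, X k

theorem Stable.raise_eq_zero {X B : Gen → Prop} (h : Stable X B) {x : List Gen →₀ ℂ}
    (hx : x ∈ wordsIn B) {i : Gen} (hi : X i) : raise Δ q c i x = 0 :=
  raise_eq_zero_of_mem X B h.1 h.2 hx hi

/-- Elements not raising the power of `L (-1)` on words in the letters behind `G m`. -/
def inertG (m : ℤ) : Gen → Prop
  | L n => n ≤ -2
  | H n => n < 0
  | G n => n < 0
  | Q n => n ≤ -m - 1
  | C => False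

/-- Elements not raising the power of `L (-1)` on words in the letters behind `Q m`. -/
def inertQ (m : ℤ) : Gen → Prop
  | L n => n ≤ -2
  | H n => n < 0
  | G n => n ≤ -m - 1
  | Q n => n < 0
  | C => False

/-- Elements not raising the power of `L (-1)` on words in the letters behind `L m`. -/
def inertL (m : ℤ) : Gen → Prop
  | L n => n ≤ -m - 1 ∧ n ≠ -1
  | H _ => True
  | G n => n < 0
  | Q n => n < 0
  | C => True

/-- The basis elements `H n` and `Q n`. -/
def isHQ : Gen → Prop
  | H _ => True
  | Q _ => True
  | _ => False

/-- The basis elements `H n`. -/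
def isH : Gen → Prop
  | H _ => True
  | _ => False

/-- The basis elements `G n`. -/
def isG : Gen → Prop
  | G _ => True
  | _ => False

/-- Elements not raising the power of `L (-1)` on words in the letters `H n` and `Q n`. -/
def inertHQ : Gen → Prop
  | L n => n ≠ -1
  | G _ => False
  | _ => True

/-- Elements not raising the power of `L (-1)` on words in the letters behind `G (-k)`. -/
def inertH (k : ℤ) : Gen → Prop
  | L n => n ≤ -2
  | H n => n ≤ k
  | G n => n < 0
  | Q n => n ≤ k - 1
  | C => True

/-- The bound on `Q` is the sharp one: for a ≤ -m-1 and b < m the sum a + b is at most -2, so {Q_a,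
G_b} just misses L_{-1}. -/
theorem stable_inertG {m : ℤ} (hm : m < 0) : Stable (inertG m) (afterG m) := by
  refine ⟨?_, ?_⟩
  · rintro i hi rfl
    simp [inertG] at hi
  · intro i y hi hy hl k hk
    revert hk
    contrapose!
    intro hk
    rw [Finsupp.notMem_support_iff]
    rcases i with a | a | a | a | _ <;> rcases y with b | b | b | b | _ <;>
      rcases k with p | p | p | p | _ <;>
      (try simp only [low_L, low_H, low_G, low_Q, not_low_C, inertG, afterG] at hi hy hl hk) <;>
      (try simp [bracket, Finsupp.single_apply]) <;> (try have hne : a + b ≠ p := by omega) <;>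
      (try have hne : a + b ≠ 0 := by omega) <;>
      simp [*]

theorem stable_inertQ {m : ℤ} (hm : m < 0) : Stable (inertQ m) (afterQ m) := by
  refine ⟨?_, ?_⟩
  · rintro i hi rfl
    simp [inertQ] at hi
  · intro i y hi hy hl k hk
    revert hk
    contrapose!
    intro hk
    rw [Finsupp.notMem_support_iff]
    rcases i with a | a | a | a | _ <;> rcases y with b | b | b | b | _ <;>
      rcases k with p | p | p | p | _ <;>
      (try simp only [low_L, low_H, low_Q, not_low_C, inertQ, afterQ] at hi hy hl hk) <;>
      (try simp [bracket, Finsupp.single_apply]) <;> (try have hne : a + b ≠ p := by omega) <;>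
      (try have hne : a + b ≠ 0 := by omega) <;>
      simp [*]

/-- Only `L` with `L` can give L_{-1} here, and the bounds force the index of such a bracket to be
at most -2. -/
theorem stable_inertL {m : ℤ} (hm : m ≤ -2) : Stable (inertL m) (afterL m) := by
  refine ⟨?_, ?_⟩
  · rintro i hi rfl
    simp [inertL] at hi
  · intro i y hi hy hl k hk
    revert hk
    contrapose!
    intro hk
    rw [Finsupp.notMem_support_iff]
    rcases i with a | a | a | a | _ <;> rcases y with b | b | b | b | _ <;>
      rcases k with p | p | p | p | _ <;>
      (try simp only [low_L, low_H, inertL, afterL, not_true_eq_false] at hi hy hl hk) <;>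
      (try simp [bracket, Finsupp.single_apply]) <;> (try have hne : a + b ≠ p := by omega) <;>
      (try have hne : a + b ≠ 0 := by omega) <;>
      simp [*]

/-- Without any `G`, brackets with `H` or `Q` never contain an `L`. -/
theorem stable_inertHQ : Stable inertHQ isHQ := by
  refine ⟨?_, ?_⟩
  · rintro i hi rfl
    simp [inertHQ] at hi
  · intro i y hi hy hl k hk
    revert hk
    contrapose!
    intro hk
    rw [Finsupp.notMem_support_iff]
    rcases i with a | a | a | a | _ <;> rcases y with b | b | b | b | _ <;>
      rcases k with p | p | p | p | _ <;>
      (try simp only [low_H, low_Q, inertHQ, isHQ,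
        not_true_eq_false] at hi hy hl hk) <;>
      (try simp [bracket])

theorem stable_isG : Stable isG isH := by
  refine ⟨?_, ?_⟩
  · rintro i hi rfl
    simp [isG] at hi
  · intro i y hi hy hl k hk
    revert hk
    contrapose!
    intro hk
    rw [Finsupp.notMem_support_iff]
    rcases i with a | a | a | a | _ <;> rcases y with b | b | b | b | _ <;>
      rcases k with p | p | p | p | _ <;>
      (try simp only [low_H, isG, isH,
        not_true_eq_false] at hi hy hl hk) <;>
      (try simp [bracket])

/-- Chosen so that `H k` belongs to it. From `H k` the letters `Q b`, `b < 0`, lead to `Q` of index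
at most k-1, and the remaining letters `G b`, `b < -k`, then give only indices at most -2. -/
theorem stable_inertH {k : ℤ} (hk0 : 0 < k) : Stable (inertH k) (afterG (-k)) := by
  refine ⟨?_, ?_⟩
  · rintro i hi rfl
    simp [inertH] at hi
  · intro i y hi hy hl k hk
    revert hk
    contrapose!
    intro hk
    rw [Finsupp.notMem_support_iff]
    rcases i with a | a | a | a | _ <;> rcases y with b | b | b | b | _ <;>
      rcases k with p | p | p | p | _ <;>
      (try simp only [low_L, low_H, low_G, low_Q, not_low_C, inertH, afterG,
        not_true_eq_false] at hi hy hl hk) <;>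
      (try simp [bracket, Finsupp.single_apply]) <;> (try have hne : a + b ≠ p := by omega) <;>
      (try have hne : a + b ≠ 0 := by omega) <;>
      simp [*]

/-! ### Removal of `G`, `Q` and `L` by the leading equations. -/

theorem raiseL_QG {m n : ℤ} (h : m + n = -1) {x : List Gen →₀ ℂ} (hx : x ∈ redM) :
    raiseL Δ q c (bracket (Q m) (G n)) x = (2 : ℂ) • x := by
  simp only [bracket, h, raiseL_add, raiseL_single, LinearMap.add_apply, LinearMap.smul_apply]
  rw [raise_low (low_H.2 (by norm_num)) hx, raise_e hx]
  simp

theorem raiseL_GQ {m n : ℤ} (h : m + n = -1) {x : List Gen →₀ ℂ} (hx : x ∈ redM) :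
    raiseL Δ q c (bracket (G m) (Q n)) x = (2 : ℂ) • x := by
  simp only [bracket, h, raiseL_add, raiseL_single, LinearMap.add_apply, LinearMap.smul_apply]
  rw [raise_low (low_H.2 (by norm_num)) hx, raise_e hx]
  simp

theorem raiseL_LL {m n : ℤ} (h : m + n = -1) {x : List Gen →₀ ℂ} (hx : x ∈ redM) :
    raiseL Δ q c (bracket (L m) (L n)) x = ((m : ℂ) - n) • x := by
  simp only [bracket, h, raiseL_single, LinearMap.smul_apply]
  rw [raise_e hx]

/-- `Q (-m - 1)` is inert on all letters behind `G m`, while its bracket with `G m` is 2 L_{-1} plus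
a low element; its raising part therefore deletes `G m` with factor 2. -/
theorem wordsIn_gt_of_raise_Q {m : ℤ} (hm : m < 0) {x : List Gen →₀ ℂ}
    (hx : x ∈ wordsIn (G m ≤ ·)) (h : raise Δ q c (Q (-m - 1)) x = 0) : x ∈ wordsIn (G m < ·) :=
  mem_wordsIn_lt_of_raise (low_G.2 hm) (two_ne_zero (α := ℂ)) (Or.inr (by norm_num [sg, odd]))
    (fun _ hx => (stable_inertG hm).raise_eq_zero
      (wordsIn_mono (fun _ hy h => (G_lt_iff hm hy).1 h) hx) (i := Q (-m - 1)) le_rfl)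
    (fun _ hx => raiseL_QG (by ring) (wordsIn_le_redM _ hx)) hx h

theorem wordsIn_gt_of_raise_G {m : ℤ} (hm : m < 0) {x : List Gen →₀ ℂ}
    (hx : x ∈ wordsIn (Q m ≤ ·)) (h : raise Δ q c (G (-m - 1)) x = 0) : x ∈ wordsIn (Q m < ·) :=
  mem_wordsIn_lt_of_raise (low_Q.2 hm) (two_ne_zero (α := ℂ)) (Or.inr (by norm_num [sg, odd]))
    (fun _ hx => (stable_inertQ hm).raise_eq_zero
      (wordsIn_mono (fun _ hy h => (Q_lt_iff hm hy).1 h) hx) (i := G (-m - 1)) le_rfl)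
    (fun _ hx => raiseL_GQ (by ring) (wordsIn_le_redM _ hx)) hx h

/-- The same deletion argument, with factor -2m-1 and with multiplicity, since `L m` may be
repeated. -/
theorem wordsIn_gt_of_raise_L {m : ℤ} (hm : m ≤ -2) {x : List Gen →₀ ℂ}
    (hx : x ∈ wordsIn (L m ≤ ·)) (h : raise Δ q c (L (-m - 1)) x = 0) : x ∈ wordsIn (L m < ·) := by
  have hκ : (((-m - 1 : ℤ) : ℂ) - m) ≠ 0 := by
    rw [← Int.cast_sub, Int.cast_ne_zero]
    omega
  exact mem_wordsIn_lt_of_raise (low_L.2 hm) hκ (Or.inl (by simp [sg, odd]))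
    (fun _ hx => (stable_inertL hm).raise_eq_zero
      (wordsIn_mono (fun _ hy h => (L_lt_iff hm hy).1 h) hx) (i := L (-m - 1))
      ⟨le_rfl, by omega⟩)
    (fun _ hx => raiseL_LL (by ring) (wordsIn_le_redM _ hx)) hx h

/-- Successive elimination of the letters `G (-1)`, `G (-2)`, ... -/
theorem wordsIn_of_raise_Q (k : ℕ) {x : List Gen →₀ ℂ} (hx : x ∈ redM)
    (h : ∀ j : ℕ, j < k → raise Δ q c (Q j) x = 0) : x ∈ wordsIn (afterG (-k)) := by
  induction k with
  | zero =>
    intro w hw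
    refine ⟨hx hw, fun y _ hl => ?_⟩
    rcases y with n | n | n | n | _ <;> simp only [afterG]
    simpa using low_G.1 hl
  | succ k ih =>
    have ih := ih fun j hj => h j (hj.trans (Nat.lt_succ_self k))
    have hm : (-((k + 1 : ℕ) : ℤ)) < 0 := by omega
    refine wordsIn_mono (fun y hl hy => (G_lt_iff hm hl).1 hy)
      (wordsIn_gt_of_raise_Q (Δ := Δ) (q := q) (c := c) hm ?_ ?_)
    · refine wordsIn_mono (fun y hl hy => ?_) ih
      rw [← not_lt]
      intro hlt
      rcases y with n | n | n | n | _
      case G =>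
        have h1 := low_G.1 hl
        have h2 : -((k + 1 : ℕ) : ℤ) < n := (G_lt_iff h1 (low_G.2 hm)).1 hlt
        simp only [afterG] at hy
        omega
      all_goals
        have h3 := (G_lt_iff hm hl).2 trivial
        exact absurd hlt h3.not_gt
    · have := h k (Nat.lt_succ_self k)
      rwa [show -(-((k + 1 : ℕ) : ℤ)) - 1 = k by push_cast; ring]

/-- Successive elimination of the letters `Q (-1)`, `Q (-2)`, ... -/
theorem wordsIn_of_raise_G (k : ℕ) {x : List Gen →₀ ℂ} (hx : x ∈ wordsIn (afterQ 0))
    (h : ∀ j : ℕ, j < k → raise Δ q c (G j) x = 0) : x ∈ wordsIn (afterQ (-k)) := by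
  induction k with
  | zero => simpa using hx
  | succ k ih =>
    have ih := ih fun j hj => h j (hj.trans (Nat.lt_succ_self k))
    have hm : (-((k + 1 : ℕ) : ℤ)) < 0 := by omega
    refine wordsIn_mono (fun y hl hy => (Q_lt_iff hm hl).1 hy)
      (wordsIn_gt_of_raise_G (Δ := Δ) (q := q) (c := c) hm ?_ ?_)
    · refine wordsIn_mono (fun y hl hy => ?_) ih
      rw [← not_lt]
      intro hlt
      rcases y with n | n | n | n | _
      case G => exact hy
      case Q =>
        have h1 := low_Q.1 hl
        have h2 : -((k + 1 : ℕ) : ℤ) < n := (Q_lt_iff h1 (low_Q.2 hm)).1 hlt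
        simp only [afterQ] at hy
        omega
      all_goals
        have h3 := (Q_lt_iff hm hl).2 trivial
        exact absurd hlt h3.not_gt
    · have := h k (Nat.lt_succ_self k)
      rwa [show -(-((k + 1 : ℕ) : ℤ)) - 1 = k by push_cast; ring]

/-- Successive elimination of the letters `L (-2)`, `L (-3)`, ... -/
theorem wordsIn_of_raise_L (k : ℕ) {x : List Gen →₀ ℂ} (hx : x ∈ wordsIn (afterL (-1)))
    (h : ∀ j : ℕ, 1 ≤ j → j ≤ k → raise Δ q c (L j) x = 0) :
    x ∈ wordsIn (afterL (-(k + 1))) := by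
  induction k with
  | zero => simpa using hx
  | succ k ih =>
    have ih := ih fun j h1 hj => h j h1 (hj.trans k.le_succ)
    have hm : (-(((k + 1 : ℕ) : ℤ) + 1)) ≤ -2 := by omega
    refine wordsIn_mono (fun y hl hy => (L_lt_iff hm hl).1 hy)
      (wordsIn_gt_of_raise_L (Δ := Δ) (q := q) (c := c) hm ?_ ?_)
    · refine wordsIn_mono (fun y hl hy => ?_) ih
      rw [← not_lt]
      intro hlt
      rcases y with n | n | n | n | _
      case L =>
        have h1 := low_L.1 hl
        have h2 : -(((k + 1 : ℕ) : ℤ) + 1) < n := (L_lt_iff h1 (low_L.2 hm)).1 hlt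
        simp only [afterL] at hy
        omega
      case H =>
        have h3 := (L_lt_iff hm hl).2 trivial
        exact absurd hlt h3.not_gt
      all_goals exact hy
    · have := h (k + 1) (by omega) le_rfl
      rwa [show -(-(((k + 1 : ℕ) : ℤ) + 1)) - 1 = ((k + 1 : ℕ) : ℤ) by push_cast; ring]

/-- A vector all of whose raising parts vanish contains only letters `H n` and `Q 0`. -/
theorem wordsIn_isH {x : List Gen →₀ ℂ} (hx : x ∈ redM)
    (hQ : ∀ j : ℕ, raise Δ q c (Q j) x = 0) (hG : ∀ j : ℕ, raise Δ q c (G j) x = 0)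
    (hL : ∀ j : ℕ, 1 ≤ j → raise Δ q c (L j) x = 0) : x ∈ wordsIn isH := by
  have h1 : x ∈ wordsIn (afterQ 0) := by
    intro w hw
    refine ⟨hx hw, fun y hy hl => ?_⟩
    rcases y with n | n | n | n | _ <;> simp only [afterQ]
    -- A given letter `G n` is excluded after |n| elimination steps.
    · have := (wordsIn_of_raise_Q n.natAbs hx (fun j _ => hQ j) hw).2 _ hy hl
      simp only [afterG] at this
      have := low_G.1 hl
      omega
    · exact low_Q.1 hl
  have h2 : x ∈ wordsIn (afterL (-1)) := by
    intro w hw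
    refine ⟨hx hw, fun y hy hl => ?_⟩
    have h3 := fun k => (wordsIn_of_raise_G k h1 (fun j _ => hG j) hw).2 _ hy hl
    rcases y with n | n | n | n | _ <;> simp only [afterL]
    · have := low_L.1 hl
      omega
    · exact h3 0
    · have := h3 n.natAbs
      simp only [afterQ] at this
      have := low_Q.1 hl
      omega
    · exact not_low_C hl
  intro w hw
  refine ⟨hx hw, fun y hy hl => ?_⟩
  have h3 := fun k => (wordsIn_of_raise_L k h2 (fun j hj _ => hL j hj) hw).2 _ hy hl
  rcases y with n | n | n | n | _ <;> simp only [isH]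
  · have := h3 n.natAbs
    simp only [afterL] at this
    have := low_L.1 hl
    omega
  · exact h3 0
  · exact h3 0
  · exact h3 0

end TopN2
end

noncomputable section
namespace TopN2
open Finsupp SuperPBW Gen

variable {Δ q c : ℂ}

/-! ### Elimination of the letters `H n` -/

theorem op_nil_pos {i : Gen} (hi : ¬ negative i) :
    op Δ q c i (Data.bas []) = character Δ q c i • Data.bas [] := (topData Δ q c).ρ_nil hi

theorem op_Q_zero_pos {i : Gen} (hi : ¬ negative i) :
    op Δ q c i (Data.bas [Q 0]) = (sg i (Q 0) * character Δ q c i) • Data.bas [Q 0] +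
      opL Δ q c (bracket i (Q 0)) (Data.bas []) := by
  have h := op_head Δ q c red_Q_zero.1
  rw [← h, op_comm Δ q c (redM_le Δ q c (bas_mem_redM red_nil)), op_nil_pos hi, map_smul, smul_smul]

theorem op_C {x : List Gen →₀ ℂ} (hx : x ∈ redM) : op Δ q c C x = c • x := by
  refine map_eq_of_support (op Δ q c C) (c • LinearMap.id) x fun w hw => ?_
  have hr : Red w := hx hw
  simp only [LinearMap.smul_apply, LinearMap.id_apply]
  rw [show single w (1 : ℂ) = Data.bas w from rfl]
  clear hw
  have hb : ∀ y, bracket C y = 0 := fun y => by cases y <;> rfl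
  induction w with
  | nil => rw [op_nil_pos not_negative_C]; rfl
  | cons y w ih =>
    rw [← op_head Δ q c hr.1, op_comm Δ q c (redM_le Δ q c (bas_mem_redM hr.tail)), hb,
      show opL Δ q c 0 = 0 from map_zero _, LinearMap.zero_apply, ih hr.tail, map_smul]
    simp [sg, odd]

theorem isHQ_stable (i j : Gen) (hi : isHQ i) (hj : isHQ j) (hli : Low i) (hlj : Low j) :
    ∀ k ∈ (bracket i j).support, isHQ k := by
  intro k hk
  have hlk := bracket_low hli hlj hk
  revert hk
  contrapose!
  intro hk
  rw [Finsupp.notMem_support_iff]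
  rcases i with a | a | a | a | _ <;> rcases j with b | b | b | b | _ <;>
    rcases k with p | p | p | p | _ <;>
    (try simp only [isHQ, not_true_eq_false, not_low_C] at hi hj hk hlk) <;> simp [bracket]

theorem op_isHQ {i : Gen} (hi : Low i) (hJ : isHQ i) {x : List Gen →₀ ℂ} (hx : x ∈ wordsIn isHQ) :
    op Δ q c i x ∈ wordsIn isHQ := op_mem_wordsIn Δ q c isHQ isHQ_stable hi hJ hx

theorem isH_le : wordsIn isH ≤ wordsIn isHQ :=
  wordsIn_mono fun y _ h => by cases y <;> trivial

theorem op_Q_nil (m : ℤ) : op Δ q c (Q m) (Data.bas []) ∈ wordsIn isHQ := by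
  by_cases hn : negative (Q m)
  · rw [op, (topData Δ q c).ρ_ok ((topData Δ q c).ok_nil.2 hn)]
    exact bas_mem_wordsIn ⟨⟨(topData 0 0 0).ok_nil.2 hn, trivial⟩, by simp⟩
      fun y hy _ => by rw [List.mem_singleton.1 hy]; trivial
  · rw [op_nil_pos hn]
    exact Submodule.smul_mem _ _ (bas_mem_wordsIn red_nil (by simp))

theorem op_Q_Q_zero {m : ℤ} (hm : 0 ≤ m) : op Δ q c (Q m) (Data.bas [Q 0]) = 0 := by
  rcases hm.eq_or_lt with rfl | h
  · exact op_Q_zero_Q_zero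
  · rw [op_Q_zero_pos (negative_Q.not.2 h.not_ge)]
    simp [character, bracket]

/-- The elements `Q m` map words in the letters `H n` to words in the letters `H n` and `Q n`. -/
theorem op_Q_mem {x : List Gen →₀ ℂ} (hx : x ∈ wordsIn isH) (m : ℤ) :
    op Δ q c (Q m) x ∈ wordsIn isHQ := by
  refine map_mem_of_support _ _ _ fun w hw => ?_
  obtain ⟨hr, hl⟩ := hx hw
  rw [show single w (1 : ℂ) = Data.bas w from rfl]
  clear hw
  induction w generalizing m with
  | nil => exact op_Q_nil m
  | cons y w ih =>
    rcases hr.cases with h | h | ⟨y', w', h, hy, hw'⟩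
    · simp at h
    · rw [h]
      rcases lt_or_ge m 0 with hm | hm
      · exact op_isHQ (low_Q.2 hm) trivial (bas_mem_wordsIn red_Q_zero
          fun z hz _ => by rw [List.mem_singleton.1 hz]; trivial)
      · rw [op_Q_Q_zero hm]
        exact Submodule.zero_mem _
    · obtain ⟨rfl, rfl⟩ : y = y' ∧ w = w' := by simpa using h
      have ih' := fun m => ih m hw' fun z hz => hl z (List.mem_cons_of_mem _ hz)
      have hyH := hl y (by simp) hy
      rcases y with n | n | n | n | _ <;> simp only [isH] at hyH
      rw [← op_head Δ q c hr.1, op_comm Δ q c (redM_le Δ q c (bas_mem_redM hw'))]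
      refine Submodule.add_mem _ (Submodule.smul_mem _ _ (op_isHQ hy trivial (ih' m))) ?_
      simpa [bracket, Data.ρL_single] using ih' (m + n)

/-- The letters `H` form the last block of low elements, sorted by absolute index. -/
theorem H_of_le {k : ℤ} (hk : 0 < k) {z : Gen} (hz : Low z) (h : H (-k) ≤ z) :
    ∃ n, z = H n ∧ n ≤ -k := by
  rcases h.lt_or_eq with h | rfl
  · rw [H_lt_iff (by omega) hz] at h
    rcases z with n | n | n | n | _ <;> simp only [afterH] at h
    exact ⟨n, rfl, h.le⟩
  · exact ⟨-k, rfl, le_rfl⟩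

/-- A linear map which acts on words in the letters `H n` as a derivation removing `H (-k)`. -/
theorem derivation_bas {f : (List Gen →₀ ℂ) →ₗ[ℂ] (List Gen →₀ ℂ)} {k : ℤ} (hk : 0 < k) {κ : ℂ}
    (h0 : f (Data.bas []) = 0) (hQ : f (Data.bas [Q 0]) = 0)
    (hH : ∀ n w, n ≤ -k → Red (H n :: w) → (∀ z ∈ w, Low z → H (-k) ≤ z) →
      f (Data.bas (H n :: w)) =
        op Δ q c (H n) (f (Data.bas w)) + (if n = -k then κ else 0) • Data.bas w)
    (w : List Gen) (hw : Red w) (hl : ∀ z ∈ w, Low z → H (-k) ≤ z) :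
    f (Data.bas w) = (κ * w.count (H (-k))) • Data.bas w.tail := by
  induction w with
  | nil => simp [h0]
  | cons z w ih =>
    rcases hw.cases with h | h | ⟨z', w', h, hz, hw'⟩
    · simp at h
    · rw [h, hQ]
      simp
    · obtain ⟨rfl, rfl⟩ : z = z' ∧ w = w' := by simpa using h
      have hlw : ∀ z ∈ w, Low z → H (-k) ≤ z := fun v hv => hl v (List.mem_cons_of_mem _ hv)
      obtain ⟨n, rfl, hn⟩ := H_of_le hk hz (hl z (by simp) hz)
      rw [hH n w hn hw hlw, ih hw' hlw]
      by_cases hkw : H (-k) ∈ w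
      · have hwk : w = H (-k) :: w.tail := by
          rcases hw'.cases with rfl | rfl | ⟨v, w'', rfl, hv, _⟩
          · simp at hkw
          · simp at hkw
          · rw [le_antisymm (hw'.le_of_mem hkw) (hlw v (by simp) hv)]
            rfl
        -- The word is sorted and contains H_{-k} further on, so its first letter H_n with n ≤ -k
        -- has to be H_{-k} itself.
        have hnk : n = -k := by
          refine le_antisymm hn ?_
          have h1 := hw.le_of_mem (y := H (-k)) (List.mem_cons_of_mem _ hkw)
          rcases h1.lt_or_eq with h1 | h1
          · have h2 : -k < n := (H_lt_iff (low_H.1 hz) (low_H.2 (by omega))).1 h1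
            exact h2.le
          · exact (Gen.H.inj h1).ge
        subst hnk
        rw [map_smul, op_head Δ q c (w := w.tail) (by rw [← hwk]; exact hw'.1), ← hwk, if_pos rfl,
          List.count_cons_self, List.tail_cons]
        push_cast
        module
      · by_cases hnk : n = -k
        · subst hnk
          simp [List.count_eq_zero.2 hkw]
        · simp [List.count_eq_zero.2 hkw, hnk]

/-- The action of `H k` on words in the letters `H n`, `n ≤ -k`. -/
theorem op_H_bas {k : ℤ} (hk : 0 < k) (w : List Gen) (hw : Red w)
    (hl : ∀ z ∈ w, Low z → H (-k) ≤ z) :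
    op Δ q c (H k) (Data.bas w) = (k * c / 3 * w.count (H (-k))) • Data.bas w.tail := by
  have hn : ¬ negative (H k) := negative_H.not.2 hk.not_gt
  refine derivation_bas (Δ := Δ) (q := q) (c := c) hk ?_ ?_ ?_ w hw hl
  · rw [op_nil_pos hn]
    simp [character, hk.ne']
  · rw [op_Q_zero_pos hn]
    simp [character, hk.ne', bracket, Data.ρL_single,
      op_nil_pos (Δ := Δ) (q := q) (c := c) (negative_Q.not.2 hk.not_ge)]
  · intro n w hn hw _
    have hr := bas_mem_redM hw.tail
    rw [← op_head Δ q c hw.1, op_comm Δ q c (redM_le Δ q c hr)]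
    by_cases hnk : n = -k
    · subst hnk
      have hb : opL Δ q c (bracket (H k) (H (-k))) (Data.bas w) = (k * c / 3) • Data.bas w := by
        simp only [bracket, add_neg_cancel, if_true, opL, Data.ρL_single, LinearMap.smul_apply]
        rw [show (topData Δ q c).ρ C (Data.bas w) = c • Data.bas w from op_C hr, smul_smul,
          div_mul_eq_mul_div]
      rw [hb, if_pos rfl]
      simp [sg, odd]
    · have : ¬ (k + n = 0) := by omega
      simp [sg, odd, bracket, hnk, this]

/-- The raising part of `G (k - j)` after the action of `Q (j - 1)`, on words in the letters
`H n`, `n ≤ -k`. -/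
theorem raise_G_op_Q_bas {k : ℤ} (hk : 0 < k) {j : ℤ} (hj : 0 ≤ j) (hjk : j < k) (w : List Gen)
    (hw : Red w) (hl : ∀ z ∈ w, Low z → H (-k) ≤ z) :
    raise Δ q c (G (k - j - 1)) (op Δ q c (Q j) (Data.bas w)) =
      ((2 : ℂ) * w.count (H (-k))) • Data.bas w.tail := by
  rw [← LinearMap.comp_apply]
  refine derivation_bas (f := raise Δ q c (G (k - j - 1)) ∘ₗ op Δ q c (Q j))
    (Δ := Δ) (q := q) (c := c) hk ?_ ?_ ?_ w hw hl
  · rw [LinearMap.comp_apply]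
    rcases hj.eq_or_lt with rfl | h
    · rw [op_head Δ q c red_Q_zero.1]
      exact raise_Q_zero (by simp)
    · rw [op_nil_pos (negative_Q.not.2 h.not_ge)]
      simp [character]
  · rw [LinearMap.comp_apply, op_Q_Q_zero hj, map_zero]
  · intro n w hn hw hlw
    have hr := bas_mem_redM hw.tail
    have hHn : Low (H n) := low_H.2 (by omega)
    have hH : Data.bas w ∈ wordsIn isH := bas_mem_wordsIn hw.tail fun z hz hzl => by
      obtain ⟨p, rfl, _⟩ := H_of_le hk hzl (hlw z hz hzl)
      trivial
    have hz := wordsIn_le_redM _ (op_Q_mem (Δ := Δ) (q := q) (c := c) hH j)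
    have hlow : Low (Q (j + n)) := low_Q.2 (by omega)
    have e1 : op Δ q c (Q j) (Data.bas (H n :: w)) =
        op Δ q c (H n) (op Δ q c (Q j) (Data.bas w)) + op Δ q c (Q (j + n)) (Data.bas w) := by
      rw [← op_head Δ q c hw.1, op_comm Δ q c (redM_le Δ q c hr)]
      simp [sg, odd, bracket, Data.ρL_single]
    -- Since n ≤ -k, this bracket is a `G` of negative index, which is low.
    have e2 : raiseL Δ q c (bracket (G (k - j - 1)) (H n)) (op Δ q c (Q j) (Data.bas w)) = 0 := by
      simp only [bracket, raiseL_single, LinearMap.smul_apply]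
      rw [raise_low (low_G.2 (by omega)) hz, smul_zero]
    have e3 : raise Δ q c (G (k - j - 1)) (Data.bas w) = 0 :=
      stable_isG.raise_eq_zero hH (i := G _) trivial
    -- The total index k - 1 + n equals -1 exactly for n = -k and is smaller otherwise.
    have e4 : raiseL Δ q c (bracket (G (k - j - 1)) (Q (j + n))) (Data.bas w) =
        (if n = -k then (2 : ℂ) else 0) • Data.bas w := by
      by_cases hnk : n = -k
      · rw [if_pos hnk, raiseL_GQ (by omega) hr]
      · have h1 : ¬ (k - j - 1 + (j + n) = 0) := by omega
        rw [if_neg hnk, zero_smul]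
        simp only [bracket, raiseL_add, raiseL_single, LinearMap.add_apply, LinearMap.smul_apply,
          if_neg h1, zero_smul]
        rw [raise_low (low_L.2 (by omega)) hr, raise_low (low_H.2 (by omega)) hr]
        simp
    rw [LinearMap.comp_apply, LinearMap.comp_apply, e1, map_add, raise_op_low _ hHn hz, e2,
      raise_op_low _ hlow hr, e3, e4]
    simp [sg, odd]

/-- A vector in the letters `H n`, `n ≤ -k`, satisfying the equations of second order contains
only letters `H n`, `n < -k`. -/
theorem wordsIn_lt_of_second_order (hc : c ≠ 3) {k : ℕ} (hk : 0 < k) {x r : List Gen →₀ ℂ}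
    (hx : x ∈ wordsIn (H (-(k : ℤ)) ≤ ·)) (hr : r ∈ redM) {a : ℂ}
    (h : ∀ i, ((∃ j : ℕ, i = Q j) ∨ i = H k) →
      keep Δ q c i x + a • raiseL Δ q c (bracket i e) x + raise Δ q c i r = 0) :
    x ∈ wordsIn (H (-(k : ℤ)) < ·) := by
  have hk' : (0 : ℤ) < k := by omega
  have hxH : x ∈ wordsIn isH := wordsIn_mono (fun z hz h => by
    obtain ⟨n, rfl, _⟩ := H_of_le hk' hz h
    trivial) hx
  have hxr := wordsIn_le_redM _ hxH
  have hQx : ∀ j : ℤ, op Δ q c (Q j) x ∈ wordsIn isHQ := op_Q_mem hxH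
  have hQr : ∀ j : ℤ, op Δ q c (Q j) x ∈ redM := fun j => wordsIn_le_redM _ (hQx j)
  -- the equations for `Q j` and `H k`
  have hQ : ∀ j : ℕ, raise Δ q c (Q j) r = -op Δ q c (Q j) x := by
    intro j
    have h1 := h (Q j) (Or.inl ⟨j, rfl⟩)
    -- The bracket with L_{-1} is a multiple of another `Q`, inert on words in `H` and `Q 0`; thus
    -- `a` drops out of the equation.
    have h2 : raiseL Δ q c (bracket (Q j) e) x = 0 := by
      simp only [bracket, raiseL_single, LinearMap.smul_apply]
      rw [stable_inertHQ.raise_eq_zero (isH_le hxH) (i := Q _) trivial, smul_zero]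
    rw [keep_eq (hQr j), h2, smul_zero, add_zero] at h1
    exact eq_neg_of_add_eq_zero_right h1
  have hHk : op Δ q c (H k) x + raise Δ q c (H k) r = 0 := by
    have h1 := h (H k) (Or.inr rfl)
    have h2 : raiseL Δ q c (bracket (H k) e) x = 0 := by
      have : raiseL Δ q c (bracket (H k) (L (-1))) x = 0 := by
        refine raiseL_eq_zero Δ q c fun i hi => ?_
        refine stable_inertHQ.raise_eq_zero (isH_le hxH) (i := i) ?_
        rcases i with n | n | n | n | _ <;> try trivial
        all_goals simp [bracket] at hi
      exact this
    have h3 : op Δ q c (H k) x ∈ redM := map_mem_of_support _ _ _ fun w hw => by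
      have := hx hw
      rw [show single w (1 : ℂ) = Data.bas w from rfl, op_H_bas hk' w this.1 this.2]
      refine Submodule.smul_mem _ _ (bas_mem_redM ?_)
      rcases w with _ | ⟨y, w⟩
      · exact red_nil
      · exact this.1.tail
    rwa [keep_eq h3, h2, smul_zero, add_zero] at h1
  -- the correction
  set r₀ : List Gen →₀ ℂ := -(1 / 2 : ℂ) •
    ∑ j ∈ Finset.range k, op Δ q c (G (-(j : ℤ) - 1)) (op Δ q c (Q j) x) with hr₀
  have lowG : ∀ j : ℕ, Low (G (-(j : ℤ) - 1)) := fun j => low_G.2 (by omega)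
  have hr₀r : r₀ ∈ redM := Submodule.smul_mem _ _
    (Submodule.sum_mem _ fun j _ => op_low_mem Δ q c (lowG j) (hQr j))
  -- The raising part of `Q i` detects only the summand j = i of `r₀`, through {Q_i, G_{-i-1}} = 2
  -- L_{-1} + ...; the factor -1/2 is fitted to this. Thus `r₀` is a particular solution of the
  -- first `k` equations.
  have hQ₀ : ∀ i : ℕ, i < k → raise Δ q c (Q i) r₀ = -op Δ q c (Q i) x := by
    intro i hi
    rw [hr₀, map_smul, map_sum, Finset.sum_eq_single i]
    · rw [raise_op_low _ (lowG i) (hQr i),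
        stable_inertHQ.raise_eq_zero (hQx i) (i := Q i) trivial, raiseL_QG (by ring) (hQr i)]
      simp only [map_zero, smul_zero, zero_add]
      module
    · intro j _ hji
      rw [raise_op_low _ (lowG j) (hQr j),
        stable_inertHQ.raise_eq_zero (hQx j) (i := Q i) trivial, map_zero, smul_zero, zero_add]
      refine raiseL_eq_zero Δ q c fun z hz => stable_inertHQ.raise_eq_zero (hQx j) (i := z) ?_
      rcases z with n | n | n | n | _ <;> try trivial
      · simp only [inertHQ]
        rintro rfl
        have h1 : ¬ ((i : ℤ) + (-(j : ℤ) - 1) = -1) := by omega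
        simp [bracket, h1] at hz
      · simp [bracket] at hz
    · intro h'
      exact absurd (Finset.mem_range.2 hi) h'
  have hdiff : r - r₀ ∈ wordsIn (afterG (-(k : ℤ))) :=
    wordsIn_of_raise_Q (Δ := Δ) (q := q) (c := c) k (Submodule.sub_mem _ hr hr₀r) fun j hj => by
      rw [map_sub, hQ j, hQ₀ j hj, sub_self]
  -- The difference solves the homogeneous equations, hence has no letters G_{-1}, ..., G_{-k}, and
  -- `H k` is inert on it. The unknown `r` may therefore be replaced by `r₀`.
  have hHdiff : raise Δ q c (H k) r = raise Δ q c (H k) r₀ := by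
    have := (stable_inertH hk').raise_eq_zero (Δ := Δ) (q := q) (c := c) hdiff (i := H k) le_rfl
    rwa [map_sub, sub_eq_zero] at this
  have hH₀ : raise Δ q c (H k) r₀ = -(1 / 2 : ℂ) •
      ∑ j ∈ Finset.range k, raise Δ q c (G ((k : ℤ) - j - 1)) (op Δ q c (Q j) x) := by
    rw [hr₀, map_smul, map_sum]
    refine congrArg (-(1 / 2 : ℂ) • ·) (Finset.sum_congr rfl fun j _ => ?_)
    rw [raise_op_low _ (lowG j) (hQr j),
      stable_inertHQ.raise_eq_zero (hQx j) (i := H k) trivial]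
    simp [bracket, raiseL_single, show (k : ℤ) + (-(j : ℤ) - 1) = k - j - 1 by ring]
  -- the resulting derivation
  have hκ : (k * c / 3 - k : ℂ) ≠ 0 := by
    have h1 : (k : ℂ) ≠ 0 := by exact_mod_cast hk.ne'
    have h2 : (k * c / 3 - k : ℂ) = k * (c - 3) / 3 := by ring
    rw [h2]
    exact div_ne_zero (mul_ne_zero h1 (sub_ne_zero.2 hc)) (by norm_num)
  refine mem_wordsIn_lt (f := op Δ q c (H k) - (1 / 2 : ℂ) •
    ∑ j ∈ Finset.range k, raise Δ q c (G ((k : ℤ) - j - 1)) ∘ₗ op Δ q c (Q j))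
    (low_H.2 (by omega)) hκ ?_ hx ?_
  · intro w hw hl
    simp only [LinearMap.sub_apply, LinearMap.smul_apply, LinearMap.sum_apply,
      LinearMap.comp_apply]
    rw [op_H_bas hk' w hw hl, Finset.sum_congr rfl fun j hj => raise_G_op_Q_bas hk'
      (by omega) (by have := Finset.mem_range.1 hj; omega) w hw hl, Finset.sum_const,
      Finset.card_range]
    push_cast
    module
  · simp only [LinearMap.sub_apply, LinearMap.smul_apply, LinearMap.sum_apply,
      LinearMap.comp_apply]
    rw [hHdiff, hH₀] at hHk
    rw [← hHk]
    module

/-- Successive elimination of the letters `H (-1)`, `H (-2)`, ... -/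
theorem wordsIn_of_second_order (hc : c ≠ 3) {x r : List Gen →₀ ℂ}
    (hx : x ∈ wordsIn isH) (hr : r ∈ redM) {a : ℂ}
    (h : ∀ i, ((∃ j : ℕ, i = Q j) ∨ ∃ k : ℕ, 0 < k ∧ i = H k) →
      keep Δ q c i x + a • raiseL Δ q c (bracket i e) x + raise Δ q c i r = 0) :
    ∀ w ∈ x.support, w = [] ∨ w = [Q 0] := by
  have step : ∀ k : ℕ, x ∈ wordsIn (afterH (-(k : ℤ))) := by
    intro k
    induction k with
    | zero =>
      refine wordsIn_mono (fun y hl hy => ?_) hx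
      rcases y with n | n | n | n | _ <;> simp only [isH] at hy
      simpa [afterH] using low_H.1 hl
    | succ k ih =>
      have hm : (-((k + 1 : ℕ) : ℤ)) < 0 := by omega
      refine wordsIn_mono (fun y hl hy => (H_lt_iff hm hl).1 hy)
        (wordsIn_lt_of_second_order (Δ := Δ) (q := q) (c := c) (a := a) hc k.succ_pos ?_ hr
          fun i hi => h i (hi.imp id fun hi => ⟨k + 1, k.succ_pos, hi⟩))
      refine wordsIn_mono (fun y hl hy => ?_) ih
      rw [← not_lt]
      intro hlt
      rcases y with n | n | n | n | _ <;> simp only [afterH] at hy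
      have h1 := low_H.1 hl
      have h2 : -((k + 1 : ℕ) : ℤ) < n := (H_lt_iff h1 (low_H.2 hm)).1 hlt
      omega
  intro w hw
  rcases (hx hw).1.cases with h | h | ⟨y, w', rfl, hy, _⟩
  · exact Or.inl h
  · exact Or.inr h
  · exfalso
    have h1 := fun k => (step k hw).2 y (by simp) hy
    rcases y with n | n | n | n | _
    case H =>
      have h2 := h1 n.natAbs
      simp only [afterH] at h2
      have := low_H.1 hy
      omega
    all_goals exact h1 0

end TopN2
end

noncomputable section
namespace TopN2
open Finsupp SuperPBW Gen

/-! ### Chiral singular vectors -/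

/-- A vector of level `m` and charge `n` annihilated by all generators of positive index and by
both odd zero modes. -/
structure IsChiral {N : Label} {Δ q c : ℂ} (m : ℕ) (n : ℤ) (x : Verma N Δ q c) : Prop where
  level : u (L 0) • x = (Δ + m) • x
  charge : u (H 0) • x = (q + n) • x
  annL : ∀ k : ℤ, 0 < k → u (L k) • x = 0
  annH : ∀ k : ℤ, 0 < k → u (H k) • x = 0
  annG : ∀ k : ℤ, 0 ≤ k → u (G k) • x = 0
  annQ : ∀ k : ℤ, 0 ≤ k → u (Q k) • x = 0

variable {Δ q c : ℂ}

/-- The level of a basis element. -/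
def levelOf : Gen → ℂ
  | L n => -n
  | H n => -n
  | G n => -n
  | Q n => -n
  | C => 0

/-- The charge of a basis element. -/
def chargeOf : Gen → ℂ
  | G _ => 1
  | Q _ => -1
  | _ => 0

theorem bracket_L_zero (x : Gen) : bracket (L 0) x = single x (levelOf x) := by
  cases x <;> simp [bracket, levelOf]

theorem bracket_H_zero (x : Gen) : bracket (H 0) x = single x (chargeOf x) := by
  cases x <;> simp [bracket, chargeOf]
  rintro rfl
  simp

/-- The even zero modes act diagonally on the ordered words. -/
theorem op_diagonal {i : Gen} (hi : ¬ negative i) (hs : ∀ x, sg i x = 1) {d : Gen → ℂ}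
    (hd : ∀ x, bracket i x = single x (d x)) {w : List Gen} (hw : Std w) :
    op Δ q c i (Data.bas w) = (character Δ q c i + (w.map d).sum) • Data.bas w := by
  induction w with
  | nil => rw [op_nil_pos hi]; simp
  | cons x w ih =>
    have hx := op_head Δ q c hw
    rw [← hx, op_comm Δ q c ((topData Δ q c).bas_mem ((std_iff Δ q c w).2 hw.2)), ih hw.2, hs, hd,
      opL, Data.ρL_single, LinearMap.smul_apply, map_smul, hx, List.map_cons, List.sum_cons]
    module

theorem diagonal_eigenvalue {i : Gen} (hi : ¬ negative i) (hs : ∀ x, sg i x = 1) {d : Gen → ℂ}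
    (hd : ∀ x, bracket i x = single x (d x)) {x : List Gen →₀ ℂ}
    (hx : x ∈ (topData Δ q c).stdM) {a : ℂ} (h : op Δ q c i x = a • x) {w : List Gen}
    (hw : w ∈ x.support) : character Δ q c i + (w.map d).sum = a := by
  have h1 : op Δ q c i x w = x w * (character Δ q c i + (w.map d).sum) := by
    rw [map_eq_sum (op Δ q c i), Finsupp.finsetSum_apply, Finset.sum_eq_single w]
    · rw [show single w (1 : ℂ) = Data.bas w from rfl,
        op_diagonal hi hs hd ((std_iff Δ q c w).1 (hx hw))]
      simp [mul_add]
    · intro v hv hvw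
      rw [show single v (1 : ℂ) = Data.bas v from rfl,
        op_diagonal hi hs hd ((std_iff Δ q c v).1 (hx hv))]
      simp [hvw]
    · exact fun h' => absurd hw h'
  rw [h, Finsupp.smul_apply, smul_eq_mul, mul_comm] at h1
  exact (mul_left_cancel₀ (Finsupp.mem_support_iff.1 hw) h1).symm

/-- An ordered word is recovered from its number of letters L_{-1} and the rest, so no two words
contribute to the same coefficient. -/
theorem cf_apply {x : List Gen →₀ ℂ} (hx : x ∈ (topData Δ q c).stdM) {w : List Gen}
    (hw : w ∈ x.support) : cf (w.count e) x (w.filter (· ≠ e)) = x w := by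
  rw [map_eq_sum (cf _), Finsupp.finsetSum_apply, Finset.sum_eq_single w]
  · rw [show single w (1 : ℂ) = Data.bas w from rfl, cf_bas, if_pos rfl]
    simp
  · intro v hv hvw
    rw [show single v (1 : ℂ) = Data.bas v from rfl, cf_bas]
    split_ifs with hc
    · have : v.filter (· ≠ e) ≠ w.filter (· ≠ e) := fun hf => hvw (by
        rw [((std_iff Δ q c v).1 (hx hv)).eq_append.1, ((std_iff Δ q c w).1 (hx hw)).eq_append.1,
          hc, hf])
      rw [Finsupp.smul_apply, Data.bas, Finsupp.single_apply, if_neg this, smul_zero]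
    · simp
  · exact fun h' => absurd hw h'

/-- The word whose coefficient determines a chiral vector of level `m` and charge `n`. -/
def topWord (m : ℕ) (n : ℤ) : List Gen :=
  List.replicate m e ++ if n = 0 then [] else [Q 0]

/-- A nonzero chiral vector has charge `0` or `-1`, and a nonzero coefficient at the word
`topWord`. -/
theorem IsChiral.topWord_mem (hc : c ≠ 3) {m : ℕ} {n : ℤ} {x : Verma .G Δ q c}
    (hx : IsChiral m n x) (h0 : x ≠ 0) :
    (n = 0 ∨ n = -1) ∧ coords Δ q c x (topWord m n) ≠ 0 := by
  set y := coords Δ q c x with hy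
  have hys : y ∈ (topData Δ q c).stdM := coords_mem Δ q c x
  have hy0 : y ≠ 0 := fun h => h0 (coords_injective Δ q c (by rw [← hy, h, map_zero]))
  have ann : ∀ i, u i • x = 0 → op Δ q c i y = 0 := fun i hi => by
    rw [hy, op, ← coords_smul, hi, map_zero]
  -- The word `w` realises the highest power of L_{-1}; `cf a y` and `cfPred a y` are then the
  -- leading and subleading coefficients p and r.
  obtain ⟨w, hw, hmax⟩ := Finset.exists_max_image y.support (fun w => w.count e)
    (Finsupp.support_nonempty_iff.2 hy0)
  set a := w.count e with ha
  have hp := cf_mem a hys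
  have hr := cfPred_mem a hys
  have raise_zero : ∀ i, u i • x = 0 → raise Δ q c i (cf a y) = 0 := fun i hi => by
    rw [← cf_succ_op hys hmax, ann i hi, map_zero]
  have hH : cf a y ∈ wordsIn isH := wordsIn_isH hp
    (fun j => raise_zero _ (hx.annQ j (by positivity)))
    (fun j => raise_zero _ (hx.annG j (by positivity)))
    (fun j hj => raise_zero _ (hx.annL j (by exact_mod_cast hj)))
  have hfin := wordsIn_of_second_order hc hH hr (a := (a : ℂ)) (fun i hi => by
    rw [← cf_op_eq hys hmax, ann i, map_zero]
    rcases hi with ⟨j, rfl⟩ | ⟨k, hk, rfl⟩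
    · exact hx.annQ j (by positivity)
    · exact hx.annH k (by exact_mod_cast hk))
  have hwf := hfin (w.filter (· ≠ e)) (by
    rw [Finsupp.mem_support_iff, ha, cf_apply hys hw]
    exact Finsupp.mem_support_iff.1 hw)
  -- Now `w` is L_{-1}^a or L_{-1}^a Q_0; the eigenvalue of L_0 gives a = m, and that of H_0 gives
  -- the charge 0 or -1.
  have hL := diagonal_eigenvalue (negative_L.not.2 (lt_irrefl 0)) (fun x => by simp [sg, odd])
    bracket_L_zero hys (a := Δ + m) (by rw [hy, op, ← coords_smul, hx.level, map_smul]) hw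
  have hQ := diagonal_eigenvalue (negative_H.not.2 (lt_irrefl 0)) (fun x => by simp [sg, odd])
    bracket_H_zero hys (a := q + n) (by rw [hy, op, ← coords_smul, hx.charge, map_smul]) hw
  have hwr := ((std_iff Δ q c w).1 (hys hw)).eq_append.1
  rw [← ha] at hwr
  have hval := Finsupp.mem_support_iff.1 hw
  rcases hwf with hf | hf
  · rw [hf] at hwr
    rw [hwr] at hL hQ hval
    simp [character, levelOf, chargeOf] at hL hQ
    obtain rfl : a = m := by exact_mod_cast hL
    obtain rfl : n = 0 := by exact_mod_cast hQ
    exact ⟨Or.inl rfl, by simpa [topWord] using hval⟩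
  · rw [hf] at hwr
    rw [hwr] at hL hQ hval
    simp [character, levelOf, chargeOf] at hL hQ
    obtain rfl : a = m := by exact_mod_cast hL
    obtain rfl : n = -1 := by exact_mod_cast hQ.symm
    exact ⟨Or.inr rfl, by simpa [topWord] using hval⟩

/-! ### The mirror automorphism -/

/-- The images of the basis elements under the mirror automorphism. -/
def mirrorGen : Gen → U
  | L n => u (L n) - (n : ℂ) • u (H n)
  | H n => -u (H n) - (if n = 0 then (1 / 3 : ℂ) else 0) • u C
  | G n => u (Q n)
  | Q n => u (G n)
  | C => u C

theorem sComm_u {i j : Gen} (h : sg i j = 1) :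
    sComm (u i) (u j) = linearCombination ℂ u (bracket i j) := by
  rw [sComm, u_mul_u i j, h]; simp

theorem aComm_u {i j : Gen} (h : sg i j = -1) :
    aComm (u i) (u j) = linearCombination ℂ u (bracket i j) := by
  rw [aComm, u_mul_u i j, h]; simp

section sComm
variable {A : Type*} [Ring A] (a b d : A)

theorem sComm_sub_left : sComm (a - b) d = sComm a d - sComm b d := by simp only [sComm]; noncomm_ring
theorem sComm_sub_right : sComm a (b - d) = sComm a b - sComm a d := by simp only [sComm]; noncomm_ring
theorem sComm_neg_left : sComm (-a) d = -sComm a d := by simp only [sComm]; noncomm_ring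
theorem sComm_neg_right : sComm a (-d) = -sComm a d := by simp only [sComm]; noncomm_ring

variable [Algebra ℂ A] (z : ℂ)

theorem sComm_smul_left : sComm (z • a) d = z • sComm a d := by simp [sComm, smul_sub]
theorem sComm_smul_right : sComm a (z • d) = z • sComm a d := by simp [sComm, smul_sub]

end sComm

theorem sComm_u_C (i : Gen) : sComm (u i) (u C) = 0 := by
  rw [sComm_u (by simp [sg, odd])]
  cases i <;> simp [bracket]

theorem sComm_C_u (i : Gen) : sComm (u C) (u i) = 0 := by
  rw [sComm_u (by simp [sg, odd])]
  cases i <;> simp [bracket]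

/-- The shift of H_0 by C/3 balances the central terms. In {G_m, Q_{-m}}, for example, it turns (m²
+ m)/3 into (m² - m)/3, the value for {Q_m, G_{-m}}. -/
theorem mirror_rel ⦃a b : FreeAlgebra ℂ Gen⦄ (h : TopRel a b) :
    FreeAlgebra.lift ℂ mirrorGen a = FreeAlgebra.lift ℂ mirrorGen b := by
  have hs : ∀ x y : FreeAlgebra ℂ Gen, FreeAlgebra.lift ℂ mirrorGen (sComm x y) =
      sComm (FreeAlgebra.lift ℂ mirrorGen x) (FreeAlgebra.lift ℂ mirrorGen y) := by
    intro x y; simp [sComm]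
  have ha : ∀ x y : FreeAlgebra ℂ Gen, FreeAlgebra.lift ℂ mirrorGen (aComm x y) =
      aComm (FreeAlgebra.lift ℂ mirrorGen x) (FreeAlgebra.lift ℂ mirrorGen y) := by
    intro x y; simp [aComm]
  have sLL : ∀ m n, sComm (u (L m)) (u (L n)) = _ := fun m n => sComm_u (by simp [sg, odd])
  have sLH : ∀ m n, sComm (u (L m)) (u (H n)) = _ := fun m n => sComm_u (by simp [sg, odd])
  have sHL : ∀ m n, sComm (u (H m)) (u (L n)) = _ := fun m n => sComm_u (by simp [sg, odd])
  have sHH : ∀ m n, sComm (u (H m)) (u (H n)) = _ := fun m n => sComm_u (by simp [sg, odd])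
  have sLG : ∀ m n, sComm (u (L m)) (u (G n)) = _ := fun m n => sComm_u (by simp [sg, odd])
  have sLQ : ∀ m n, sComm (u (L m)) (u (Q n)) = _ := fun m n => sComm_u (by simp [sg, odd])
  have sHG : ∀ m n, sComm (u (H m)) (u (G n)) = _ := fun m n => sComm_u (by simp [sg, odd])
  have sHQ : ∀ m n, sComm (u (H m)) (u (Q n)) = _ := fun m n => sComm_u (by simp [sg, odd])
  have sQG : ∀ m n, aComm (u (Q m)) (u (G n)) = _ := fun m n => aComm_u (by simp [sg, odd])
  have sGG : ∀ m n, aComm (u (G m)) (u (G n)) = _ := fun m n => aComm_u (by simp [sg, odd])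
  have sQQ : ∀ m n, aComm (u (Q m)) (u (Q n)) = _ := fun m n => aComm_u (by simp [sg, odd])
  induction h
  case GG m n => simp [ha, mirrorGen, sQQ, bracket]
  case QQ m n => simp [ha, mirrorGen, sGG, bracket]
  case central x =>
    cases x <;> simp [hs, mirrorGen, sComm_C_u, sComm_sub_right, sComm_neg_right, sComm_smul_right]
    split_ifs <;> simp [sComm]
  all_goals
    rename_i m n
    by_cases h : m + n = 0
    · obtain rfl : n = -m := by omega
      simp only [hs, ha, FreeAlgebra.lift_ι_apply, mirrorGen, sComm_sub_left, sComm_sub_right,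
        sComm_neg_left, sComm_neg_right, sComm_smul_left, sComm_smul_right, sComm_u_C, sComm_C_u,
        sLL, sLH, sHL, sHH, sLG, sLQ, sHG, sHQ, sQG, bracket, map_add, map_sub, map_smul, map_neg,
        linearCombination_single, add_neg_cancel, if_true, Int.cast_zero]
      push_cast
      try module
    · simp only [hs, ha, FreeAlgebra.lift_ι_apply, mirrorGen, sComm_sub_left, sComm_sub_right,
        sComm_neg_left, sComm_neg_right, sComm_smul_left, sComm_smul_right, sComm_u_C, sComm_C_u,
        sLL, sLH, sHL, sHH, sLG, sLQ, sHG, sHQ, sQG, bracket, map_add, map_sub, map_smul, map_neg,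
        linearCombination_single, if_neg h]
      push_cast
      try module

/-- The mirror automorphism of the enveloping algebra. -/
def mirror : U →ₐ[ℂ] U :=
  RingQuot.liftAlgHom ℂ ⟨FreeAlgebra.lift ℂ mirrorGen, mirror_rel⟩

theorem mirror_u (i : Gen) : mirror (u i) = mirrorGen i := by
  simp only [mirror, u, toU]
  erw [RingQuot.liftAlgHom_mkAlgHom_apply]
  simp

theorem mirror_mirror (a : U) : mirror (mirror a) = a := by
  obtain ⟨a, rfl⟩ := toU_surjective a
  induction a using FreeAlgebra.induction with
  | grade0 z => simp
  | grade1 i =>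
    rw [show toU (FreeAlgebra.ι ℂ i) = u i from rfl, mirror_u]
    rcases i with n | n | n | n | _ <;> simp only [mirrorGen, map_sub, map_neg, map_smul, mirror_u]
    · by_cases h : n = 0
      · subst h; simp
      · simp [h]
    · module
  | mul a b ha hb => rw [map_mul, map_mul, map_mul, ha, hb]
  | add a b ha hb => rw [map_add, map_add, map_add, ha, hb]

theorem mirror_ideal (N : Label) (Δ q c : ℂ) {a : U} (h : a ∈ vermaIdeal N Δ q c) :
    mirror a ∈ vermaIdeal N.other Δ (-q - c / 3) c := by
  have pos : ∀ k : ℤ, 0 < k → ∀ y, (y = u (L k) ∨ y = u (H k) ∨ y = u (G k) ∨ y = u (Q k)) →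
      y ∈ vermaIdeal N.other Δ (-q - c / 3) c := fun k hk y hy =>
    Submodule.subset_span (Or.inr ⟨k, hk, hy⟩)
  have smul : ∀ (z : ℂ) (y : U), y ∈ vermaIdeal N.other Δ (-q - c / 3) c →
      z • y ∈ vermaIdeal N.other Δ (-q - c / 3) c := fun z y hy => by
    rw [← smul_one_mul z y]
    exact Submodule.smul_mem _ _ hy
  have hC : u C - algebraMap ℂ U c ∈ vermaIdeal N.other Δ (-q - c / 3) c :=
    Submodule.subset_span (by simp)
  have hH : u (H 0) - algebraMap ℂ U (-q - c / 3) ∈ vermaIdeal N.other Δ (-q - c / 3) c :=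
    Submodule.subset_span (by simp)
  induction h using Submodule.span_induction with
  | zero => simp
  | add a b _ _ ha hb => rw [map_add]; exact Submodule.add_mem _ ha hb
  | smul a b _ hb =>
    rw [smul_eq_mul, map_mul]
    exact Submodule.smul_mem _ _ hb
  | mem x hx =>
    rcases hx with hx | ⟨k, hk, hx⟩
    · rcases hx with rfl | rfl | rfl | rfl
      · have : mirror (u (L 0) - algebraMap ℂ U Δ) = u (L 0) - algebraMap ℂ U Δ := by
          rw [map_sub, mirror_u, AlgHom.commutes]
          simp [mirrorGen]
        rw [this]
        exact Submodule.subset_span (by simp)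
      · have : mirror (u (H 0) - algebraMap ℂ U q) =
            -(u (H 0) - algebraMap ℂ U (-q - c / 3)) - (1 / 3 : ℂ) • (u C - algebraMap ℂ U c) := by
          rw [map_sub, mirror_u, AlgHom.commutes]
          simp only [mirrorGen, if_true, Algebra.algebraMap_eq_smul_one]
          module
        rw [this]
        exact Submodule.sub_mem _ (Submodule.neg_mem _ hH) (smul _ _ hC)
      · have : mirror (u C - algebraMap ℂ U c) = u C - algebraMap ℂ U c := by
          rw [map_sub, mirror_u, AlgHom.commutes]
          rfl
        rw [this]
        exact hC
      · have : mirror (u N.zeroMode) = u N.other.zeroMode := by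
          rw [mirror_u]; cases N <;> rfl
        rw [this]
        exact Submodule.subset_span (by simp)
    · rcases hx with rfl | rfl | rfl | rfl
      · rw [mirror_u]
        exact Submodule.sub_mem _ (pos k hk _ (by simp)) (smul _ _ (pos k hk _ (by simp)))
      · rw [mirror_u, mirrorGen, if_neg hk.ne', zero_smul, sub_zero]
        exact Submodule.neg_mem _ (pos k hk _ (by simp))
      · rw [mirror_u]
        exact pos k hk _ (by simp [mirrorGen])
      · rw [mirror_u]
        exact pos k hk _ (by simp [mirrorGen])

/-- The mirror map between Verma modules. -/
def mirrorMap (N : Label) (Δ q c : ℂ) : Verma N Δ q c →ₗ[ℂ] Verma N.other Δ (-q - c / 3) c :=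
  ((vermaIdeal N Δ q c).restrictScalars ℂ).liftQ
    ((vermaIdeal N.other Δ (-q - c / 3) c).mkQ.restrictScalars ℂ ∘ₗ mirror.toLinearMap)
    (fun _ hx => LinearMap.mem_ker.2
      ((Submodule.Quotient.mk_eq_zero _).2 (mirror_ideal N Δ q c hx))) ∘ₗ
  (Submodule.Quotient.restrictScalarsEquiv ℂ (vermaIdeal N Δ q c)).symm.toLinearMap

theorem mirrorMap_mk (N : Label) (Δ q c : ℂ) (a : U) :
    mirrorMap N Δ q c (Submodule.Quotient.mk a) = Submodule.Quotient.mk (mirror a) := rfl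

theorem mirrorMap_smul (N : Label) (Δ q c : ℂ) (a : U) (x : Verma N Δ q c) :
    mirrorMap N Δ q c (mirror a • x) = a • mirrorMap N Δ q c x := by
  induction x using Submodule.Quotient.induction_on with
  | _ b =>
    rw [← Submodule.Quotient.mk_smul, mirrorMap_mk, mirrorMap_mk, ← Submodule.Quotient.mk_smul,
      smul_eq_mul, smul_eq_mul, map_mul, mirror_mirror]

/-- The automorphism, the exchange of labels and q ↦ -q - c/3 are all involutions, so applying the
automorphism again returns to the original ideal. -/
theorem mirrorMap_eq_zero (N : Label) (Δ q c : ℂ) {x : Verma N Δ q c}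
    (h : mirrorMap N Δ q c x = 0) : x = 0 := by
  induction x using Submodule.Quotient.induction_on with
  | _ b =>
    rw [mirrorMap_mk, Submodule.Quotient.mk_eq_zero] at h
    have h1 := mirror_ideal _ _ _ _ h
    rw [mirror_mirror, show -(-q - c / 3) - c / 3 = q by ring,
      show N.other.other = N by cases N <;> rfl] at h1
    exact (Submodule.Quotient.mk_eq_zero _).2 h1

theorem u_C_comm (a : U) : u C * a = a * u C := by
  obtain ⟨a, rfl⟩ := toU_surjective a
  induction a using FreeAlgebra.induction with
  | grade0 z => rw [AlgHom.commutes]; exact (Algebra.commutes z (u C)).symm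
  | grade1 i => exact sub_eq_zero.1 (sComm_C_u i)
  | mul a b ha hb => rw [map_mul, ← mul_assoc, ha, mul_assoc, hb, mul_assoc]
  | add a b ha hb => rw [map_add, mul_add, add_mul, ha, hb]

theorem u_C_smul {N : Label} (x : Verma N Δ q c) : u C • x = c • x := by
  induction x using Submodule.Quotient.induction_on with
  | _ b =>
    have h : u C - algebraMap ℂ U c ∈ vermaIdeal N Δ q c := Submodule.subset_span (by simp)
    rw [← Submodule.Quotient.mk_smul, ← Submodule.Quotient.mk_smul, ← sub_eq_zero,
      ← Submodule.Quotient.mk_sub, Submodule.Quotient.mk_eq_zero]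
    have : u C • b - c • b = b • (u C - algebraMap ℂ U c) := by
      rw [smul_eq_mul, u_C_comm, smul_eq_mul, mul_sub, ← Algebra.commutes, Algebra.smul_def]
    rw [this]
    exact Submodule.smul_mem _ _ h

/-- Chirality treats G and Q alike. The charge changes sign because H_0 now acts by -(q + n) - c/3,
relative to the highest weight -q - c/3. -/
theorem IsChiral.mirror {N : Label} {m : ℕ} {n : ℤ} {x : Verma N Δ q c} (hx : IsChiral m n x) :
    IsChiral m (-n) (mirrorMap N Δ q c x) where
  level := by
    rw [← mirrorMap_smul, mirror_u]
    simp [mirrorGen, hx.level]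
  charge := by
    rw [← mirrorMap_smul, mirror_u, ← map_smul]
    congr 1
    simp only [mirrorGen, if_true, sub_smul, neg_smul, smul_assoc, hx.charge, u_C_smul]
    push_cast
    module
  annL k hk := by
    rw [← mirrorMap_smul, mirror_u]
    simp [mirrorGen, sub_smul, smul_assoc, hx.annL k hk, hx.annH k hk]
  annH k hk := by
    rw [← mirrorMap_smul, mirror_u]
    simp [mirrorGen, hk.ne', hx.annH k hk]
  annG k hk := by
    rw [← mirrorMap_smul, mirror_u]
    simp [mirrorGen, hx.annQ k hk]
  annQ k hk := by
    rw [← mirrorMap_smul, mirror_u]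
    simp [mirrorGen, hx.annG k hk]

/-! ### Chiral vectors in both kinds of Verma module. -/

/-- Chiral vectors of given level and charge are determined by one coordinate. -/
theorem exists_chiral_functional (N : Label) (Δ q : ℂ) (hc : c ≠ 3) (m : ℕ) (n : ℤ) :
    ∃ φ : Verma N Δ q c →ₗ[ℂ] ℂ, ∀ x, IsChiral m n x → φ x = 0 → x = 0 := by
  cases N with
  | G =>
    refine ⟨Finsupp.lapply (topWord m n) ∘ₗ coords Δ q c, fun x hx h => ?_⟩
    by_contra h0
    exact (hx.topWord_mem hc h0).2 h
  | Q =>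
    refine ⟨Finsupp.lapply (topWord m (-n)) ∘ₗ coords Δ (-q - c / 3) c ∘ₗ mirrorMap .Q Δ q c,
      fun x hx h => mirrorMap_eq_zero .Q Δ q c ?_⟩
    by_contra h0
    exact (hx.mirror.topWord_mem hc h0).2 h

/-- The possible charges of chiral vectors. -/
theorem IsChiral.charge_eq {N : Label} (hc : c ≠ 3) {m : ℕ} {n : ℤ} {x : Verma N Δ q c}
    (hx : IsChiral m n x) (h0 : x ≠ 0) : n = 0 ∨ n = match N with | .G => -1 | .Q => 1 := by
  cases N with
  | G => exact (hx.topWord_mem hc h0).1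
  | Q =>
    have := (hx.mirror.topWord_mem hc fun h => h0 (mirrorMap_eq_zero .Q Δ q c h)).1
    dsimp only
    omega

/-! ### Closed singular vectors -/

theorem u_smul_u_smul {N : Label} (i j : Gen) (x : Verma N Δ q c) :
    u i • u j • x = sg i j • u j • u i • x + linearCombination ℂ u (bracket i j) • x := by
  rw [← mul_smul, u_mul_u, add_smul, smul_assoc, mul_smul]

/-- The charge of the chiral vector obtained from a closed singular vector of charge `n`. -/
def chiralCharge : Label → ℤ → ℤ
  | .G, n => n - 1
  | .Q, n => n + 1

/-- The zero mode not annihilating a closed singular vector maps it to a chiral vector, if its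
conformal weight vanishes. -/
theorem IsClosedSingular.chiral {N K : Label} {m : ℕ} {n : ℤ} {x : Verma N (-(m : ℂ)) q c}
    (hx : IsClosedSingular K m n x) :
    IsChiral m (chiralCharge K n) (u K.other.zeroMode • x) := by
  have hL0 : u (L 0) • x = 0 := by rw [hx.level]; simp
  cases K with
  | G =>
    have hG0 : u (G 0) • x = 0 := hx.ann
    constructor <;> simp only [Label.other, Label.zeroMode, chiralCharge]
    · rw [u_smul_u_smul, hL0]
      simp [bracket]
    · rw [u_smul_u_smul, hx.charge]
      simp only [bracket, sg, odd, Bool.false_and, Bool.false_eq_true, if_false,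
        one_smul, smul_comm _ (q + n : ℂ), linearCombination_single, smul_assoc, add_zero]
      generalize u (Q 0) • x = y
      push_cast
      module
    · intro k hk
      rw [u_smul_u_smul, hx.annL k hk]
      simp [bracket]
    · intro k hk
      rw [u_smul_u_smul, hx.annH k hk]
      simp [bracket, hx.annQ k hk]
    · intro k hk
      rw [u_smul_u_smul]
      rcases hk.eq_or_lt with rfl | hk
      -- Here Δ = -m is essential: G_0 Q_0 x = 2 L_0 x - Q_0 G_0 x, and both terms vanish.
      · simp [bracket, hG0, smul_assoc, hL0]
      · simp [bracket, hx.annG k hk, smul_assoc, hx.annL k hk, hk.ne']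
    · intro k hk
      rw [u_smul_u_smul]
      rcases hk.eq_or_lt with rfl | hk
      · have h := u_sq (Q 0) (by norm_num [sg, odd])
        rw [← mul_smul, h]
        simp [bracket]
      · simp [bracket, hx.annQ k hk]
  | Q =>
    have hQ0 : u (Q 0) • x = 0 := hx.ann
    constructor <;> simp only [Label.other, Label.zeroMode, chiralCharge]
    · rw [u_smul_u_smul, hL0]
      simp [bracket]
    · rw [u_smul_u_smul, hx.charge]
      simp only [bracket, sg, odd, Bool.false_and, Bool.false_eq_true, if_false,
        one_smul, smul_comm _ (q + n : ℂ), linearCombination_single, add_zero]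
      generalize u (G 0) • x = y
      push_cast
      module
    · intro k hk
      rw [u_smul_u_smul, hx.annL k hk]
      simp [bracket, smul_assoc, hx.annG k hk]
    · intro k hk
      rw [u_smul_u_smul, hx.annH k hk]
      simp [bracket, hx.annG k hk]
    · intro k hk
      rw [u_smul_u_smul]
      rcases hk.eq_or_lt with rfl | hk
      · have h := u_sq (G 0) (by norm_num [sg, odd])
        rw [← mul_smul, h]
        simp [bracket]
      · simp [bracket, hx.annG k hk]
    · intro k hk
      rw [u_smul_u_smul]
      rcases hk.eq_or_lt with rfl | hk
      · simp [bracket, hQ0, smul_assoc, hL0]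
      · simp [bracket, hx.annQ k hk, smul_assoc, hx.annL k hk, hx.annH k hk, hk.ne', add_smul,
          -Finsupp.single_mul]

/-- The nonzero entries of the table sit exactly where the shifted charge is one that a nonzero
chiral vector may have. -/
theorem not_isClosedSingular (hc : c ≠ 3) {N K : Label} {m : ℕ} {n : ℤ}
    (h : maxDim N K n = 0) (x : Verma N (-(m : ℂ)) q c) : ¬ IsClosedSingular K m n x := by
  intro hx
  have h1 := hx.chiral.charge_eq hc hx.not_ann
  cases N <;> cases K <;> simp only [chiralCharge] at h1 <;> rcases h1 with h1 | h1
  · obtain rfl : n = 1 := by omega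
    simp [maxDim] at h
  · obtain rfl : n = 0 := by omega
    simp [maxDim] at h
  · obtain rfl : n = -1 := by omega
    simp [maxDim] at h
  · obtain rfl : n = -2 := by omega
    simp [maxDim] at h
  · obtain rfl : n = 1 := by omega
    simp [maxDim] at h
  · obtain rfl : n = 2 := by omega
    simp [maxDim] at h
  · obtain rfl : n = -1 := by omega
    simp [maxDim] at h
  · obtain rfl : n = 0 := by omega
    simp [maxDim] at h

/-- The zero mode that kills no nonzero element of `W`, followed by the functional detecting chiral
vectors, embeds `W` into ℂ. -/
theorem rank_closedSingularSpace_le_one (hc : c ≠ 3) {N K : Label} {m : ℕ} {n : ℤ}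
    {W : Submodule ℂ (Verma N (-(m : ℂ)) q c)} (hW : IsClosedSingularSpace K m n W) :
    Module.rank ℂ W ≤ 1 := by
  obtain ⟨φ, hφ⟩ := exists_chiral_functional N (-(m : ℂ)) q hc m (chiralCharge K n)
  have hinj : Function.Injective
      (φ ∘ₗ Algebra.lsmul ℂ ℂ (Verma N (-(m : ℂ)) q c) (u K.other.zeroMode) ∘ₗ W.subtype) := by
    rw [← LinearMap.ker_eq_bot, LinearMap.ker_eq_bot']
    intro w hw
    by_contra h0
    have hx := hW w w.2 fun h => h0 (Subtype.ext h)
    exact hx.not_ann (hφ _ hx.chiral hw)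
  have := LinearMap.rank_le_of_injective _ hinj
  rwa [CommSemiring.rank_self] at this

end TopN2
end

theorem mainTheorem8 (c q : ℂ) (hc : c ≠ 3) (m : ℕ) (hm : 1 ≤ m) (N K : TopN2.Label) (n : ℤ) :
    (∀ W : Submodule ℂ (TopN2.Verma N (-(m : ℂ)) q c),
      TopN2.IsClosedSingularSpace K m n W →
        Module.rank ℂ W ≤ (TopN2.maxDim N K n : Cardinal)) ∧
    (TopN2.maxDim N K n = 0 →
      ∀ x : TopN2.Verma N (-(m : ℂ)) q c, ¬ TopN2.IsClosedSingular K m n x) := by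
  refine ⟨fun W hW => ?_, fun h x => TopN2.not_isClosedSingular hc h x⟩
  by_cases h : TopN2.maxDim N K n = 0
  · have hW0 : W = ⊥ := (Submodule.eq_bot_iff W).2 fun x hx => by
      by_contra h0
      exact TopN2.not_isClosedSingular hc h x (hW x hx h0)
    rw [hW0, rank_bot, h]
    simp
  · refine (TopN2.rank_closedSingularSpace_le_one hc hW).trans ?_
    exact_mod_cast Nat.one_le_iff_ne_zero.2 h
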